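/- Let $X$ be a (finite-dimensional) complex manifold, $A\to X$ a holomorphic vector bundle of finite rank, and let $(A\to X,\rho,[\cdot,\cdot])$ be a holomorphic Lie algebroid: $\rho:A\to TX$ is a holomorphic bundle map and the sheaf $\mathcal A$ of holomorphic sections of $A$ is a sheaf of complex Lie algebras such that $\rho$ induces a morphism of sheaves of Lie algebras and $[V,fW]=(\rho(V)f)W+f[V,W]$ for holomorphic sections $V,W$ and holomorphic functions $f$ over any open set. Real Lie algebroids are defined in the same way with smooth sections and smooth real functions. Write $j$ for multiplication by $\sqrt{-1}$ in the fibers of $A$. For a real or holomorphic Lie algebroid on $A$, the associated fiberwise-linear Poisson structure on the (real or complex) dual bundle $p:A^*\to X$ is the one with $$\{l_V,l_W\}=l_{[V,W]},\qquad \{l_V,p^*f\}=p^*(\rho(V)f),\qquad l_V(\xi)=\xi(V(p(\xi))).$$ Here a Poisson structure on $A^*$ is called fiberwise linear if brackets of fiberwise-linear functions are fiberwise linear, brackets of a fiberwise-linear function and a function pulled back from $X$ are pulled back from $X$, and brackets of two functions pulled back from $X$ vanish. (0) There is a unique such fiberwise-linear holomorphic Poisson structure $\pi$ on $\mathrm{Hom}_{\mathbb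 C}(A,\mathbb C)$. There is a unique real Lie algebroid structure $A_R$ on the underlying real vector bundle of $A$ with anchor $\rho$ whose bracket extends the bracket of holomorphic sections. The formulas $\rho_j=\rho\circ j$ and $[V,W]_j=[jV,W]+[V,jW]-j[V,W]$, where $[\cdot,\cdot]$ is the bracket of $A_R$, define a real Lie algebroid $A_I=(A_R)_j$. Write $\pi=\pi_R+i\pi_I$ with real bivector fields $\pi_R,\pi_I$ on $\mathrm{Hom}_{\mathbb C}(A,\mathbb C)$, and let $\Psi:\mathrm{Hom}_{\mathbb R}(A,\mathbb R)\to\mathrm{Hom}_{\mathbb C}(A,\mathbb C)$, $\Psi(f)(v)=f(v)-i\,f(jv)$. Then $\Psi^{-1}_*\pi_R$ and $\Psi^{-1}_*\pi_I$ are fiberwise $\mathbb R$-linear Poisson structures on the real dual bundle $\mathrm{Hom}_{\mathbb R}(A,\mathbb R)$, and each is associated to a unique real Lie algebroid structure on $A$, denoted $A_\Re=(A,\rho_\Re,[\cdot,\cdot]_\Re)$ and $A_\Im=(A,\rho_\Im,[\cdot,\cdot]_\Im)$ respectively. Moreover: (1) the Lie algebroid $(A,4\rho_\Re,4[\cdot,\cdot]_\Re)$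 is isomorphic to $A_R$; (2) the Lie algebroid $(A,-4\rho_\Im,-4[\cdot,\cdot]_\Im)$ is isomorphic to $A_I$; and in both cases the identity map of $A$ is an isomorphism. -/

import Mathlib

open Bundle Set TopologicalSpace VectorField
open scoped Manifold ContDiff

noncomputable section

/-! ### Local sections of a vector bundle of class `C^n` -/

section Sections

variable {𝕜 : Type*} [NontriviallyNormedField 𝕜]
  {E : Type*} [NormedAddCommGroup E] [NormedSpace 𝕜 E]
  {H : Type*} [TopologicalSpace H]
  {X : Type*} [TopologicalSpace X] [ChartedSpace H X]

/-- The `𝕜`-module `Γ(U, A)` of sections of class `C^n` of the vector bundle `A` over the open set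
`U`.  A section over `U` is stored as its extension by zero to all of `X`, so that elements of
`Γ(U, A)` are in bijection with the `C^n` sections of the restriction of `A` to `U`. -/
def LocalSections (n : ℕ∞ω) (I : ModelWithCorners 𝕜 E H)
    (F : Type*) [NormedAddCommGroup F] [NormedSpace 𝕜 F]
    (A : X → Type*) [TopologicalSpace (TotalSpace F A)]
    [∀ x, AddCommGroup (A x)] [∀ x, Module 𝕜 (A x)] [∀ x, TopologicalSpace (A x)]
    [FiberBundle F A] [VectorBundle 𝕜 F A] (U : Opens X) : Submodule 𝕜 (Π x, A x) where
  carrier := {s | ContMDiffOn I (I.prod 𝓘(𝕜, F)) n (fun x => TotalSpace.mk' F x (s x)) U ∧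
    ∀ x ∉ U, s x = 0}
  add_mem' := fun {s t} hs ht => ⟨hs.1.add_section ht.1, fun x hx => by
    simp [hs.2 x hx, ht.2 x hx]⟩
  zero_mem' := ⟨(contMDiff_zeroSection 𝕜 A).contMDiffOn, fun x _ => rfl⟩
  smul_mem' := fun c s hs => ⟨hs.1.const_smul_section, fun x hx => by simp [hs.2 x hx]⟩

variable {n : ℕ∞ω} {I : ModelWithCorners 𝕜 E H}
  {F : Type*} [NormedAddCommGroup F] [NormedSpace 𝕜 F]
  {A : X → Type*} [TopologicalSpace (TotalSpace F A)]
  [∀ x, AddCommGroup (A x)] [∀ x, Module 𝕜 (A x)] [∀ x, TopologicalSpace (A x)]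
  [FiberBundle F A] [VectorBundle 𝕜 F A]

/-- The product `f V` of a `C^n` function `f` on `U` and a section `V` over `U`. -/
def LocalSections.fsmul {U : Opens X} (f : X → 𝕜) (hf : ContMDiffOn I 𝓘(𝕜, 𝕜) n f U)
    (V : LocalSections n I F A U) : LocalSections n I F A U :=
  ⟨fun x => f x • V.1 x, ContMDiffOn.smul_section hf V.2.1, fun x hx => by simp [V.2.2 x hx]⟩

end Sections

/-! ### Lie algebroids -/

/-- A Lie algebroid of class `C^n` over the field `𝕜` on the vector bundle `A → X`: an anchor
`ρ : A → TX` that is a `C^n` bundle map, and a structure of sheaf of `𝕜`-Lie algebras on the sheaf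
of `C^n` sections of `A`, such that the anchor is a morphism of sheaves of Lie algebras and the
Leibniz identity `[V, fW] = (ρ(V) f) W + f [V, W]` holds.
For `𝕜 = ℂ` and `n = ω` this is a holomorphic Lie algebroid; for `𝕜 = ℝ` and `n = ∞` it is a
(smooth, real) Lie algebroid. -/
structure LieAlgebroid {𝕜 : Type*} [NontriviallyNormedField 𝕜]
    {E : Type*} [NormedAddCommGroup E] [NormedSpace 𝕜 E]
    {H : Type*} [TopologicalSpace H]
    {X : Type*} [TopologicalSpace X] [ChartedSpace H X]
    (n : ℕ∞ω) (I : ModelWithCorners 𝕜 E H) [IsManifold I 1 X]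
    (F : Type*) [NormedAddCommGroup F] [NormedSpace 𝕜 F]
    (A : X → Type*) [TopologicalSpace (TotalSpace F A)]
    [∀ x, AddCommGroup (A x)] [∀ x, Module 𝕜 (A x)] [∀ x, TopologicalSpace (A x)]
    [FiberBundle F A] [VectorBundle 𝕜 F A] where
  anchor : Π x, A x →ₗ[𝕜] TangentSpace I x
  contMDiff_anchor : ContMDiff (I.prod 𝓘(𝕜, F)) I.tangent n
    (fun v : TotalSpace F A => (⟨v.1, anchor v.1 v.2⟩ : TangentBundle I X))
  bracket : Π U : Opens X,
    LocalSections n I F A U →ₗ[𝕜] LocalSections n I F A U →ₗ[𝕜] LocalSections n I F A U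
  /-- compatibility with restrictions -/
  bracket_restrict : ∀ (U U' : Opens X), U' ≤ U → ∀ (V W : LocalSections n I F A U)
    (V' W' : LocalSections n I F A U'),
    (∀ x ∈ U', V'.1 x = V.1 x) → (∀ x ∈ U', W'.1 x = W.1 x) →
    ∀ x ∈ U', (bracket U' V' W').1 x = (bracket U V W).1 x
  bracket_self : ∀ (U : Opens X) (V : LocalSections n I F A U), bracket U V V = 0
  jacobi : ∀ (U : Opens X) (V W Z : LocalSections n I F A U),
    bracket U V (bracket U W Z) + bracket U W (bracket U Z V) + bracket U Z (bracket U V W) = 0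
  anchor_bracket : ∀ (U : Opens X) (V W : LocalSections n I F A U), ∀ x ∈ U,
    anchor x ((bracket U V W).1 x) =
      mlieBracket I (fun y => anchor y (V.1 y)) (fun y => anchor y (W.1 y)) x
  leibniz : ∀ (U : Opens X) (V W : LocalSections n I F A U) (f : X → 𝕜)
    (hf : ContMDiffOn I 𝓘(𝕜, 𝕜) n f U), ∀ x ∈ U,
    (bracket U V (LocalSections.fsmul f hf W)).1 x =
      mvfderiv I f x (anchor x (V.1 x)) • W.1 x + f x • (bracket U V W).1 x

namespace LieAlgebroid

section Iso

variable {𝕜 : Type*} [NontriviallyNormedField 𝕜]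
  {E : Type*} [NormedAddCommGroup E] [NormedSpace 𝕜 E]
  {H : Type*} [TopologicalSpace H]
  {X : Type*} [TopologicalSpace X] [ChartedSpace H X]
  {n : ℕ∞ω} {I : ModelWithCorners 𝕜 E H} [IsManifold I 1 X]
  {F : Type*} [NormedAddCommGroup F] [NormedSpace 𝕜 F]
  {A : X → Type*} [TopologicalSpace (TotalSpace F A)]
  [∀ x, AddCommGroup (A x)] [∀ x, Module 𝕜 (A x)] [∀ x, TopologicalSpace (A x)]
  [FiberBundle F A] [VectorBundle 𝕜 F A]
  {F' : Type*} [NormedAddCommGroup F'] [NormedSpace 𝕜 F']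
  {A' : X → Type*} [TopologicalSpace (TotalSpace F' A')]
  [∀ x, AddCommGroup (A' x)] [∀ x, Module 𝕜 (A' x)] [∀ x, TopologicalSpace (A' x)]
  [FiberBundle F' A'] [VectorBundle 𝕜 F' A']

/-- An isomorphism of Lie algebroids over the same base (covering the identity). -/
structure Iso (L : LieAlgebroid n I F A) (L' : LieAlgebroid n I F' A') where
  fiber : Π x, A x ≃ₗ[𝕜] A' x
  contMDiff_fiber : ContMDiff (I.prod 𝓘(𝕜, F)) (I.prod 𝓘(𝕜, F')) n
    (fun v : TotalSpace F A => (⟨v.1, fiber v.1 v.2⟩ : TotalSpace F' A'))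
  contMDiff_fiber_symm : ContMDiff (I.prod 𝓘(𝕜, F')) (I.prod 𝓘(𝕜, F)) n
    (fun v : TotalSpace F' A' => (⟨v.1, (fiber v.1).symm v.2⟩ : TotalSpace F A))
  anchor_comm : ∀ x v, L'.anchor x (fiber x v) = L.anchor x v
  bracket_comm : ∀ (U : Opens X) (V W : LocalSections n I F A U) (V' W' : LocalSections n I F' A' U),
    (∀ x, V'.1 x = fiber x (V.1 x)) → (∀ x, W'.1 x = fiber x (W.1 x)) →
    ∀ x, (L'.bracket U V' W').1 x = fiber x ((L.bracket U V W).1 x)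

end Iso

end LieAlgebroid

/-! ### Fiberwise endomorphisms, and scaling a real Lie algebroid -/

section Endo

variable {𝕜 : Type*} [NontriviallyNormedField 𝕜]
  {E : Type*} [NormedAddCommGroup E] [NormedSpace 𝕜 E]
  {H : Type*} [TopologicalSpace H]
  {X : Type*} [TopologicalSpace X] [ChartedSpace H X]
  {n : ℕ∞ω} {I : ModelWithCorners 𝕜 E H}
  {E' : Type*} [NormedAddCommGroup E'] [NormedSpace 𝕜 E']
  {H' : Type*} [TopologicalSpace H']
  {M : Type*} [TopologicalSpace M] [ChartedSpace H' M] {J : ModelWithCorners 𝕜 E' H'}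
  {F : Type*} [NormedAddCommGroup F] [NormedSpace 𝕜 F]
  {A : X → Type*} [TopologicalSpace (TotalSpace F A)]
  [∀ x, TopologicalSpace (A x)]
  [FiberBundle F A]

/-- A fiberwise operation which is the same continuous linear map in all trivializations preserves
smoothness of maps into the total space. -/
theorem contMDiffOn_fiberwise (T : Π x, A x → A x) (T₀ : F →L[𝕜] F)
    (hT : ∀ x₀ x, x ∈ (trivializationAt F A x₀).baseSet → ∀ v : A x,
      (trivializationAt F A x₀ ⟨x, T x v⟩).2 = T₀ (trivializationAt F A x₀ ⟨x, v⟩).2)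
    {g : M → TotalSpace F A} {s : Set M} (hg : ContMDiffOn J (I.prod 𝓘(𝕜, F)) n g s) :
    ContMDiffOn J (I.prod 𝓘(𝕜, F)) n
      (fun m => (⟨(g m).1, T (g m).1 (g m).2⟩ : TotalSpace F A)) s := by
  intro m hm
  have h := hg m hm
  rw [contMDiffWithinAt_totalSpace] at h ⊢
  refine ⟨h.1, ?_⟩
  have hb : ∀ᶠ m' in nhdsWithin m s, (g m').1 ∈ (trivializationAt F A (g m).1).baseSet :=
    h.1.continuousWithinAt.preimage_mem_nhdsWithin
      ((trivializationAt F A (g m).1).open_baseSet.mem_nhds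
        (FiberBundle.mem_baseSet_trivializationAt' _))
  refine (T₀.contMDiff.contMDiffAt.comp_contMDiffWithinAt m h.2).congr_of_eventuallyEq ?_ ?_
  · filter_upwards [hb] with m' hm'
    exact hT _ _ hm' _
  · exact hT _ _ (FiberBundle.mem_baseSet_trivializationAt' _) _

end Endo

namespace LieAlgebroid

variable {E : Type*} [NormedAddCommGroup E] [NormedSpace ℝ E] [FiniteDimensional ℝ E]
  {H : Type*} [TopologicalSpace H]
  {X : Type*} [TopologicalSpace X] [ChartedSpace H X]
  {I : ModelWithCorners ℝ E H} [IsManifold I ∞ X]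
  {F : Type*} [NormedAddCommGroup F] [NormedSpace ℝ F]
  {A : X → Type*} [TopologicalSpace (TotalSpace F A)]
  [∀ x, AddCommGroup (A x)] [∀ x, Module ℝ (A x)] [∀ x, TopologicalSpace (A x)]
  [FiberBundle F A] [VectorBundle ℝ F A]

/-- The Lie algebroid `(A, c ρ, c [·,·])` obtained from `(A, ρ, [·,·])` by scaling with `c`. -/
def scale (c : ℝ) (L : LieAlgebroid ∞ I F A) : LieAlgebroid ∞ I F A where
  anchor x := c • L.anchor x
  contMDiff_anchor := by
    have h := contMDiffOn_fiberwise (I := I) (F := E) (A := (TangentSpace I : X → Type _))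
      (fun x v => c • v) (c • ContinuousLinearMap.id ℝ E)
      (fun x₀ x hx v => ((trivializationAt E (TangentSpace I) x₀).linear ℝ hx).map_smul c v)
      L.contMDiff_anchor.contMDiffOn (s := univ)
    exact contMDiffOn_univ.1 h
  bracket U := c • L.bracket U
  bracket_restrict U U' h V W V' W' hV hW x hx := by
    have := L.bracket_restrict U U' h V W V' W' hV hW x hx
    simp [this]
  bracket_self U V := by simp [L.bracket_self]
  jacobi U V W Z := by
    have := L.jacobi U V W Z
    simp only [LinearMap.smul_apply, map_smul]
    rw [← smul_add, ← smul_add, ← smul_add, ← smul_add, this, smul_zero, smul_zero]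
  anchor_bracket U V W x hx := by
    have : CompleteSpace E := FiniteDimensional.complete ℝ E
    have hd : ∀ V : LocalSections ∞ I F A U, MDifferentiableAt I I.tangent
        (fun y => (⟨y, L.anchor y (V.1 y)⟩ : TangentBundle I X)) x := fun V =>
      ((L.contMDiff_anchor.comp_contMDiffOn V.2.1).contMDiffAt
        (U.isOpen.mem_nhds hx)).mdifferentiableAt (by simp)
    have h1 := mlieBracket_const_smul_left (I := I) (c := c) (W := fun y => c • L.anchor y (W.1 y))
      (hd V)
    have h2 := mlieBracket_const_smul_right (I := I) (c := c) (V := fun y => L.anchor y (V.1 y))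
      (hd W)
    have h3 := L.anchor_bracket U V W x hx
    change c • L.anchor x (c • (L.bracket U V W).1 x) =
      mlieBracket I (c • fun y => L.anchor y (V.1 y)) (fun y => c • L.anchor y (W.1 y)) x
    rw [h1, map_smul, h3]
    exact congrArg (c • ·) h2.symm
  leibniz U V W f hf x hx := by
    have := L.leibniz U V W f hf x hx
    simp only [LinearMap.smul_apply, map_smul, Submodule.coe_smul, Pi.smul_apply, this, smul_add,
      smul_smul, smul_eq_mul, mul_comm]

end LieAlgebroid

/-! ### Poisson tensors -/

/-- A field of `𝕜`-bilinear forms on the cotangent spaces of `M`. -/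
abbrev CotangentForm {𝕜 : Type*} [NontriviallyNormedField 𝕜]
    {E : Type*} [NormedAddCommGroup E] [NormedSpace 𝕜 E]
    {H : Type*} [TopologicalSpace H] (I : ModelWithCorners 𝕜 E H)
    (M : Type*) [TopologicalSpace M] [ChartedSpace H M] :=
  Π m : M, (TangentSpace I m →L[𝕜] 𝕜) →ₗ[𝕜] (TangentSpace I m →L[𝕜] 𝕜) →ₗ[𝕜] 𝕜

namespace CotangentForm

variable {𝕜 : Type*} [NontriviallyNormedField 𝕜]
  {E : Type*} [NormedAddCommGroup E] [NormedSpace 𝕜 E]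
  {H : Type*} [TopologicalSpace H] {I : ModelWithCorners 𝕜 E H}
  {M : Type*} [TopologicalSpace M] [ChartedSpace H M]
  {E' : Type*} [NormedAddCommGroup E'] [NormedSpace 𝕜 E']
  {H' : Type*} [TopologicalSpace H'] {I' : ModelWithCorners 𝕜 E' H'}
  {M' : Type*} [TopologicalSpace M'] [ChartedSpace H' M']

/-- The bracket `{f, g} = P(df, dg)` of functions. -/
def bracket (P : CotangentForm I M) (f g : M → 𝕜) : M → 𝕜 :=
  fun m => P m (mvfderiv I f m) (mvfderiv I g m)

/-- `P` is a Poisson tensor of class `C^n`: it is a bivector field (alternating), of class `C^n`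
(brackets of local `C^n` functions are `C^n`), and its bracket satisfies the Jacobi identity on
local `C^n` functions. For `𝕜 = ℂ` and `n = ω` these are the holomorphic Poisson tensors. -/
structure IsPoisson (n : ℕ∞ω) (P : CotangentForm I M) : Prop where
  alternating : ∀ m α, P m α α = 0
  contMDiffOn_bracket : ∀ (U : Opens M) (f g : M → 𝕜), ContMDiffOn I 𝓘(𝕜, 𝕜) n f U →
    ContMDiffOn I 𝓘(𝕜, 𝕜) n g U → ContMDiffOn I 𝓘(𝕜, 𝕜) n (P.bracket f g) U
  jacobi : ∀ (U : Opens M) (f g h : M → 𝕜), ContMDiffOn I 𝓘(𝕜, 𝕜) n f U →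
    ContMDiffOn I 𝓘(𝕜, 𝕜) n g U → ContMDiffOn I 𝓘(𝕜, 𝕜) n h U → ∀ m ∈ U,
    P.bracket f (P.bracket g h) m + P.bracket g (P.bracket h f) m
      + P.bracket h (P.bracket f g) m = 0

/-- For a diffeomorphism `Φ : M' → M`, the pullback `Φ^* P = (Φ⁻¹)_* P`. -/
def pullback (I' : ModelWithCorners 𝕜 E' H') (Φ : M' → M) (P : CotangentForm I M) :
    CotangentForm I' M' := fun m =>
  LinearMap.mk₂ 𝕜
    (fun α β => P (Φ m) (α ∘L (mfderiv I' I Φ m).inverse) (β ∘L (mfderiv I' I Φ m).inverse))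
    (by intros; simp [ContinuousLinearMap.add_comp])
    (by intros; simp [ContinuousLinearMap.smul_comp])
    (by intros; simp [ContinuousLinearMap.add_comp])
    (by intros; simp [ContinuousLinearMap.smul_comp])

end CotangentForm

/-! ### Fiberwise linear Poisson structures on the dual bundle -/

/-- The dual bundle `A^* = Hom_𝕜(A, 𝕜)`, as a family of vector spaces. -/
abbrev DualBundle (𝕜 : Type*) [NontriviallyNormedField 𝕜] {X : Type*} (A : X → Type*)
    [∀ x, AddCommGroup (A x)] [∀ x, Module 𝕜 (A x)] [∀ x, TopologicalSpace (A x)] : X → Type _ :=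
  fun x => A x →L[𝕜] Trivial X 𝕜 x

/-- The total space of the dual bundle `A^*`. -/
abbrev DualTotal (𝕜 : Type*) [NontriviallyNormedField 𝕜] {X : Type*}
    (F : Type*) [NormedAddCommGroup F] [NormedSpace 𝕜 F] (A : X → Type*)
    [∀ x, AddCommGroup (A x)] [∀ x, Module 𝕜 (A x)] [∀ x, TopologicalSpace (A x)] :=
  TotalSpace (F →L[𝕜] 𝕜) (DualBundle 𝕜 A)

section LiePoisson

variable {𝕜 : Type*} [NontriviallyNormedField 𝕜]
  {E : Type*} [NormedAddCommGroup E] [NormedSpace 𝕜 E]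
  {H : Type*} [TopologicalSpace H]
  {X : Type*} [TopologicalSpace X] [ChartedSpace H X]
  {n : ℕ∞ω} {I : ModelWithCorners 𝕜 E H} [IsManifold I 1 X]
  {F : Type*} [NormedAddCommGroup F] [NormedSpace 𝕜 F]
  {A : X → Type*} [TopologicalSpace (TotalSpace F A)]
  [∀ x, AddCommGroup (A x)] [∀ x, Module 𝕜 (A x)] [∀ x, TopologicalSpace (A x)]
  [FiberBundle F A] [VectorBundle 𝕜 F A]

/-- The fiberwise linear function `l_V(ξ) = ξ(V(p(ξ)))` on the dual bundle defined by a section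
`V` over `U`; only its values on `p⁻¹(U)` are relevant. -/
def linFun {U : Opens X} (V : LocalSections n I F A U) : DualTotal 𝕜 F A → 𝕜 :=
  fun ξ => ξ.2 (V.1 ξ.1)

/-- The function `p^* f` on the dual bundle. -/
def dualPull (F : Type*) [NormedAddCommGroup F] [NormedSpace 𝕜 F] (A : X → Type*)
    [∀ x, AddCommGroup (A x)] [∀ x, Module 𝕜 (A x)] [∀ x, TopologicalSpace (A x)]
    (f : X → 𝕜) : DualTotal 𝕜 F A → 𝕜 :=
  fun ξ => f ξ.1

/-- `P` is fiberwise linear: over every open set `U`, the bracket of two fiberwise linear functions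
is fiberwise linear, the bracket of a fiberwise linear function and a basic function is basic, and
the bracket of two basic functions vanishes (the last two conditions follow from the first one
when the rank is positive). -/
structure CotangentForm.IsFiberwiseLinear (n : ℕ∞ω)
    (P : CotangentForm (I.prod 𝓘(𝕜, F →L[𝕜] 𝕜)) (DualTotal 𝕜 F A)) : Prop where
  lin_lin : ∀ (U : Opens X) (V W : LocalSections n I F A U), ∃ Z : LocalSections n I F A U,
    ∀ ξ : DualTotal 𝕜 F A, ξ.1 ∈ U → P.bracket (linFun V) (linFun W) ξ = linFun Z ξ
  lin_basic : ∀ (U : Opens X) (V : LocalSections n I F A U) (f : X → 𝕜),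
    ContMDiffOn I 𝓘(𝕜, 𝕜) n f U → ∃ g : X → 𝕜, ContMDiffOn I 𝓘(𝕜, 𝕜) n g U ∧
      ∀ ξ : DualTotal 𝕜 F A, ξ.1 ∈ U → P.bracket (linFun V) (dualPull F A f) ξ = dualPull F A g ξ
  basic_basic : ∀ (U : Opens X) (f g : X → 𝕜),
    ContMDiffOn I 𝓘(𝕜, 𝕜) n f U → ContMDiffOn I 𝓘(𝕜, 𝕜) n g U →
      ∀ ξ : DualTotal 𝕜 F A, ξ.1 ∈ U → P.bracket (dualPull F A f) (dualPull F A g) ξ = 0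

/-- `P` is the fiberwise linear Poisson structure on `A^*` corresponding to the Lie algebroid
structure `L` on `A`: `{l_V, l_W} = l_{[V, W]}` and `{l_V, p^* f} = p^*(ρ(V) f)`. -/
structure LieAlgebroid.IsLiePoisson (L : LieAlgebroid n I F A)
    (P : CotangentForm (I.prod 𝓘(𝕜, F →L[𝕜] 𝕜)) (DualTotal 𝕜 F A)) : Prop where
  isPoisson : P.IsPoisson n
  isFiberwiseLinear : P.IsFiberwiseLinear n
  bracket_lin_lin : ∀ (U : Opens X) (V W : LocalSections n I F A U),
    ∀ ξ : DualTotal 𝕜 F A, ξ.1 ∈ U → P.bracket (linFun V) (linFun W) ξ = linFun (L.bracket U V W) ξ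
  bracket_lin_basic : ∀ (U : Opens X) (V : LocalSections n I F A U) (f : X → 𝕜),
    ContMDiffOn I 𝓘(𝕜, 𝕜) n f U → ∀ ξ : DualTotal 𝕜 F A, ξ.1 ∈ U →
      P.bracket (linFun V) (dualPull F A f) ξ =
        dualPull F A (fun x => mvfderiv I f x (L.anchor x (V.1 x))) ξ

end LiePoisson

/-! ### Underlying real structures of complex ones -/

section Realification

variable {E : Type*} [NormedAddCommGroup E] [NormedSpace ℂ E]
  {X : Type*} [TopologicalSpace X] [ChartedSpace E X]
  {n : ℕ∞ω}
  {F : Type*} [NormedAddCommGroup F] [NormedSpace ℂ F]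
  {A : X → Type*} [TopologicalSpace (TotalSpace F A)]
  [∀ x, AddCommGroup (A x)] [∀ x, Module ℂ (A x)] [∀ x, TopologicalSpace (A x)]
  [FiberBundle F A]

/-- A complex manifold is a real manifold. -/
instance isManifold_complexToReal [h : IsManifold 𝓘(ℂ, E) n X] : IsManifold 𝓘(ℝ, E) n X := by
  refine isManifold_of_contDiffOn _ _ _ fun e e' he he' => ?_
  have := (contDiffGroupoid n 𝓘(ℂ, E)).compatible he he'
  rw [contDiffGroupoid, mem_groupoid_of_pregroupoid] at this
  exact ContDiffOn.restrict_scalars ℝ this.1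

/-- A complex vector bundle is a real vector bundle. -/
instance vectorBundle_complexToReal [VectorBundle ℂ F A] : VectorBundle ℝ F A :=
  have hlin : ∀ (e : Trivialization F (π F A)) [MemTrivializationAtlas e], e.IsLinear ℝ :=
    fun e he => ⟨fun b hb => ⟨(e.linear ℂ hb).map_add, fun c v => by
      have := (e.linear ℂ hb).map_smul (c : ℂ) v
      simpa using this⟩⟩
  { trivialization_linear' := hlin
    continuousOn_coordChange' := fun e e' he he' => by
      have := hlin e
      have := hlin e'
      refine ((ContinuousLinearMap.restrictScalarsL ℂ F F ℝ ℝ).continuous.comp_continuousOn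
        (continuousOn_coordChange ℂ e e')).congr fun b hb => ?_
      ext v
      simp [Trivialization.coordChangeL_apply _ _ hb] }

/-- A holomorphic vector bundle is a smooth real vector bundle. -/
instance contMDiffVectorBundle_complexToReal [VectorBundle ℂ F A]
    [h : ContMDiffVectorBundle n F A 𝓘(ℂ, E)] : ContMDiffVectorBundle n F A 𝓘(ℝ, E) where
  contMDiffOn_coordChangeL e e' he he' := by
    have h1 : ContMDiffOn 𝓘(ℝ, E) 𝓘(ℝ, F →L[ℂ] F) n
        (fun b : X => (e.coordChangeL ℂ e' b : F →L[ℂ] F)) (e.baseSet ∩ e'.baseSet) := fun x hx =>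
      ⟨(h.contMDiffOn_coordChangeL e e' x hx).1,
        ContDiffWithinAt.restrict_scalars ℝ (h.contMDiffOn_coordChangeL e e' x hx).2⟩
    refine ((ContinuousLinearMap.restrictScalarsL ℂ F F ℝ ℝ).contMDiff.comp_contMDiffOn
      h1).congr fun b hb => ?_
    ext v
    simp [Trivialization.coordChangeL_apply _ _ hb]

/-- The inclusion of holomorphic sections into smooth sections. -/
def toSmooth [VectorBundle ℂ F A] {U : Opens X}
    (V : LocalSections ω 𝓘(ℂ, E) F A U) : LocalSections ∞ 𝓘(ℝ, E) F A U :=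
  ⟨V.1, fun x hx => ⟨(V.2.1 x hx).1,
    (ContDiffWithinAt.restrict_scalars ℝ (V.2.1 x hx).2).of_le le_top⟩, V.2.2⟩

/-- The endomorphism `j` of smooth sections given by multiplication by `√-1` in the fibers. -/
def jmul [VectorBundle ℂ F A] {U : Opens X}
    (V : LocalSections ∞ 𝓘(ℝ, E) F A U) : LocalSections ∞ 𝓘(ℝ, E) F A U :=
  ⟨fun x => Complex.I • V.1 x, by
    have h := contMDiffOn_fiberwise (I := 𝓘(ℝ, E)) (F := F) (A := A)
      (fun x v => Complex.I • v) (Complex.I • ContinuousLinearMap.id ℝ F)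
      (fun x₀ x hx v => ((trivializationAt F A x₀).linear ℂ hx).map_smul Complex.I v) V.2.1
    exact h, fun x hx => by simp [V.2.2 x hx]⟩

/-- `R` is the underlying real Lie algebroid `A_R` of the holomorphic Lie algebroid `L`: it is a
real Lie algebroid structure on the underlying smooth real vector bundle, with the same anchor,
such that the inclusion of holomorphic sections into smooth sections preserves brackets. -/
structure LieAlgebroid.IsUnderlyingReal [IsManifold 𝓘(ℂ, E) ω X] [VectorBundle ℂ F A]
    (L : LieAlgebroid ω 𝓘(ℂ, E) F A) (R : LieAlgebroid ∞ 𝓘(ℝ, E) F A) : Prop where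
  anchor_eq : ∀ x (v : A x), (R.anchor x v : E) = L.anchor x v
  bracket_eq : ∀ (U : Opens X) (V W : LocalSections ω 𝓘(ℂ, E) F A U),
    R.bracket U (toSmooth V) (toSmooth W) = toSmooth (L.bracket U V W)

/-- `D` is the deformation `(A, ρ_j, [·,·]_j)` of `R = (A, ρ, [·,·])` by `j`: `ρ_j = ρ ∘ j` and
`[V, W]_j = [jV, W] + [V, jW] - j[V, W]`. -/
structure LieAlgebroid.IsDeformation [IsManifold 𝓘(ℂ, E) ω X] [VectorBundle ℂ F A]
    (R D : LieAlgebroid ∞ 𝓘(ℝ, E) F A) : Prop where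
  anchor_eq : ∀ x (v : A x), D.anchor x v = R.anchor x (Complex.I • v)
  bracket_eq : ∀ (U : Opens X) (V W : LocalSections ∞ 𝓘(ℝ, E) F A U),
    D.bracket U V W =
      R.bracket U (jmul V) W + R.bracket U V (jmul W) - jmul (R.bracket U V W)

end Realification

/-! ### Real and imaginary parts of a holomorphic bivector field -/

section RealPart

/-- The `(1,0)`-part `α^{1,0}(v) = (α(v) - i α(iv)) / 2` of a real covector `α`, as a complex
linear form. -/
def covector10 (V : Type*) [NormedAddCommGroup V] [NormedSpace ℂ V] :
    (V →L[ℝ] ℝ) →ₗ[ℝ] (V →L[ℂ] ℂ) :=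
  (1 / 2 : ℝ) • (StrongDual.extendRCLikeₗ (𝕜 := ℂ) (F := V)).toLinearMap

variable {V : Type*} [NormedAddCommGroup V] [NormedSpace ℂ V]
  {H : Type*} [TopologicalSpace H] {I : ModelWithCorners ℂ V H}
  {M : Type*} [TopologicalSpace M] [ChartedSpace H M]

/-- The real part of a bilinear form `P` on complex covectors, which is first extended to
`V^* ⊗ ℂ` by zero on covectors of type `(0,1)`, and then restricted to real covectors. -/
def reForm (P : (V →L[ℂ] ℂ) →ₗ[ℂ] (V →L[ℂ] ℂ) →ₗ[ℂ] ℂ) :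
    (V →L[ℝ] ℝ) →ₗ[ℝ] (V →L[ℝ] ℝ) →ₗ[ℝ] ℝ :=
  LinearMap.mk₂ ℝ (fun α β => (P (covector10 V α) (covector10 V β)).re)
    (by intros; simp) (by intros; simp) (by intros; simp) (by intros; simp)

/-- The imaginary part, see `reForm`. -/
def imForm (P : (V →L[ℂ] ℂ) →ₗ[ℂ] (V →L[ℂ] ℂ) →ₗ[ℂ] ℂ) :
    (V →L[ℝ] ℝ) →ₗ[ℝ] (V →L[ℝ] ℝ) →ₗ[ℝ] ℝ :=
  LinearMap.mk₂ ℝ (fun α β => (P (covector10 V α) (covector10 V β)).im)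
    (by intros; simp) (by intros; simp) (by intros; simp) (by intros; simp)

/-- The real part `P_R` of a section `P = P_R + i P_I` of `∧² T^{1,0} M`; here `I'` is the real
model underlying `I`. -/
def CotangentForm.re (I' : ModelWithCorners ℝ V H) (P : CotangentForm I M) : CotangentForm I' M :=
  fun m => reForm (V := V) (P m)

/-- The imaginary part `P_I` of a section `P = P_R + i P_I` of `∧² T^{1,0} M`; here `I'` is the
real model underlying `I`. -/
def CotangentForm.im (I' : ModelWithCorners ℝ V H) (P : CotangentForm I M) : CotangentForm I' M :=
  fun m => imForm (V := V) (P m)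

end RealPart

/-! ### The identification of the real and the complex dual bundle -/

section Psi

/-- Scalar multiplication is continuous on the fibers of a complex vector bundle. -/
theorem fiber_continuousConstSMul {X : Type*} [TopologicalSpace X]
    (F : Type*) [NormedAddCommGroup F] [NormedSpace ℂ F]
    (A : X → Type*) [TopologicalSpace (TotalSpace F A)]
    [∀ x, AddCommGroup (A x)] [∀ x, Module ℂ (A x)] [∀ x, TopologicalSpace (A x)]
    [FiberBundle F A] [VectorBundle ℂ F A] (x : X) : ContinuousConstSMul ℂ (A x) := by
  refine ⟨fun c => ?_⟩
  let e := (trivializationAt F A x).continuousLinearEquivAt ℂ x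
    (FiberBundle.mem_baseSet_trivializationAt' x)
  have : (fun v : A x => c • v) = fun v => e.symm (c • e v) := by
    ext v; simp
  rw [this]
  exact e.symm.continuous.comp ((continuous_const_smul c).comp e.continuous)

/-- The isomorphism of real vector bundles `Ψ = 1 - i j^*` from `Hom_ℝ(A, ℝ)` to `Hom_ℂ(A, ℂ)`:
`Ψ(f)(v) = f(v) - i f(j v)`; its inverse is `ξ ↦ Re ∘ ξ`. -/
def dualPsi {X : Type*} [TopologicalSpace X] (F : Type*) [NormedAddCommGroup F] [NormedSpace ℂ F]
    (A : X → Type*) [TopologicalSpace (TotalSpace F A)]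
    [∀ x, AddCommGroup (A x)] [∀ x, Module ℂ (A x)] [∀ x, TopologicalSpace (A x)]
    [FiberBundle F A] [VectorBundle ℂ F A] (f : DualTotal ℝ F A) : DualTotal ℂ F A :=
  haveI := fiber_continuousConstSMul F A f.1
  ⟨f.1, StrongDual.extendRCLike (𝕜 := ℂ) (F := A f.1) f.2⟩

end Psi

section PicRe

variable {E : Type*} [NormedAddCommGroup E] [NormedSpace ℂ E]
  {X : Type*} [TopologicalSpace X] [ChartedSpace E X]
  {F : Type*} [NormedAddCommGroup F] [NormedSpace ℂ F]
  {A : X → Type*} [TopologicalSpace (TotalSpace F A)]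
  [∀ x, AddCommGroup (A x)] [∀ x, Module ℂ (A x)] [∀ x, TopologicalSpace (A x)]
  [FiberBundle F A] [VectorBundle ℂ F A]

/-- The bivector field `Ψ⁻¹_* P_R` on the real dual bundle, where `P_R` is the real part of `P`. -/
def dualRe (P : CotangentForm (𝓘(ℂ, E).prod 𝓘(ℂ, F →L[ℂ] ℂ)) (DualTotal ℂ F A)) :
    CotangentForm (𝓘(ℝ, E).prod 𝓘(ℝ, F →L[ℝ] ℝ)) (DualTotal ℝ F A) :=
  (P.re (𝓘(ℝ, E).prod 𝓘(ℝ, F →L[ℂ] ℂ))).pullback _ (dualPsi F A)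

/-- The bivector field `Ψ⁻¹_* P_I` on the real dual bundle, where `P_I` is the imaginary part of
`P`. -/
def dualIm (P : CotangentForm (𝓘(ℂ, E).prod 𝓘(ℂ, F →L[ℂ] ℂ)) (DualTotal ℂ F A)) :
    CotangentForm (𝓘(ℝ, E).prod 𝓘(ℝ, F →L[ℝ] ℝ)) (DualTotal ℝ F A) :=
  (P.im (𝓘(ℝ, E).prod 𝓘(ℝ, F →L[ℂ] ℂ))).pullback _ (dualPsi F A)

end PicRe

end

noncomputable section

set_option maxSynthPendingDepth 3
set_option linter.unusedSectionVars false

/-! ### Derivatives on manifolds: product rules, regularity, and the Lie bracket as a commutator -/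

section Calculus

open Filter Topology

/-! A Lie algebroid is encoded by the functions `l_V + p^*f`, which are affine on the fibers of the
dual bundle. At each point their differentials fill the cotangent space (`mvfderiv_affFun_frame`),
so a fiberwise linear bivector is determined by its brackets of affine functions. This gives
uniqueness of the Poisson tensor (`IsLiePoisson.eq_liePoisson`); conversely the anchor and the
bracket can be read off from the tensor (`IsLiePoisson.algebroid_unique`). For existence, the tensor
is written at each point in the trivialization at its base point (`SkewAlgebroid.dualBivector`). The
Jacobiator of a bivector field depends only on differentials, so it suffices to test it on linear
functions of charts (`CotangentForm.IsPoisson.of_coordFun`). In bundle charts these are affine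
functions, and for them the Jacobi identity is that of sections together with `ρ[V, W] = [ρV, ρW]`.

In a trivialization, `[V, W] = ρ(V)W - ρ(W)V + c(V, W)` with structure functions `c`
(`SkewAlgebroid.bracket_eq`). For a holomorphic algebroid `L`, the same formula with real
derivatives makes sense for smooth sections and does not depend on the trivialization
(`LieAlgebroid.localBracket_eq`). Once the Leibniz rule holds, the anchor identity and then the
Jacobi identity need only be checked on local frames. Those frames are holomorphic, and there the
identities are the ones of `L`. This produces the realification `L_R = A_R`, and the local formula
also shows its uniqueness.

For a complex number `c` let `cL` be the algebroid with anchor and bracket multiplied by `c`. Three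
identifications finish the proof. The local formula gives `A_I = (iL)_R`
(`LieAlgebroid.isDeformation_realify`). If `F`, `G` are holomorphic on the complex dual, the
`(1,0)`-part of `d Re F` is `dF/2`, so `π_R(d Re F, d Re G) = Re {F, G} / 4`; since `Ψ` pulls `Re
l_V` back to the real `l_V`, the tensor `Ψ⁻¹_* π_R` belongs to `(L/4)_R`
(`LieAlgebroid.dualRe_liePoisson`). As `Im z = Re(-iz)`, the tensor `Ψ⁻¹_* π_I` belongs to
`(-iL/4)_R` (`LieAlgebroid.dualIm_liePoisson`). Scaling by `4` and `-4` gives exactly `L_R` and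
`(iL)_R`, so the isomorphisms are equalities. -/

theorem add_one_le_of_top_le {n : ℕ∞ω} (hn : ∞ ≤ n) : n + 1 ≤ n := by
  rcases eq_or_ne n ω with rfl | h
  · exact le_top
  · have : n = ∞ := by
      refine le_antisymm ?_ hn
      lift n to ℕ∞ using h
      exact WithTop.coe_le_coe.2 le_top
    subst this
    rfl

theorem natCast_le_of_top_le {n : ℕ∞ω} (hn : ∞ ≤ n) (k : ℕ) : (k : ℕ∞ω) ≤ n :=
  le_trans (WithTop.coe_le_coe.2 le_top) hn

variable {𝕜 : Type*} [NontriviallyNormedField 𝕜]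
  {E : Type*} [NormedAddCommGroup E] [NormedSpace 𝕜 E]
  {H : Type*} [TopologicalSpace H] {I : ModelWithCorners 𝕜 E H}
  {M : Type*} [TopologicalSpace M] [ChartedSpace H M]
  {G : Type*} [NormedAddCommGroup G] [NormedSpace 𝕜 G]
  {n : ℕ∞ω}

theorem Filter.EventuallyEq.mvfderiv_eq {f g : M → G} {x : M} (h : f =ᶠ[𝓝 x] g) :
    mvfderiv I f x = mvfderiv I g x := by
  have h1 : f x = g x := h.eq_of_nhds
  have h2 := h.mfderiv_eq (I := I) (I' := 𝓘(𝕜, G))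
  ext v
  exact congrArg (fun L : E →L[𝕜] G => L v) h2

theorem HasMFDerivAt.mvfderiv_eq {f : M → G} {x : M} {f' : E →L[𝕜] G}
    (h : HasMFDerivAt I 𝓘(𝕜, G) f x f') : mvfderiv I f x = f' := h.mfderiv

theorem MDifferentiableAt.hasMFDerivAt_mvfderiv {f : M → G} {x : M}
    (h : MDifferentiableAt I 𝓘(𝕜, G) f x) : HasMFDerivAt I 𝓘(𝕜, G) f x (mvfderiv I f x) :=
  h.hasMFDerivAt

theorem HasMFDerivAt.hasFDerivAt_comp {E' : Type*} [NormedAddCommGroup E'] [NormedSpace 𝕜 E']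
    {f : M → G} {c : E' → M} {y : E'} {f' : E →L[𝕜] G} {c' : E' →L[𝕜] E}
    (hf : HasMFDerivAt I 𝓘(𝕜, G) f (c y) f') (hc : HasMFDerivAt 𝓘(𝕜, E') I c y c') :
    HasFDerivAt (f ∘ c) (f' ∘L c') y :=
  hasMFDerivAt_iff_hasFDerivAt.1 (HasMFDerivAt.comp y hf hc)

theorem mvfderiv_clm_comp {G' : Type*} [NormedAddCommGroup G'] [NormedSpace 𝕜 G'] (T : G →L[𝕜] G')
    {f : M → G} {x : M} (h : MDifferentiableAt I 𝓘(𝕜, G) f x) :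
    mvfderiv I (fun y => T (f y)) x = T ∘L mvfderiv I f x :=
  (HasMFDerivAt.comp x (T.hasMFDerivAt (x := f x)) h.hasMFDerivAt_mvfderiv).mvfderiv_eq

theorem mvfderiv_clm_apply {G' : Type*} [NormedAddCommGroup G'] [NormedSpace 𝕜 G']
    {T : M → G →L[𝕜] G'} {f : M → G} {x : M} (hT : MDifferentiableAt I 𝓘(𝕜, G →L[𝕜] G') T x)
    (h : MDifferentiableAt I 𝓘(𝕜, G) f x) (v : TangentSpace I x) :
    mvfderiv I (fun y => T y (f y)) x v = mvfderiv I T x v (f x) + T x (mvfderiv I f x v) := by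
  have h1 := hT.hasMFDerivAt_mvfderiv
  have h2 := h.hasMFDerivAt_mvfderiv
  have h3 : HasFDerivWithinAt (fun y => T ((extChartAt I x).symm y) (f ((extChartAt I x).symm y)))
      _ (range I) (extChartAt I x x) := HasFDerivWithinAt.clm_apply h1.2 h2.2
  have h4 : HasMFDerivAt I 𝓘(𝕜, G') (fun y => T y (f y)) x _ := ⟨h1.1.clm_apply h2.1, h3⟩
  refine (congrArg (fun L : E →L[𝕜] G' => L v) h4.mvfderiv_eq).trans ?_
  have h5 : (extChartAt I x).symm (extChartAt I x x) = x := extChartAt_to_inv x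
  refine (add_comm _ _).trans ?_
  exact congrArg₂ (· + ·) (congrArg (fun z => mvfderiv I T x v (f z)) h5)
    (congrArg (fun z => T z (mvfderiv I f x v)) h5)

/-- The condition `n + 1 ≤ n` singles out `∞` and `ω`: differentiating costs no regularity, so
functions of class `C^n` are stable under `C^n` vector fields. -/
theorem ContMDiffAt.contMDiffAt_mvfderiv_apply [IsManifold I 1 M] [IsManifold I n M]
    (hn : n + 1 ≤ n) {f : M → G}
    {V : Π y, TangentSpace I y} {x : M} (hf : ContMDiffAt I 𝓘(𝕜, G) n f x)
    (hV : ContMDiffAt I I.tangent n (fun y => (⟨y, V y⟩ : TangentBundle I M)) x) :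
    ContMDiffAt I 𝓘(𝕜, G) n (fun y => mvfderiv I f y (V y)) x := by
  have h1 : ContMDiffAt I 𝓘(𝕜, E →L[𝕜] G) n
      (fun y => ContinuousLinearMap.inCoordinates E (TangentSpace I (M := M)) G
        (TangentSpace 𝓘(𝕜, G) (M := G)) x y (f x) (f y) (mfderiv I 𝓘(𝕜, G) f y)) x :=
    hf.mfderiv_const hn
  have h2 : ContMDiffAt I 𝓘(𝕜, G).tangent n
      (fun y => (⟨f y, mfderiv I 𝓘(𝕜, G) f y (V y)⟩ : TangentBundle 𝓘(𝕜, G) G)) x :=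
    ContMDiffAt.clm_apply_of_inCoordinates h1 hV hf
  exact (contMDiff_snd_tangentBundle_modelSpace G 𝓘(𝕜, G)).contMDiffAt.comp x h2

theorem ContMDiffOn.contMDiffOn_mvfderiv_apply [IsManifold I 1 M] [IsManifold I n M]
    (hn : n + 1 ≤ n) {f : M → G}
    {V : Π y, TangentSpace I y} {U : Set M} (hU : IsOpen U) (hf : ContMDiffOn I 𝓘(𝕜, G) n f U)
    (hV : ContMDiffOn I I.tangent n (fun y => (⟨y, V y⟩ : TangentBundle I M)) U) :
    ContMDiffOn I 𝓘(𝕜, G) n (fun y => mvfderiv I f y (V y)) U := fun _ hx =>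
  (ContMDiffAt.contMDiffAt_mvfderiv_apply hn (hf.contMDiffAt (hU.mem_nhds hx))
    (hV.contMDiffAt (hU.mem_nhds hx))).contMDiffWithinAt


variable [I.Boundaryless]

theorem mvfderiv_eq_fderiv {f : M → G} {x : M} (h : MDifferentiableAt I 𝓘(𝕜, G) f x) :
    mvfderiv I f x = fderiv 𝕜 (f ∘ (extChartAt I x).symm) (extChartAt I x x) := by
  rw [h.mvfderiv, I.range_eq_univ, fderivWithin_univ]
  rfl

theorem ContMDiffAt.contDiffAt_comp_extChartAt_symm {m : ℕ∞ω} {f : M → G} {x : M}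
    (hf : ContMDiffAt I 𝓘(𝕜, G) m f x) :
    ContDiffAt 𝕜 m (f ∘ (extChartAt I x).symm) (extChartAt I x x) := by
  have := (contMDiffAt_iff.1 hf).2
  rw [I.range_eq_univ] at this
  exact this

section MlieBracket

variable [IsManifold I 1 M]

variable (I) in
/-- A vector field read in the chart at `x`. -/
def inChart (V : Π y : M, TangentSpace I y) (x : M) : E → E :=
  mpullbackWithin 𝓘(𝕜, E) I (extChartAt I x).symm V (range I)

/-- Chain rule: the derivative of the inverse chart is invertible and carries the pulled-back field
to the original one. -/
theorem fderiv_comp_extChartAt_symm_inChart (V : Π y, TangentSpace I y) {f : M → G} {x : M}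
    {y : E} (hy : y ∈ (extChartAt I x).target)
    (hf : MDifferentiableAt I 𝓘(𝕜, G) f ((extChartAt I x).symm y)) :
    fderiv 𝕜 (f ∘ (extChartAt I x).symm) y (inChart I V x y) =
      mvfderiv I f ((extChartAt I x).symm y) (V ((extChartAt I x).symm y)) := by
  have h1 : MDifferentiableAt 𝓘(𝕜, E) I (extChartAt I x).symm y := by
    have := mdifferentiableWithinAt_extChartAt_symm hy
    rwa [I.range_eq_univ, mdifferentiableWithinAt_univ] at this
  obtain ⟨A, hA⟩ : ∃ A : E →L[𝕜] E, A = mfderiv 𝓘(𝕜, E) I (extChartAt I x).symm y := ⟨_, rfl⟩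
  obtain ⟨D, hD⟩ : ∃ D : E →L[𝕜] G, D = mvfderiv I f ((extChartAt I x).symm y) := ⟨_, rfl⟩
  have h2 : HasFDerivAt (f ∘ (extChartAt I x).symm) (D ∘L A) y := by
    subst hA hD
    exact HasMFDerivAt.hasFDerivAt_comp hf.hasMFDerivAt_mvfderiv h1.hasMFDerivAt
  have h := isInvertible_mfderivWithin_extChartAt_symm hy
  rw [I.range_eq_univ, mfderivWithin_univ] at h
  have h3 : A (inChart I V x y) = V ((extChartAt I x).symm y) := by
    rw [hA]
    unfold inChart
    rw [I.range_eq_univ, mpullbackWithin_apply, mfderivWithin_univ]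
    exact ContinuousLinearMap.IsInvertible.self_apply_inverse h (V ((extChartAt I x).symm y))
  rw [h2.fderiv]
  exact (congrArg D h3).trans (by rw [hD]; rfl)

theorem MDifferentiableAt.differentiableAt_inChart [CompleteSpace E] [IsManifold I 2 M]
    {V : Π y, TangentSpace I y} {x : M}
    (hV : MDifferentiableAt I I.tangent (fun y => (⟨y, V y⟩ : TangentBundle I M)) x) :
    DifferentiableAt 𝕜 (inChart I V x) (extChartAt I x x) := by
  have := MDifferentiableWithinAt.differentiableWithinAt_mpullbackWithin_vectorField
    (mdifferentiableWithinAt_univ.2 hV)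
  simp only [preimage_univ, univ_inter] at this
  exact this.differentiableAt (by rw [I.range_eq_univ]; exact univ_mem)

/-- Differentiating `df(W)` in the chart splits it into a Hessian term, symmetric in the two fields,
and a term with the derivative of the coefficients of `W`. Only the second kind survives in a
commutator. -/
theorem mvfderiv_mvfderiv_apply [CompleteSpace E] [IsManifold I 2 M]
    {V W : Π y, TangentSpace I y} {f : M → G} {x : M}
    (hf : ContMDiffAt I 𝓘(𝕜, G) 2 f x)
    (hW : MDifferentiableAt I I.tangent (fun y => (⟨y, W y⟩ : TangentBundle I M)) x)
    (hWf : MDifferentiableAt I 𝓘(𝕜, G) (fun y => mvfderiv I f y (W y)) x) :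
    mvfderiv I (fun y => mvfderiv I f y (W y)) x (V x) =
      fderiv 𝕜 (fderiv 𝕜 (f ∘ (extChartAt I x).symm)) (extChartAt I x x)
        (inChart I V x (extChartAt I x x)) (inChart I W x (extChartAt I x x)) +
      fderiv 𝕜 (f ∘ (extChartAt I x).symm) (extChartAt I x x)
        (fderiv 𝕜 (inChart I W x) (extChartAt I x x) (inChart I V x (extChartAt I x x))) := by
  have hF := hf.contDiffAt_comp_extChartAt_symm
  have hx := mem_extChartAt_target (I := I) x
  have hxx : (extChartAt I x).symm (extChartAt I x x) = x := extChartAt_to_inv x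
  have h1 := fderiv_comp_extChartAt_symm_inChart (I := I) V hx (hxx ▸ hWf)
  rw [hxx] at h1
  rw [← h1]
  have h2 : (fun y => mvfderiv I f y (W y)) ∘ (extChartAt I x).symm =ᶠ[𝓝 (extChartAt I x x)]
      fun y => fderiv 𝕜 (f ∘ (extChartAt I x).symm) y (inChart I W x y) := by
    have h3 : ∀ᶠ y in 𝓝 (extChartAt I x x),
        ContMDiffAt I 𝓘(𝕜, G) 2 f ((extChartAt I x).symm y) := by
      have : Tendsto (extChartAt I x).symm (𝓝 (extChartAt I x x)) (𝓝 x) := by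
        have := continuousAt_extChartAt_symm (I := I) x
        rwa [ContinuousAt, hxx] at this
      exact this.eventually ((contMDiffAt_iff_contMDiffAt_nhds (by simp)).1 hf)
    filter_upwards [h3, extChartAt_target_mem_nhds (I := I) x] with y hy hy'
    exact (fderiv_comp_extChartAt_symm_inChart W hy' (hy.mdifferentiableAt (by simp))).symm
  rw [h2.fderiv_eq]
  have h4 : DifferentiableAt 𝕜 (fderiv 𝕜 (f ∘ (extChartAt I x).symm)) (extChartAt I x x) :=
    (hF.fderiv_right (m := 1) (by norm_num)).differentiableAt (by simp)
  rw [(h4.hasFDerivAt.clm_apply hW.differentiableAt_inChart.hasFDerivAt).fderiv]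
  exact add_comm _ _

/-- Symmetry of the Hessian cancels the second-order terms of the commutator, and the rest is the
Lie bracket of the fields read in the chart. This turns the anchor axiom into an identity between
derivations. -/
theorem mvfderiv_mlieBracket [IsRCLikeNormedField 𝕜] [CompleteSpace E] [IsManifold I 2 M]
    {V W : Π y, TangentSpace I y} {f : M → G} {x : M}
    (hf : ContMDiffAt I 𝓘(𝕜, G) 2 f x)
    (hV : MDifferentiableAt I I.tangent (fun y => (⟨y, V y⟩ : TangentBundle I M)) x)
    (hW : MDifferentiableAt I I.tangent (fun y => (⟨y, W y⟩ : TangentBundle I M)) x)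
    (hVf : MDifferentiableAt I 𝓘(𝕜, G) (fun y => mvfderiv I f y (V y)) x)
    (hWf : MDifferentiableAt I 𝓘(𝕜, G) (fun y => mvfderiv I f y (W y)) x) :
    mvfderiv I f x (mlieBracket I V W x) =
      mvfderiv I (fun y => mvfderiv I f y (W y)) x (V x) -
        mvfderiv I (fun y => mvfderiv I f y (V y)) x (W x) := by
  have hF := hf.contDiffAt_comp_extChartAt_symm
  have h6 : mvfderiv I f x (mlieBracket I V W x) =
      fderiv 𝕜 (f ∘ (extChartAt I x).symm) (extChartAt I x x)
        (lieBracket 𝕜 (inChart I V x) (inChart I W x) (extChartAt I x x)) := by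
    have h8 : MDifferentiableAt I 𝓘(𝕜, E) (extChartAt I x) x :=
      mdifferentiableAt_extChartAt (mem_chart_source H x)
    have h10 := HasMFDerivAt.comp x
      (hF.differentiableAt (by simp)).hasFDerivAt.hasMFDerivAt h8.hasMFDerivAt
    have h11 : f =ᶠ[𝓝 x] (f ∘ (extChartAt I x).symm) ∘ extChartAt I x := by
      filter_upwards [extChartAt_source_mem_nhds (I := I) x] with y hy
      simp only [Function.comp_apply, (extChartAt I x).left_inv hy]
    have h7 := h11.mvfderiv_eq.trans (HasMFDerivAt.mvfderiv_eq h10)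
    have h13 := (isInvertible_mfderiv_extChartAt (mem_extChartAt_source (I := I) x)).self_apply_inverse
      (lieBracket 𝕜 (inChart I V x) (inChart I W x) (extChartAt I x x) : E)
    refine (congrArg (fun L : E →L[𝕜] G => L (mlieBracket I V W x)) h7).trans ?_
    refine congrArg (fderiv 𝕜 (f ∘ (extChartAt I x).symm) (extChartAt I x x)) (Eq.trans ?_ h13)
    refine congrArg (mfderiv I 𝓘(𝕜, E) (extChartAt I x) x) ?_
    rw [← mlieBracketWithin_univ, mlieBracketWithin_apply]
    refine congrArg (mfderiv I 𝓘(𝕜, E) (extChartAt I x) x).inverse ?_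
    rw [preimage_univ, univ_inter]
    unfold inChart
    rw [I.range_eq_univ]
    exact congrFun (lieBracketWithin_univ (E := E)) _
  rw [h6, mvfderiv_mvfderiv_apply hf hW hWf, mvfderiv_mvfderiv_apply hf hV hVf, lieBracket,
    map_sub, (hF.isSymmSndFDerivAt (by simp)) (inChart I V x _) (inChart I W x _)]
  abel

end MlieBracket

end Calculus

/-! ### Testing the Poisson axioms on chart coordinates -/

section PoissonCriterion

open Filter Topology

variable {𝕜 : Type*} [NontriviallyNormedField 𝕜]
  {E : Type*} [NormedAddCommGroup E] [NormedSpace 𝕜 E]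
  {H : Type*} [TopologicalSpace H] {I : ModelWithCorners 𝕜 E H}
  {M : Type*} [TopologicalSpace M] [ChartedSpace H M]
  {n : ℕ∞ω}

theorem contMDiffAt_of_clm_apply [CompleteSpace 𝕜] {G G' : Type*}
    [NormedAddCommGroup G] [NormedSpace 𝕜 G] [FiniteDimensional 𝕜 G]
    [NormedAddCommGroup G'] [NormedSpace 𝕜 G'] {f : M → G →L[𝕜] G'} {x : M}
    (h : ∀ v, ContMDiffAt I 𝓘(𝕜, G') n (fun y => f y v) x) :
    ContMDiffAt I 𝓘(𝕜, G →L[𝕜] G') n f x := by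
  let b := Module.finBasis 𝕜 G
  have h1 : f = fun y => ∑ i, ContinuousLinearMap.smulRightL 𝕜 G G'
      (LinearMap.toContinuousLinearMap (b.coord i)) (f y (b i)) := by
    ext y v
    conv_lhs => rw [← b.sum_repr v]
    rw [map_sum]
    simp
  rw [h1]
  refine contMDiffAt_finsetSum fun i _ => ?_
  exact (ContinuousLinearMap.contMDiff _).contMDiffAt.comp x (h (b i))

/-- Reflexivity of a finite-dimensional space. Applied to `B y (df)`, it yields the Hamiltonian
vector of `f` at `y`. -/
theorem exists_forall_apply_eq [CompleteSpace 𝕜] [FiniteDimensional 𝕜 E]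
    (a : (E →L[𝕜] 𝕜) →ₗ[𝕜] 𝕜) : ∃ v : E, ∀ β : E →L[𝕜] 𝕜, a β = β v := by
  refine ⟨(Module.evalEquiv 𝕜 E).symm (a ∘ₗ LinearMap.toContinuousLinearMap.toLinearMap),
    fun β => ?_⟩
  have h := Module.apply_evalEquiv_symm_apply 𝕜 E β.toLinearMap
    (a ∘ₗ LinearMap.toContinuousLinearMap.toLinearMap)
  refine Eq.trans (congrArg a ?_) h.symm
  ext v
  rfl

section Linear

variable [IsRCLikeNormedField 𝕜] [CompleteSpace 𝕜] [FiniteDimensional 𝕜 E]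
  {B : E → (E →L[𝕜] 𝕜) →L[𝕜] (E →L[𝕜] 𝕜) →L[𝕜] 𝕜} {y : E}

/-- The bracket of functions on a vector space defined by a bivector field. -/
def bivectorBracket (B : E → (E →L[𝕜] 𝕜) →L[𝕜] (E →L[𝕜] 𝕜) →L[𝕜] 𝕜) (f g : E → 𝕜) : E → 𝕜 :=
  fun z => B z (fderiv 𝕜 f z) (fderiv 𝕜 g z)

theorem fderiv_bivectorBracket_apply (hB : DifferentiableAt 𝕜 B y) {g h : E → 𝕜}
    (hg : ContDiffAt 𝕜 2 g y) (hh : ContDiffAt 𝕜 2 h y) (v : E) :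
    fderiv 𝕜 (bivectorBracket B g h) y v = fderiv 𝕜 B y v (fderiv 𝕜 g y) (fderiv 𝕜 h y) +
      B y (fderiv 𝕜 (fderiv 𝕜 g) y v) (fderiv 𝕜 h y) +
      B y (fderiv 𝕜 g y) (fderiv 𝕜 (fderiv 𝕜 h) y v) := by
  have hd : ∀ {g : E → 𝕜}, ContDiffAt 𝕜 2 g y → DifferentiableAt 𝕜 (fderiv 𝕜 g) y := fun hg =>
    (hg.fderiv_right (m := 1) (by norm_num)).differentiableAt (by simp)
  have h1 := (hB.hasFDerivAt.clm_apply (hd hg).hasFDerivAt).clm_apply (hd hh).hasFDerivAt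
  have h2 : fderiv 𝕜 (bivectorBracket B g h) y = _ := h1.fderiv
  rw [h2]
  simp only [add_apply, ContinuousLinearMap.comp_apply,
    ContinuousLinearMap.flip_apply]
  ring

/-- The Jacobiator of the bracket of a bivector field depends only on differentials. -/
theorem bivectorBracket_jacobiator (hB : DifferentiableAt 𝕜 B y) (halt : ∀ α, B y α α = 0)
    {f g h : E → 𝕜}
    (hf : ContDiffAt 𝕜 2 f y) (hg : ContDiffAt 𝕜 2 g y) (hh : ContDiffAt 𝕜 2 h y) :
    ∃ xf xg xh : E, (∀ β, B y (fderiv 𝕜 f y) β = β xf) ∧ (∀ β, B y (fderiv 𝕜 g y) β = β xg) ∧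
      (∀ β, B y (fderiv 𝕜 h y) β = β xh) ∧
    bivectorBracket B f (bivectorBracket B g h) y + bivectorBracket B g (bivectorBracket B h f) y +
      bivectorBracket B h (bivectorBracket B f g) y =
    fderiv 𝕜 B y xf (fderiv 𝕜 g y) (fderiv 𝕜 h y) + fderiv 𝕜 B y xg (fderiv 𝕜 h y) (fderiv 𝕜 f y) +
      fderiv 𝕜 B y xh (fderiv 𝕜 f y) (fderiv 𝕜 g y) := by
  obtain ⟨xf, hxf⟩ := exists_forall_apply_eq (B y (fderiv 𝕜 f y)).toLinearMap
  obtain ⟨xg, hxg⟩ := exists_forall_apply_eq (B y (fderiv 𝕜 g y)).toLinearMap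
  obtain ⟨xh, hxh⟩ := exists_forall_apply_eq (B y (fderiv 𝕜 h y)).toLinearMap
  simp only [ContinuousLinearMap.coe_coe] at hxf hxg hxh
  refine ⟨xf, xg, xh, hxf, hxg, hxh, ?_⟩
  have hskew : ∀ α β, B y α β = - B y β α := by
    intro α β
    have := halt (α + β)
    simp only [map_add, add_apply, halt, zero_add, add_zero] at this
    exact eq_neg_of_add_eq_zero_right this
  have e1 : bivectorBracket B f (bivectorBracket B g h) y = fderiv 𝕜 (bivectorBracket B g h) y xf :=
    hxf _
  have e2 : bivectorBracket B g (bivectorBracket B h f) y = fderiv 𝕜 (bivectorBracket B h f) y xg :=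
    hxg _
  have e3 : bivectorBracket B h (bivectorBracket B f g) y = fderiv 𝕜 (bivectorBracket B f g) y xh :=
    hxh _
  -- The six terms with second derivatives become Hessians evaluated on two Hamiltonian vectors.
  -- They cancel in pairs by symmetry of the Hessians and antisymmetry of `B y`.
  rw [e1, e2, e3, fderiv_bivectorBracket_apply hB hg hh, fderiv_bivectorBracket_apply hB hh hf,
    fderiv_bivectorBracket_apply hB hf hg, hskew _ (fderiv 𝕜 h y), hskew _ (fderiv 𝕜 f y),
    hskew _ (fderiv 𝕜 g y), hxf, hxf, hxg, hxg, hxh, hxh,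
    (hf.isSymmSndFDerivAt (by simp)) xg xh, (hg.isSymmSndFDerivAt (by simp)) xf xh,
    (hh.isSymmSndFDerivAt (by simp)) xg xf]
  ring

/-- A function and its differential at `y`, viewed as a linear function, have the same differential
at `y`, which is all that the Jacobiator sees. -/
theorem bivectorBracket_jacobiator_eq (hB : DifferentiableAt 𝕜 B y) (halt : ∀ α, B y α α = 0)
    {f g h : E → 𝕜}
    (hf : ContDiffAt 𝕜 2 f y) (hg : ContDiffAt 𝕜 2 g y) (hh : ContDiffAt 𝕜 2 h y) :
    bivectorBracket B f (bivectorBracket B g h) y + bivectorBracket B g (bivectorBracket B h f) y +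
      bivectorBracket B h (bivectorBracket B f g) y =
    bivectorBracket B (fderiv 𝕜 f y) (bivectorBracket B (fderiv 𝕜 g y) (fderiv 𝕜 h y)) y +
      bivectorBracket B (fderiv 𝕜 g y) (bivectorBracket B (fderiv 𝕜 h y) (fderiv 𝕜 f y)) y +
      bivectorBracket B (fderiv 𝕜 h y) (bivectorBracket B (fderiv 𝕜 f y) (fderiv 𝕜 g y)) y := by
  obtain ⟨xf, xg, xh, hxf, hxg, hxh, e⟩ := bivectorBracket_jacobiator hB halt hf hg hh
  obtain ⟨yf, yg, yh, hyf, hyg, hyh, e'⟩ := bivectorBracket_jacobiator hB halt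
    (fderiv 𝕜 f y).contDiff.contDiffAt (fderiv 𝕜 g y).contDiff.contDiffAt
    (fderiv 𝕜 h y).contDiff.contDiffAt
  simp only [ContinuousLinearMap.fderiv] at hyf hyg hyh e'
  -- Linear forms separate points, so the Hamiltonian vectors chosen on the two sides coincide.
  have hsep : ∀ {v w : E}, (∀ β : E →L[𝕜] 𝕜, β v = β w) → v = w := by
    intro v w hvw
    refine (Module.evalEquiv 𝕜 E).injective (LinearMap.ext fun φ => ?_)
    exact hvw (LinearMap.toContinuousLinearMap φ)
  rw [e, e', hsep fun β => (hyf β).symm.trans (hxf β), hsep fun β => (hyg β).symm.trans (hxg β),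
    hsep fun β => (hyh β).symm.trans (hxh β)]

end Linear

section Manifold

variable [IsRCLikeNormedField 𝕜] [CompleteSpace 𝕜] [FiniteDimensional 𝕜 E] [I.Boundaryless]

namespace CotangentForm

variable (P : CotangentForm I M)

theorem bracket_congr {f f' g g' : M → 𝕜} {m : M} (hf : mvfderiv I f m = mvfderiv I f' m)
    (hg : mvfderiv I g m = mvfderiv I g' m) : P.bracket f g m = P.bracket f' g' m := by
  rw [bracket, bracket, hf, hg]

theorem bracket_congr_of_eventuallyEq {f f' g g' : M → 𝕜} {m : M} (hf : f =ᶠ[𝓝 m] f')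
    (hg : g =ᶠ[𝓝 m] g') : P.bracket f g m = P.bracket f' g' m :=
  P.bracket_congr hf.mvfderiv_eq hg.mvfderiv_eq

/-- A linear function of the coordinates of the chart at `m`. -/
def _root_.coordFun (I : ModelWithCorners 𝕜 E H) (m : M) (u : E →L[𝕜] 𝕜) : M → 𝕜 :=
  fun x => u (extChartAt I m x)

theorem _root_.contMDiffAt_coordFun [IsManifold I n M] (m : M) (u : E →L[𝕜] 𝕜) {x : M}
    (hx : x ∈ (chartAt H m).source) : ContMDiffAt I 𝓘(𝕜, 𝕜) n (coordFun I m u) x :=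
  u.contMDiff.contMDiffAt.comp x (contMDiffAt_extChartAt' hx)

/-- Precomposition of linear forms with a continuous linear map. -/
def _root_.precompₗ {T : Type*} [AddCommGroup T] [Module 𝕜 T] [TopologicalSpace T]
    (D : T →L[𝕜] E) : (E →L[𝕜] 𝕜) →ₗ[𝕜] (T →L[𝕜] 𝕜) where
  toFun u := u ∘L D
  map_add' u v := ContinuousLinearMap.add_comp u v D
  map_smul' c u := ContinuousLinearMap.smul_comp c u D

/-- The bivector field read in the chart at `m`. -/
def inChart (m : M) (y : E) : (E →L[𝕜] 𝕜) →L[𝕜] (E →L[𝕜] 𝕜) →L[𝕜] 𝕜 :=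
  LinearMap.toContinuousLinearMap <| LinearMap.toContinuousLinearMap.toLinearMap ∘ₗ
    (P ((extChartAt I m).symm y)).compl₁₂
      (precompₗ (mvfderiv I (extChartAt I m) ((extChartAt I m).symm y)))
      (precompₗ (mvfderiv I (extChartAt I m) ((extChartAt I m).symm y)))

theorem inChart_apply [IsManifold I 1 M] (m : M) {y : E} (hy : y ∈ (extChartAt I m).target)
    (u v : E →L[𝕜] 𝕜) : P.inChart m y u v =
      P.bracket (coordFun I m u) (coordFun I m v) ((extChartAt I m).symm y) := by
  have h : MDifferentiableAt I 𝓘(𝕜, E) (extChartAt I m) ((extChartAt I m).symm y) :=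
    mdifferentiableAt_extChartAt (by
      rw [← extChartAt_source I]; exact (extChartAt I m).map_target hy)
  exact congrArg₂ (fun α β => P ((extChartAt I m).symm y) α β)
    (mvfderiv_clm_comp u h).symm (mvfderiv_clm_comp v h).symm

/-- The bracket sees `f` only through its differential, so `f` may be replaced by the linear
function of the chart with the same differential at the given point. -/
theorem bracket_comp_extChartAt_symm [IsManifold I 1 M] (m : M) {y : E}
    (hy : y ∈ (extChartAt I m).target)
    {f g : M → 𝕜} (hf : MDifferentiableAt I 𝓘(𝕜, 𝕜) f ((extChartAt I m).symm y))
    (hg : MDifferentiableAt I 𝓘(𝕜, 𝕜) g ((extChartAt I m).symm y)) :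
    P.bracket f g ((extChartAt I m).symm y) = bivectorBracket (P.inChart m)
      (f ∘ (extChartAt I m).symm) (g ∘ (extChartAt I m).symm) y := by
  rw [bivectorBracket, inChart_apply P m hy]
  have hs : (extChartAt I m).symm y ∈ (chartAt H m).source := by
    rw [← extChartAt_source I]; exact (extChartAt I m).map_target hy
  have key : ∀ {f : M → 𝕜}, MDifferentiableAt I 𝓘(𝕜, 𝕜) f ((extChartAt I m).symm y) →
      mvfderiv I f ((extChartAt I m).symm y) =
        mvfderiv I (coordFun I m (fderiv 𝕜 (f ∘ (extChartAt I m).symm) y))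
          ((extChartAt I m).symm y) := by
    intro f hf
    have h1 : MDifferentiableAt I 𝓘(𝕜, E) (extChartAt I m) ((extChartAt I m).symm y) :=
      mdifferentiableAt_extChartAt hs
    have h2 : MDifferentiableAt 𝓘(𝕜, E) I (extChartAt I m).symm y := by
      have := mdifferentiableWithinAt_extChartAt_symm hy
      rwa [I.range_eq_univ, mdifferentiableWithinAt_univ] at this
    have h3 : DifferentiableAt 𝕜 (f ∘ (extChartAt I m).symm) y :=
      mdifferentiableAt_iff_differentiableAt.1 (MDifferentiableAt.comp y hf h2)
    have h4 : f =ᶠ[𝓝 ((extChartAt I m).symm y)]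
        (f ∘ (extChartAt I m).symm) ∘ (extChartAt I m) := by
      have : (extChartAt I m).source ∈ 𝓝 ((extChartAt I m).symm y) :=
        extChartAt_source_mem_nhds' ((extChartAt I m).map_target hy)
      filter_upwards [this] with z hz
      simp only [Function.comp_apply, (extChartAt I m).left_inv hz]
    rw [h4.mvfderiv_eq]
    have h5 : HasFDerivAt (f ∘ (extChartAt I m).symm)
        (fderiv 𝕜 (f ∘ (extChartAt I m).symm) y)
        (extChartAt I m ((extChartAt I m).symm y)) := by
      rw [(extChartAt I m).right_inv hy]
      exact h3.hasFDerivAt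
    exact (HasMFDerivAt.mvfderiv_eq
      (HasMFDerivAt.comp _ h5.hasMFDerivAt h1.hasMFDerivAt_mvfderiv)).trans
        (mvfderiv_clm_comp (fderiv 𝕜 (f ∘ (extChartAt I m).symm) y) h1).symm
  exact P.bracket_congr (key hf) (key hg)

theorem bracket_comp_extChartAt_symm_eventuallyEq [IsManifold I 1 M] (m : M)
    {f g : M → 𝕜} (hf : ContMDiffAt I 𝓘(𝕜, 𝕜) 1 f m) (hg : ContMDiffAt I 𝓘(𝕜, 𝕜) 1 g m) :
    P.bracket f g ∘ (extChartAt I m).symm =ᶠ[𝓝 (extChartAt I m m)]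
      bivectorBracket (P.inChart m) (f ∘ (extChartAt I m).symm) (g ∘ (extChartAt I m).symm) := by
  have h2 : Tendsto (extChartAt I m).symm (𝓝 (extChartAt I m m)) (𝓝 m) := by
    have := continuousAt_extChartAt_symm (I := I) m
    rwa [ContinuousAt, extChartAt_to_inv m] at this
  filter_upwards [extChartAt_target_mem_nhds (I := I) m,
    h2.eventually ((contMDiffAt_iff_contMDiffAt_nhds (by simp)).1 hf),
    h2.eventually ((contMDiffAt_iff_contMDiffAt_nhds (by simp)).1 hg)] with y hy hfy hgy
  exact P.bracket_comp_extChartAt_symm m hy (hfy.mdifferentiableAt (by simp))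
    (hgy.mdifferentiableAt (by simp))

theorem contDiffAt_inChart [IsManifold I 1 M] (m : M)
    (h : ∀ u v, ContMDiffAt I 𝓘(𝕜, 𝕜) n (P.bracket (coordFun I m u) (coordFun I m v)) m) :
    ContDiffAt 𝕜 n (P.inChart m) (extChartAt I m m) := by
  rw [← contMDiffAt_iff_contDiffAt]
  refine contMDiffAt_of_clm_apply fun u => contMDiffAt_of_clm_apply fun v => ?_
  rw [contMDiffAt_iff_contDiffAt]
  refine (h u v).contDiffAt_comp_extChartAt_symm.congr_of_eventuallyEq ?_
  filter_upwards [extChartAt_target_mem_nhds (I := I) m] with y hy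
  exact P.inChart_apply m hy u v

/-- The coefficients of `P` in the chart at `m` are brackets of coordinates, which gives regularity.
For Jacobi, any triple of differentials at `m` is realized by linear functions of that chart, and
the Jacobiator at `m` depends on nothing else. -/
theorem IsPoisson.of_coordFun [IsManifold I 1 M] [IsManifold I n M] (hn : ∞ ≤ n)
    (halt : ∀ m α, P m α α = 0)
    (hsmooth : ∀ m u v, ContMDiffAt I 𝓘(𝕜, 𝕜) n (P.bracket (coordFun I m u) (coordFun I m v)) m)
    (hjac : ∀ m u v w,
      P.bracket (coordFun I m u) (P.bracket (coordFun I m v) (coordFun I m w)) m +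
      P.bracket (coordFun I m v) (P.bracket (coordFun I m w) (coordFun I m u)) m +
      P.bracket (coordFun I m w) (P.bracket (coordFun I m u) (coordFun I m v)) m = 0) :
    P.IsPoisson n := by
  have h1 : (1 : ℕ∞ω) ≤ n := natCast_le_of_top_le hn 1
  have h2 : (2 : ℕ∞ω) ≤ n := natCast_le_of_top_le hn 2
  have hbr : ∀ (m : M) (f g : M → 𝕜), ContMDiffAt I 𝓘(𝕜, 𝕜) n f m → ContMDiffAt I 𝓘(𝕜, 𝕜) n g m →
      ContMDiffAt I 𝓘(𝕜, 𝕜) n (P.bracket f g) m := by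
    intro m f g hf hg
    have h3 : ContDiffAt 𝕜 n (bivectorBracket (P.inChart m) (f ∘ (extChartAt I m).symm)
        (g ∘ (extChartAt I m).symm)) (extChartAt I m m) :=
      ((P.contDiffAt_inChart m (hsmooth m)).clm_apply (hf.contDiffAt_comp_extChartAt_symm.fderiv_right
        (add_one_le_of_top_le hn))).clm_apply (hg.contDiffAt_comp_extChartAt_symm.fderiv_right
        (add_one_le_of_top_le hn))
    have h4 := h3.congr_of_eventuallyEq
      (P.bracket_comp_extChartAt_symm_eventuallyEq m (hf.of_le h1) (hg.of_le h1))
    have h5 : ContMDiffAt I 𝓘(𝕜, 𝕜) n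
        ((P.bracket f g ∘ (extChartAt I m).symm) ∘ extChartAt I m) m :=
      (contMDiffAt_iff_contDiffAt.2 h4).comp m contMDiffAt_extChartAt
    refine h5.congr_of_eventuallyEq ?_
    filter_upwards [extChartAt_source_mem_nhds (I := I) m] with z hz
    simp only [Function.comp_apply, (extChartAt I m).left_inv hz]
  refine ⟨halt, fun U f g hf hg m hm => ?_, fun U f g h hf hg hh m hm => ?_⟩
  · exact (hbr m f g (hf.contMDiffAt (U.isOpen.mem_nhds hm))
      (hg.contMDiffAt (U.isOpen.mem_nhds hm))).contMDiffWithinAt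
  have key : ∀ f g h : M → 𝕜, ContMDiffAt I 𝓘(𝕜, 𝕜) n f m → ContMDiffAt I 𝓘(𝕜, 𝕜) n g m →
      ContMDiffAt I 𝓘(𝕜, 𝕜) n h m →
      P.bracket f (P.bracket g h) m = bivectorBracket (P.inChart m) (f ∘ (extChartAt I m).symm)
        (bivectorBracket (P.inChart m) (g ∘ (extChartAt I m).symm) (h ∘ (extChartAt I m).symm))
        (extChartAt I m m) := by
    intro f g h hf hg hh
    have h3 := (P.bracket_comp_extChartAt_symm_eventuallyEq m (hf.of_le h1)
      ((hbr m g h hg hh).of_le h1)).eq_of_nhds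
    rw [Function.comp_apply, extChartAt_to_inv] at h3
    rw [h3, bivectorBracket, (P.bracket_comp_extChartAt_symm_eventuallyEq m (hg.of_le h1)
      (hh.of_le h1)).fderiv_eq]
    rfl
  have hf' := hf.contMDiffAt (U.isOpen.mem_nhds hm)
  have hg' := hg.contMDiffAt (U.isOpen.mem_nhds hm)
  have hh' := hh.contMDiffAt (U.isOpen.mem_nhds hm)
  have hu : ∀ u, ContMDiffAt I 𝓘(𝕜, 𝕜) n (coordFun I m u) m := fun u =>
    contMDiffAt_coordFun m u (mem_chart_source H m)
  -- Read in its own chart, the coordinate function is `u` near the center; so the Jacobiators of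
  -- `f, g, h` and of the coordinate functions reduce to the same triple of linear forms.
  have hd : ∀ u : E →L[𝕜] 𝕜, fderiv 𝕜 (coordFun I m u ∘ (extChartAt I m).symm) (extChartAt I m m) =
      u := by
    intro u
    have : coordFun I m u ∘ (extChartAt I m).symm =ᶠ[𝓝 (extChartAt I m m)] u := by
      filter_upwards [extChartAt_target_mem_nhds (I := I) m] with y hy
      simp only [coordFun, Function.comp_apply, (extChartAt I m).right_inv hy]
    rw [this.fderiv_eq, ContinuousLinearMap.fderiv]
  have hB : DifferentiableAt 𝕜 (P.inChart m) (extChartAt I m m) :=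
    (P.contDiffAt_inChart m (hsmooth m)).differentiableAt (by
      rintro rfl; simp at h1)
  have h2' := fun {f : M → 𝕜} (hf : ContMDiffAt I 𝓘(𝕜, 𝕜) n f m) =>
    (hf.of_le h2).contDiffAt_comp_extChartAt_symm
  have ha : ∀ α, P.inChart m (extChartAt I m m) α α = 0 := fun α => halt _ _
  rw [key f g h hf' hg' hh', key g h f hg' hh' hf', key h f g hh' hf' hg',
    bivectorBracket_jacobiator_eq hB ha (h2' hf') (h2' hg') (h2' hh')]
  set u := fderiv 𝕜 (f ∘ (extChartAt I m).symm) (extChartAt I m m)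
  set v := fderiv 𝕜 (g ∘ (extChartAt I m).symm) (extChartAt I m m)
  set w := fderiv 𝕜 (h ∘ (extChartAt I m).symm) (extChartAt I m m)
  have h6 := hjac m u v w
  rwa [key _ _ _ (hu u) (hu v) (hu w), key _ _ _ (hu v) (hu w) (hu u), key _ _ _ (hu w) (hu u) (hu v),
    bivectorBracket_jacobiator_eq hB ha (h2' (hu u)) (h2' (hu v)) (h2' (hu w)), hd, hd, hd] at h6

end CotangentForm

end Manifold

end PoissonCriterion

/-! ### Coordinates of sections and frames in a trivialization -/

section LocalFrames

open Filter Topology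

variable {𝕜 : Type*} [NontriviallyNormedField 𝕜]
  {E : Type*} [NormedAddCommGroup E] [NormedSpace 𝕜 E]
  {H : Type*} [TopologicalSpace H]
  {X : Type*} [TopologicalSpace X] [ChartedSpace H X]
  {n : ℕ∞ω} {I : ModelWithCorners 𝕜 E H}
  {F : Type*} [NormedAddCommGroup F] [NormedSpace 𝕜 F]
  {A : X → Type*} [TopologicalSpace (TotalSpace F A)]
  [∀ x, AddCommGroup (A x)] [∀ x, Module 𝕜 (A x)] [∀ x, TopologicalSpace (A x)]
  [FiberBundle F A]

/-- The coordinates of a section in the preferred trivialization at `x₀`. -/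
def sectionCoord (F : Type*) [TopologicalSpace F] {X : Type*} [TopologicalSpace X]
    {A : X → Type*} [TopologicalSpace (TotalSpace F A)] [∀ x, TopologicalSpace (A x)]
    [FiberBundle F A] (x₀ : X) (V : Π x, A x) : X → F :=
  fun x => (trivializationAt F A x₀ ⟨x, V x⟩).2

variable (F A) in
/-- The domain of the preferred trivialization at `x₀`. -/
def trivOpens (x₀ : X) : Opens X := ⟨(trivializationAt F A x₀).baseSet,
  (trivializationAt F A x₀).open_baseSet⟩

variable (F A) in
theorem mem_trivOpens_self (x₀ : X) : x₀ ∈ trivOpens F A x₀ :=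
  FiberBundle.mem_baseSet_trivializationAt' x₀

open Classical in
/-- The inverse of the preferred trivialization at `x₀`, on fibers over its domain, extended by
zero. -/
def trivSymm (x₀ x : X) (a : F) : A x :=
  if x ∈ trivOpens F A x₀ then (trivializationAt F A x₀).symm x a else 0

theorem trivSymm_of_mem {x₀ x : X} (hx : x ∈ trivOpens F A x₀) (a : F) :
    trivSymm x₀ x a = (trivializationAt F A x₀).symm x a := if_pos hx

theorem trivSymm_of_notMem {x₀ x : X} (hx : x ∉ trivOpens F A x₀) (a : F) :
    (trivSymm x₀ x a : A x) = 0 := if_neg hx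

theorem trivSymm_sectionCoord {x₀ x : X} (hx : x ∈ trivOpens F A x₀) (V : Π x, A x) :
    trivSymm x₀ x (sectionCoord F x₀ V x) = V x := by
  rw [trivSymm_of_mem hx]
  exact (trivializationAt F A x₀).symm_apply_apply_mk hx (V x)

theorem sectionCoord_trivSymm {x₀ x : X} (hx : x ∈ trivOpens F A x₀) {V : Π x, A x} {a : F}
    (h : V x = trivSymm x₀ x a) : sectionCoord F x₀ V x = a := by
  rw [sectionCoord, h, trivSymm_of_mem hx, (trivializationAt F A x₀).apply_mk_symm hx]

theorem sectionCoord_congr (x₀ : X) {x : X} {V W : Π x, A x} (h : V x = W x) :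
    sectionCoord F x₀ V x = sectionCoord F x₀ W x := by rw [sectionCoord, sectionCoord, h]

theorem sectionCoord_congr_of_eventuallyEq (x₀ : X) {x : X} {V W : Π x, A x}
    (h : ∀ᶠ y in 𝓝 x, V y = W y) : sectionCoord F x₀ V =ᶠ[𝓝 x] sectionCoord F x₀ W :=
  h.mono fun _ hy => sectionCoord_congr x₀ hy

variable [VectorBundle 𝕜 F A]

variable (𝕜 F A) in
theorem isLinearMap_trivSymm (x₀ x : X) : IsLinearMap 𝕜 (trivSymm x₀ x : F → A x) := by
  by_cases hx : x ∈ trivOpens F A x₀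
  · have : (trivSymm x₀ x : F → A x) = (trivializationAt F A x₀).symmₗ 𝕜 x := by
      ext a
      rw [trivSymm_of_mem hx, (trivializationAt F A x₀).symmₗ_apply hx]
    rw [this]
    exact LinearMap.isLinear _
  · have : (trivSymm x₀ x : F → A x) = (0 : F →ₗ[𝕜] A x) := by
      ext a
      rw [trivSymm_of_notMem hx, LinearMap.zero_apply]
    rw [this]
    exact LinearMap.isLinear _

variable (𝕜) in
theorem isLinearMap_sectionCoord {x₀ x : X} (hx : x ∈ trivOpens F A x₀) :
    IsLinearMap 𝕜 fun V : Π x, A x => sectionCoord F x₀ V x :=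
  ⟨fun _ _ => ((trivializationAt F A x₀).linear 𝕜 hx).map_add _ _,
    fun c _ => ((trivializationAt F A x₀).linear 𝕜 hx).map_smul c _⟩

namespace LocalSections

theorem contMDiffAt {U : Opens X} (V : LocalSections n I F A U) {x : X} (hx : x ∈ U) :
    ContMDiffAt I (I.prod 𝓘(𝕜, F)) n (fun x => TotalSpace.mk' F x (V.1 x)) x :=
  V.2.1.contMDiffAt (U.isOpen.mem_nhds hx)

theorem ext_on {U : Opens X} {V W : LocalSections n I F A U} (h : ∀ x ∈ U, V.1 x = W.1 x) :
    V = W := by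
  refine Subtype.ext (funext fun x => ?_)
  by_cases hx : x ∈ U
  · exact h x hx
  · rw [V.2.2 x hx, W.2.2 x hx]

open Classical in
/-- Restriction of sections to a smaller open set. -/
def restrict {U U' : Opens X} (h : U' ≤ U) (V : LocalSections n I F A U) :
    LocalSections n I F A U' :=
  ⟨fun x => if x ∈ U' then V.1 x else 0,
    (V.2.1.mono h).congr fun x hx => by simp [show x ∈ U' from hx],
    fun x hx => by simp [hx]⟩

theorem restrict_apply {U U' : Opens X} (h : U' ≤ U) (V : LocalSections n I F A U) {x : X}
    (hx : x ∈ U') : (restrict h V).1 x = V.1 x := by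
  simp [restrict, hx]

theorem restrict_eventuallyEq {U U' : Opens X} (h : U' ≤ U) (V : LocalSections n I F A U) {x : X}
    (hx : x ∈ U') : ∀ᶠ y in 𝓝 x, (restrict h V).1 y = V.1 y :=
  (U'.isOpen.mem_nhds hx |> Filter.mem_of_superset) fun _ hy => restrict_apply h V hy

variable [ContMDiffVectorBundle n F A I]

theorem contMDiffAt_sectionCoord {U : Opens X} (V : LocalSections n I F A U) {x₀ x : X} (hx : x ∈ U)
    (hx₀ : x ∈ trivOpens F A x₀) : ContMDiffAt I 𝓘(𝕜, F) n (sectionCoord F x₀ V.1) x :=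
  ((trivializationAt F A x₀).contMDiffAt_section_iff hx₀).1 (contMDiffAt V hx)

/-- The section which is constant in the preferred trivialization at `x₀`. -/
def frame (n : ℕ∞ω) (I : ModelWithCorners 𝕜 E H) (F : Type*) [NormedAddCommGroup F]
    [NormedSpace 𝕜 F] (A : X → Type*) [TopologicalSpace (TotalSpace F A)]
    [∀ x, AddCommGroup (A x)] [∀ x, Module 𝕜 (A x)] [∀ x, TopologicalSpace (A x)]
    [FiberBundle F A] [VectorBundle 𝕜 F A] [ContMDiffVectorBundle n F A I] (x₀ : X) :
    F →ₗ[𝕜] LocalSections n I F A (trivOpens F A x₀) where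
  toFun a := ⟨fun x => trivSymm x₀ x a,
    (trivializationAt F A x₀).contMDiffOn_section_baseSet_iff.2
      (contMDiffOn_const (c := a) |>.congr fun x hx => by
        rw [trivSymm_of_mem hx, (trivializationAt F A x₀).apply_mk_symm hx]),
    fun x hx => trivSymm_of_notMem hx a⟩
  map_add' a b := Subtype.ext (funext fun x => (isLinearMap_trivSymm 𝕜 F A x₀ x).map_add a b)
  map_smul' c a := Subtype.ext (funext fun x => (isLinearMap_trivSymm 𝕜 F A x₀ x).map_smul c a)

theorem frame_apply (x₀ x : X) (a : F) :
    (frame n I F A x₀ a).1 x = trivSymm x₀ x a := rfl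

theorem sectionCoord_frame {x₀ x : X} (hx : x ∈ trivOpens F A x₀) (a : F) :
    sectionCoord F x₀ (frame n I F A x₀ a).1 x = a := sectionCoord_trivSymm hx rfl

theorem frame_sectionCoord {x₀ x : X} (hx : x ∈ trivOpens F A x₀) (V : Π x, A x) :
    (frame n I F A x₀ (sectionCoord F x₀ V x)).1 x = V x := trivSymm_sectionCoord hx V

theorem mvfderiv_sectionCoord_frame {x₀ x : X} (hx : x ∈ trivOpens F A x₀) (a : F) :
    mvfderiv I (sectionCoord F x₀ (frame n I F A x₀ a).1) x = 0 := by
  have : sectionCoord F x₀ (frame n I F A x₀ a).1 =ᶠ[𝓝 x] fun _ => a := by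
    filter_upwards [(trivOpens F A x₀).isOpen.mem_nhds hx] with y hy
    exact sectionCoord_frame hy a
  rw [this.mvfderiv_eq, mvfderiv_const]

theorem sum_apply {ι : Type*} (s : Finset ι) {U : Opens X} (V : ι → LocalSections n I F A U)
    (x : X) : (∑ i ∈ s, V i).1 x = ∑ i ∈ s, (V i).1 x := by
  rw [AddSubmonoidClass.coe_finsetSum, Finset.sum_apply]

/-- Inside a trivialization domain a section is a finite sum of functions times frame sections, by a
basis of the finite-dimensional model fiber. -/
theorem frame_induction [CompleteSpace 𝕜] [FiniteDimensional 𝕜 F] {x₀ : X} {U : Opens X}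
    (hU : U ≤ trivOpens F A x₀)
    {p : LocalSections n I F A U → Prop} (hframe : ∀ a, p (restrict hU (frame n I F A x₀ a)))
    (hadd : ∀ V W, p V → p W → p (V + W))
    (hsmul : ∀ (f : X → 𝕜) (hf : ContMDiffOn I 𝓘(𝕜, 𝕜) n f U) (V), p V → p (fsmul f hf V))
    (V : LocalSections n I F A U) : p V := by
  let b := Module.finBasis 𝕜 F
  have hc : ∀ i, ContMDiffOn I 𝓘(𝕜, 𝕜) n (fun x => b.coord i (sectionCoord F x₀ V.1 x)) U :=
    fun i x hx => ((LinearMap.toContinuousLinearMap (b.coord i)).contMDiff.contMDiffAt.comp x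
      (contMDiffAt_sectionCoord V hx (hU hx))).contMDiffWithinAt
  have h : V = ∑ i, fsmul _ (hc i) (restrict hU (frame n I F A x₀ (b i))) := by
    refine ext_on fun x hx => ?_
    rw [sum_apply]
    have h1 : ∀ i, (fsmul _ (hc i) (restrict hU (frame n I F A x₀ (b i)))).1 x =
        b.repr (sectionCoord F x₀ V.1 x) i • (frame n I F A x₀ (b i)).1 x := fun i => by
      rw [← restrict_apply hU _ hx]; rfl
    rw [Finset.sum_congr rfl fun i _ => h1 i, ← frame_sectionCoord (n := n) (I := I) (hU hx) V.1]
    conv_lhs => rw [← b.sum_repr (sectionCoord F x₀ V.1 x), map_sum, sum_apply]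
    simp only [map_smul]
    rfl
  rw [h]
  refine Finset.sum_induction _ p hadd ?_ fun i _ => hsmul _ _ _ (hframe _)
  -- The empty sum is the frame section with zero coefficient, so no separate hypothesis for the
  -- zero section is needed.
  have h0 : restrict hU (frame n I F A x₀ 0) = 0 := ext_on fun x hx => by
    rw [restrict_apply hU _ hx, map_zero]
    rfl
  exact h0 ▸ hframe 0

end LocalSections

end LocalFrames

/-! ### Skew algebroids and their bracket in a trivialization -/

section SkewAlgebroids

open Filter Topology LocalSections

/-- A Lie algebroid without the Jacobi identity and without the compatibility of the anchor with
brackets. -/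
structure SkewAlgebroid {𝕜 : Type*} [NontriviallyNormedField 𝕜]
    {E : Type*} [NormedAddCommGroup E] [NormedSpace 𝕜 E]
    {H : Type*} [TopologicalSpace H]
    {X : Type*} [TopologicalSpace X] [ChartedSpace H X]
    (n : ℕ∞ω) (I : ModelWithCorners 𝕜 E H) [IsManifold I 1 X]
    (F : Type*) [NormedAddCommGroup F] [NormedSpace 𝕜 F]
    (A : X → Type*) [TopologicalSpace (TotalSpace F A)]
    [∀ x, AddCommGroup (A x)] [∀ x, Module 𝕜 (A x)] [∀ x, TopologicalSpace (A x)]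
    [FiberBundle F A] [VectorBundle 𝕜 F A] where
  anchor : Π x, A x →ₗ[𝕜] TangentSpace I x
  contMDiff_anchor : ContMDiff (I.prod 𝓘(𝕜, F)) I.tangent n
    (fun v : TotalSpace F A => (⟨v.1, anchor v.1 v.2⟩ : TangentBundle I X))
  bracket : Π U : Opens X,
    LocalSections n I F A U →ₗ[𝕜] LocalSections n I F A U →ₗ[𝕜] LocalSections n I F A U
  bracket_restrict : ∀ (U U' : Opens X), U' ≤ U → ∀ (V W : LocalSections n I F A U)
    (V' W' : LocalSections n I F A U'),
    (∀ x ∈ U', V'.1 x = V.1 x) → (∀ x ∈ U', W'.1 x = W.1 x) →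
    ∀ x ∈ U', (bracket U' V' W').1 x = (bracket U V W).1 x
  bracket_self : ∀ (U : Opens X) (V : LocalSections n I F A U), bracket U V V = 0
  leibniz : ∀ (U : Opens X) (V W : LocalSections n I F A U) (f : X → 𝕜)
    (hf : ContMDiffOn I 𝓘(𝕜, 𝕜) n f U), ∀ x ∈ U,
    (bracket U V (LocalSections.fsmul f hf W)).1 x =
      mvfderiv I f x (anchor x (V.1 x)) • W.1 x + f x • (bracket U V W).1 x

variable {𝕜 : Type*} [NontriviallyNormedField 𝕜]
  {E : Type*} [NormedAddCommGroup E] [NormedSpace 𝕜 E]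
  {H : Type*} [TopologicalSpace H]
  {X : Type*} [TopologicalSpace X] [ChartedSpace H X]
  {n : ℕ∞ω} {I : ModelWithCorners 𝕜 E H} [IsManifold I 1 X]
  {F : Type*} [NormedAddCommGroup F] [NormedSpace 𝕜 F]
  {A : X → Type*} [TopologicalSpace (TotalSpace F A)]
  [∀ x, AddCommGroup (A x)] [∀ x, Module 𝕜 (A x)] [∀ x, TopologicalSpace (A x)]
  [FiberBundle F A] [VectorBundle 𝕜 F A]

/-- The skew algebroid underlying a Lie algebroid. -/
def LieAlgebroid.toSkew (L : LieAlgebroid n I F A) : SkewAlgebroid n I F A where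
  anchor := L.anchor
  contMDiff_anchor := L.contMDiff_anchor
  bracket := L.bracket
  bracket_restrict := L.bracket_restrict
  bracket_self := L.bracket_self
  leibniz := L.leibniz

theorem LieAlgebroid.ext_of {L L' : LieAlgebroid n I F A} (h : ∀ x v, L.anchor x v = L'.anchor x v)
    (h' : ∀ U V W, ∀ x ∈ U, (L.bracket U V W).1 x = (L'.bracket U V W).1 x) : L = L' := by
  have h1 : L.anchor = L'.anchor := funext fun x => LinearMap.ext (h x)
  have h2 : L.bracket = L'.bracket := funext fun U => LinearMap.ext fun V => LinearMap.ext fun W =>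
    LocalSections.ext_on (h' U V W)
  cases L
  cases L'
  subst h1 h2
  rfl

namespace SkewAlgebroid

variable (S : SkewAlgebroid n I F A)

theorem bracket_skew (U : Opens X) (V W : LocalSections n I F A U) :
    S.bracket U V W = -S.bracket U W V := by
  have h := S.bracket_self U (V + W)
  simp only [map_add, LinearMap.add_apply, S.bracket_self, zero_add, add_zero] at h
  exact eq_neg_of_add_eq_zero_left ((add_comm _ _).trans h)

/-- Compatibility with restriction makes the bracket local: comparing both sides with a common
smaller open set shows that only germs at `x` matter. -/
theorem bracket_congr {U U' : Opens X} {V W : LocalSections n I F A U}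
    {V' W' : LocalSections n I F A U'} {x : X} (hx : x ∈ U) (hx' : x ∈ U')
    (hV : ∀ᶠ y in 𝓝 x, V.1 y = V'.1 y) (hW : ∀ᶠ y in 𝓝 x, W.1 y = W'.1 y) :
    (S.bracket U V W).1 x = (S.bracket U' V' W').1 x := by
  obtain ⟨s, hs, hso, hxs⟩ := mem_nhds_iff.1 (hV.and hW)
  let U'' : Opens X := U ⊓ U' ⊓ ⟨s, hso⟩
  have hU : U'' ≤ U := inf_le_left.trans inf_le_left
  have hU' : U'' ≤ U' := inf_le_left.trans inf_le_right
  have hx'' : x ∈ U'' := ⟨⟨hx, hx'⟩, hxs⟩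
  rw [← S.bracket_restrict U U'' hU V W (restrict hU V) (restrict hU W)
    (fun y hy => LocalSections.restrict_apply hU V hy) (fun y hy => LocalSections.restrict_apply hU W hy) x hx'',
    S.bracket_restrict U' U'' hU' V' W' (restrict hU V) (restrict hU W)
    (fun y hy => (LocalSections.restrict_apply hU V hy).trans (hs hy.2).1)
    (fun y hy => (LocalSections.restrict_apply hU W hy).trans (hs hy.2).2) x hx'']

theorem bracket_add_right_apply {U : Opens X} (V W Z : LocalSections n I F A U) (x : X) :
    (S.bracket U V (W + Z)).1 x = (S.bracket U V W).1 x + (S.bracket U V Z).1 x := by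
  rw [map_add]; rfl

theorem bracket_skew_apply {U : Opens X} (V W : LocalSections n I F A U) (x : X) :
    (S.bracket U V W).1 x = -(S.bracket U W V).1 x := by
  rw [S.bracket_skew]; rfl

variable [ContMDiffVectorBundle n F A I]

/-- Both sides are additive in `W` and obey the same Leibniz rule, so frames suffice, and these have
coordinates with zero derivative. The last term is the bracket of `V` with the section that freezes
the coordinates of `W` at `x`. -/
theorem bracket_eq_of_le [CompleteSpace 𝕜] [FiniteDimensional 𝕜 F] (hn : ∞ ≤ n) {x₀ : X}
    {U : Opens X} (hU : U ≤ trivOpens F A x₀) (V W : LocalSections n I F A U) {x : X} (hx : x ∈ U) :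
    (S.bracket U V W).1 x = trivSymm x₀ x (mvfderiv I (sectionCoord F x₀ W.1) x (S.anchor x (V.1 x))) +
      (S.bracket U V (restrict hU (frame n I F A x₀ (sectionCoord F x₀ W.1 x)))).1 x := by
  have hs := isLinearMap_trivSymm 𝕜 F A x₀ x
  have hr := isLinearMap_sectionCoord (A := A) 𝕜 (hU hx)
  have hn0 : n ≠ 0 := by rintro rfl; simp at hn
  have hd : ∀ W : LocalSections n I F A U,
      MDifferentiableAt I 𝓘(𝕜, F) (sectionCoord F x₀ W.1) x := fun W =>
    (contMDiffAt_sectionCoord W hx (hU hx)).mdifferentiableAt hn0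
  have hev : ∀ᶠ y in 𝓝 x, y ∈ U := U.isOpen.mem_nhds hx
  refine frame_induction hU (p := fun W => (S.bracket U V W).1 x = trivSymm x₀ x
      (mvfderiv I (sectionCoord F x₀ W.1) x (S.anchor x (V.1 x))) +
      (S.bracket U V (restrict hU (frame n I F A x₀ (sectionCoord F x₀ W.1 x)))).1 x)
    (fun a => ?_) (fun W Z hW hZ => ?_) (fun f hf W hW => ?_) W
  · have h1 := sectionCoord_congr_of_eventuallyEq (F := F) x₀
      (restrict_eventuallyEq hU (frame n I F A x₀ a) hx)
    rw [h1.mvfderiv_eq, mvfderiv_sectionCoord_frame (hU hx), zero_apply, hs.map_zero, zero_add,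
      h1.eq_of_nhds, sectionCoord_frame (hU hx)]
  · have h1 : sectionCoord F x₀ (W + Z).1 =ᶠ[𝓝 x]
        fun y => sectionCoord F x₀ W.1 y + sectionCoord F x₀ Z.1 y := by
      filter_upwards [hev] with y hy
      exact (isLinearMap_sectionCoord 𝕜 (hU hy)).map_add W.1 Z.1
    rw [h1.mvfderiv_eq, mvfderiv_fun_add (hd W) (hd Z), add_apply, hs.map_add,
      bracket_add_right_apply, hW, hZ, h1.eq_of_nhds, map_add]
    have h2 : ∀ a b, restrict hU (frame n I F A x₀ a + frame n I F A x₀ b) =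
        restrict hU (frame n I F A x₀ a) + restrict hU (frame n I F A x₀ b) := by
      intro a b
      refine ext_on fun y hy => ?_
      rw [LocalSections.restrict_apply hU _ hy]
      exact congrArg₂ (· + ·) (LocalSections.restrict_apply hU (frame n I F A x₀ a) hy).symm
        (LocalSections.restrict_apply hU (frame n I F A x₀ b) hy).symm
    rw [h2, bracket_add_right_apply]
    abel
  · have hfx : MDifferentiableAt I 𝓘(𝕜, 𝕜) f x :=
      (hf.contMDiffAt (U.isOpen.mem_nhds hx)).mdifferentiableAt hn0
    have h1 : sectionCoord F x₀ (fsmul f hf W).1 =ᶠ[𝓝 x]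
        fun y => f y • sectionCoord F x₀ W.1 y := by
      filter_upwards [hev] with y hy
      exact (isLinearMap_sectionCoord 𝕜 (hU hy)).map_smul (f y) W.1
    rw [S.leibniz U V W f hf x hx, h1.mvfderiv_eq, mvfderiv_fun_smul hfx (hd W), h1.eq_of_nhds,
      map_smul]
    have h2 : restrict hU (f x • frame n I F A x₀ (sectionCoord F x₀ W.1 x)) =
        f x • restrict hU (frame n I F A x₀ (sectionCoord F x₀ W.1 x)) := by
      refine ext_on fun y hy => ?_
      rw [LocalSections.restrict_apply hU _ hy]
      exact congrArg (f x • ·) (LocalSections.restrict_apply hU (frame n I F A x₀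
        (sectionCoord F x₀ W.1 x)) hy).symm
    rw [h2, map_smul, add_apply, hs.map_add, smul_apply, hs.map_smul,
      ContinuousLinearMap.smulRight_apply, hs.map_smul, trivSymm_sectionCoord (hU hx), hW, smul_add]
    simp only [Submodule.coe_smul, Pi.smul_apply]
    abel

/-- The bracket of a skew algebroid in a local trivialization. -/
theorem bracket_eq [CompleteSpace 𝕜] [FiniteDimensional 𝕜 F] (hn : ∞ ≤ n) {x₀ : X}
    {U : Opens X} (V W : LocalSections n I F A U) {x : X} (hx : x ∈ U)
    (hx₀ : x ∈ trivOpens F A x₀) :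
    (S.bracket U V W).1 x =
      trivSymm x₀ x (mvfderiv I (sectionCoord F x₀ W.1) x (S.anchor x (V.1 x)) -
        mvfderiv I (sectionCoord F x₀ V.1) x (S.anchor x (W.1 x))) +
      (S.bracket (trivOpens F A x₀) (frame n I F A x₀ (sectionCoord F x₀ V.1 x))
        (frame n I F A x₀ (sectionCoord F x₀ W.1 x))).1 x := by
  let U' := U ⊓ trivOpens F A x₀
  have h1 : U' ≤ U := inf_le_left
  have h2 : U' ≤ trivOpens F A x₀ := inf_le_right
  have hx' : x ∈ U' := ⟨hx, hx₀⟩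
  have hs := isLinearMap_trivSymm 𝕜 F A x₀ x
  have hr : ∀ Z : LocalSections n I F A U, sectionCoord F x₀ (restrict h1 Z).1 =ᶠ[𝓝 x]
      sectionCoord F x₀ Z.1 := fun Z =>
    sectionCoord_congr_of_eventuallyEq x₀ (restrict_eventuallyEq h1 Z hx')
  have hf : ∀ Z : LocalSections n I F A U, (restrict h2
      (frame n I F A x₀ (sectionCoord F x₀ Z.1 x))).1 x = Z.1 x := fun Z => by
    rw [LocalSections.restrict_apply h2 _ hx', frame_sectionCoord hx₀]
  -- The one-sided formula freezes `W`; after swapping the arguments it freezes `V`, and swapping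
  -- back gives the symmetric formula.
  rw [S.bracket_congr hx hx' ((restrict_eventuallyEq h1 V hx').mono fun _ h => h.symm)
      ((restrict_eventuallyEq h1 W hx').mono fun _ h => h.symm),
    S.bracket_eq_of_le hn h2 _ _ hx', S.bracket_skew_apply, S.bracket_eq_of_le hn h2 _ _ hx',
    S.bracket_skew_apply, (hr W).mvfderiv_eq, (hr V).mvfderiv_eq, (hr W).eq_of_nhds,
    (hr V).eq_of_nhds, hf, LocalSections.restrict_apply h1 _ hx',
    S.bracket_congr hx' hx₀ (restrict_eventuallyEq h2 _ hx') (restrict_eventuallyEq h2 _ hx'),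
    hs.map_sub]
  abel

end SkewAlgebroid

end SkewAlgebroids

/-! ### Reduction of the Lie algebroid axioms to frames -/

section SkewAlgebroidJacobi

open Filter Topology LocalSections

variable {𝕜 : Type*} [NontriviallyNormedField 𝕜]
  {E : Type*} [NormedAddCommGroup E] [NormedSpace 𝕜 E]
  {H : Type*} [TopologicalSpace H]
  {X : Type*} [TopologicalSpace X] [ChartedSpace H X]
  {n : ℕ∞ω} {I : ModelWithCorners 𝕜 E H} [IsManifold I 1 X]
  {F : Type*} [NormedAddCommGroup F] [NormedSpace 𝕜 F]
  {A : X → Type*} [TopologicalSpace (TotalSpace F A)]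
  [∀ x, AddCommGroup (A x)] [∀ x, Module 𝕜 (A x)] [∀ x, TopologicalSpace (A x)]
  [FiberBundle F A] [VectorBundle 𝕜 F A] [ContMDiffVectorBundle n F A I]

namespace LocalSections

theorem frame_induction₂ [CompleteSpace 𝕜] [FiniteDimensional 𝕜 F] {x₀ : X} {U : Opens X}
    (hU : U ≤ trivOpens F A x₀)
    {p : LocalSections n I F A U → LocalSections n I F A U → Prop}
    (hframe : ∀ a b, p (restrict hU (frame n I F A x₀ a)) (restrict hU (frame n I F A x₀ b)))
    (hsymm : ∀ V W, p V W → p W V)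
    (hadd : ∀ V W Z, p V W → p V Z → p V (W + Z))
    (hsmul : ∀ (f : X → 𝕜) (hf : ContMDiffOn I 𝓘(𝕜, 𝕜) n f U) (V W), p V W → p V (fsmul f hf W))
    (V W : LocalSections n I F A U) : p V W :=
  frame_induction hU (p := fun W => p V W)
    (fun _ => hsymm _ _ (frame_induction hU (p := fun V => p _ V) (fun _ => hframe _ _)
      (hadd _) (fun f hf => hsmul f hf _) V)) (hadd _) (fun f hf => hsmul f hf _) W

/-- Cyclic invariance brings each slot in turn to the last place, so closure is needed in the last
slot only. -/
theorem frame_induction₃ [CompleteSpace 𝕜] [FiniteDimensional 𝕜 F] {x₀ : X} {U : Opens X}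
    (hU : U ≤ trivOpens F A x₀)
    {p : LocalSections n I F A U → LocalSections n I F A U → LocalSections n I F A U → Prop}
    (hframe : ∀ a b c, p (restrict hU (frame n I F A x₀ a)) (restrict hU (frame n I F A x₀ b))
      (restrict hU (frame n I F A x₀ c)))
    (hcycl : ∀ V W Z, p V W Z → p W Z V)
    (hadd : ∀ V W Z Z', p V W Z → p V W Z' → p V W (Z + Z'))
    (hsmul : ∀ (f : X → 𝕜) (hf : ContMDiffOn I 𝓘(𝕜, 𝕜) n f U) (V W Z), p V W Z →
      p V W (fsmul f hf Z))
    (V W Z : LocalSections n I F A U) : p V W Z := by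
  have h1 : ∀ a b Z, p (restrict hU (frame n I F A x₀ a)) (restrict hU (frame n I F A x₀ b)) Z :=
    fun a b Z => frame_induction hU (p := fun Z => p _ _ Z) (hframe a b) (hadd _ _)
      (fun f hf => hsmul f hf _ _) Z
  have h2 : ∀ b Z V, p (restrict hU (frame n I F A x₀ b)) Z V :=
    fun b Z V => frame_induction hU (p := fun V => p _ _ V) (fun a => hcycl _ _ _ (h1 a b Z))
      (hadd _ _) (fun f hf => hsmul f hf _ _) V
  exact frame_induction hU (p := fun Z => p _ _ Z)
    (fun b => hcycl _ _ _ (h2 b V W)) (hadd _ _) (fun f hf => hsmul f hf _ _) Z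

end LocalSections

namespace SkewAlgebroid

variable (S : SkewAlgebroid n I F A)

theorem contMDiffOn_anchor {U : Opens X} (V : LocalSections n I F A U) :
    ContMDiffOn I I.tangent n (fun y => (⟨y, S.anchor y (V.1 y)⟩ : TangentBundle I X)) U :=
  S.contMDiff_anchor.comp_contMDiffOn V.2.1

theorem mdifferentiableAt_anchor (hn : ∞ ≤ n) {U : Opens X} (V : LocalSections n I F A U) {x : X}
    (hx : x ∈ U) :
    MDifferentiableAt I I.tangent (fun y => (⟨y, S.anchor y (V.1 y)⟩ : TangentBundle I X)) x :=
  ((S.contMDiffOn_anchor V).contMDiffAt (U.isOpen.mem_nhds hx)).mdifferentiableAt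
    (by rintro rfl; simp at hn)

variable [IsRCLikeNormedField 𝕜] [CompleteSpace 𝕜] [CompleteSpace E] [I.Boundaryless]
  [FiniteDimensional 𝕜 F]

theorem anchor_bracket_congr {U U' : Opens X} {V W : LocalSections n I F A U}
    {V' W' : LocalSections n I F A U'} {x : X} (hx : x ∈ U) (hx' : x ∈ U')
    (hV : ∀ᶠ y in 𝓝 x, V.1 y = V'.1 y) (hW : ∀ᶠ y in 𝓝 x, W.1 y = W'.1 y)
    (h : S.anchor x ((S.bracket U' V' W').1 x) =
      mlieBracket I (fun y => S.anchor y (V'.1 y)) (fun y => S.anchor y (W'.1 y)) x) :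
    S.anchor x ((S.bracket U V W).1 x) =
      mlieBracket I (fun y => S.anchor y (V.1 y)) (fun y => S.anchor y (W.1 y)) x := by
  rw [S.bracket_congr hx hx' hV hW, h]
  exact (Filter.EventuallyEq.mlieBracket_vectorField_eq
    (hV.mono fun y hy => congrArg (S.anchor y) hy)
    (hW.mono fun y hy => congrArg (S.anchor y) hy)).symm

/-- By the two Leibniz rules, `ρ[V, W] - [ρV, ρW]` is linear over functions in each slot, hence
vanishes once it vanishes on frames. -/
theorem anchor_bracket_of_frame [IsManifold I 2 X] (hn : ∞ ≤ n)
    (ha : ∀ x₀ a b, ∀ x ∈ trivOpens F A x₀,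
      S.anchor x ((S.bracket _ (frame n I F A x₀ a) (frame n I F A x₀ b)).1 x) =
        mlieBracket I (fun y => S.anchor y ((frame n I F A x₀ a).1 y))
          (fun y => S.anchor y ((frame n I F A x₀ b).1 y)) x)
    (U : Opens X) (V W : LocalSections n I F A U) (x : X) (hx : x ∈ U) :
    S.anchor x ((S.bracket U V W).1 x) =
      mlieBracket I (fun y => S.anchor y (V.1 y)) (fun y => S.anchor y (W.1 y)) x := by
  have hn0 : n ≠ 0 := by rintro rfl; simp at hn
  let U' := U ⊓ trivOpens F A x
  have h1 : U' ≤ U := inf_le_left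
  have h2 : U' ≤ trivOpens F A x := inf_le_right
  have hx' : x ∈ U' := ⟨hx, mem_trivOpens_self F A x⟩
  refine S.anchor_bracket_congr hx hx' ((restrict_eventuallyEq h1 V hx').mono fun _ h => h.symm)
    ((restrict_eventuallyEq h1 W hx').mono fun _ h => h.symm) ?_
  refine frame_induction₂ h2 (p := fun V W => S.anchor x ((S.bracket U' V W).1 x) =
      mlieBracket I (fun y => S.anchor y (V.1 y)) (fun y => S.anchor y (W.1 y)) x)
    (fun a b => ?_) (fun V W h => ?_) (fun V W Z hW hZ => ?_) (fun f hf V W h => ?_) _ _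
  · exact S.anchor_bracket_congr hx' (h2 hx') (restrict_eventuallyEq h2 _ hx')
      (restrict_eventuallyEq h2 _ hx') (ha _ _ _ _ (h2 hx'))
  · rw [S.bracket_skew_apply, map_neg, h, mlieBracket_swap_apply]
    exact neg_neg _
  · rw [S.bracket_add_right_apply, map_add, hW, hZ]
    refine (mlieBracket_add_right (V := fun y => S.anchor y (V.1 y))
      (S.mdifferentiableAt_anchor hn W hx') (S.mdifferentiableAt_anchor hn Z hx')).symm.trans ?_
    exact congrArg (fun T => mlieBracket I _ T x) (funext fun y => (map_add (S.anchor y) _ _).symm)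
  · rw [S.leibniz U' V W f hf x hx', map_add, map_smul, map_smul, h]
    refine (mlieBracket_smul_right (V := fun y => S.anchor y (V.1 y))
      ((hf.contMDiffAt (U'.isOpen.mem_nhds hx')).mdifferentiableAt hn0)
      (S.mdifferentiableAt_anchor hn W hx')).symm.trans ?_
    exact congrArg (fun T => mlieBracket I _ T x) (funext fun y => (map_smul (S.anchor y) _ _).symm)

theorem mvfderiv_anchor_bracket [IsManifold I 2 X] [IsManifold I n X] (hn : ∞ ≤ n)
    {G : Type*} [NormedAddCommGroup G] [NormedSpace 𝕜 G] {U : Opens X}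
    {V W : LocalSections n I F A U} {x : X} (hx : x ∈ U)
    (ha : S.anchor x ((S.bracket U V W).1 x) =
      mlieBracket I (fun y => S.anchor y (V.1 y)) (fun y => S.anchor y (W.1 y)) x)
    {f : X → G} (hf : ContMDiffAt I 𝓘(𝕜, G) n f x) :
    mvfderiv I f x (S.anchor x ((S.bracket U V W).1 x)) =
      mvfderiv I (fun y => mvfderiv I f y (S.anchor y (W.1 y))) x (S.anchor x (V.1 x)) -
        mvfderiv I (fun y => mvfderiv I f y (S.anchor y (V.1 y))) x (S.anchor x (W.1 x)) := by
  have hn0 : n ≠ 0 := by rintro rfl; simp at hn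
  have hd : ∀ V : LocalSections n I F A U,
      MDifferentiableAt I 𝓘(𝕜, G) (fun y => mvfderiv I f y (S.anchor y (V.1 y))) x := fun V =>
    (ContMDiffAt.contMDiffAt_mvfderiv_apply (add_one_le_of_top_le hn) hf
      ((S.contMDiffOn_anchor V).contMDiffAt (U.isOpen.mem_nhds hx))).mdifferentiableAt hn0
  rw [ha]
  exact mvfderiv_mlieBracket (hf.of_le (natCast_le_of_top_le hn 2))
    (S.mdifferentiableAt_anchor hn V hx) (S.mdifferentiableAt_anchor hn W hx) (hd V) (hd W)

/-- Replacing `Z` by `fZ` multiplies the Jacobiator by `f`, up to the term `(ρ(V)ρ(W)f - ρ(W)ρ(V)f -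
ρ([V, W])f) Z`. This vanishes because the anchor preserves brackets, so that axiom has to be
available for all sections beforehand. -/
theorem jacobi_of_frame [IsManifold I 2 X] [IsManifold I n X] (hn : ∞ ≤ n)
    (ha : ∀ (U : Opens X) (V W : LocalSections n I F A U), ∀ x ∈ U,
      S.anchor x ((S.bracket U V W).1 x) =
        mlieBracket I (fun y => S.anchor y (V.1 y)) (fun y => S.anchor y (W.1 y)) x)
    (hj : ∀ x₀ a b c, ∀ x ∈ trivOpens F A x₀,
      (S.bracket _ (frame n I F A x₀ a) (S.bracket _ (frame n I F A x₀ b)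
        (frame n I F A x₀ c))).1 x +
      (S.bracket _ (frame n I F A x₀ b) (S.bracket _ (frame n I F A x₀ c)
        (frame n I F A x₀ a))).1 x +
      (S.bracket _ (frame n I F A x₀ c) (S.bracket _ (frame n I F A x₀ a)
        (frame n I F A x₀ b))).1 x = 0)
    (U : Opens X) (V W Z : LocalSections n I F A U) (x : X) (hx : x ∈ U) :
    (S.bracket U V (S.bracket U W Z)).1 x + (S.bracket U W (S.bracket U Z V)).1 x +
      (S.bracket U Z (S.bracket U V W)).1 x = 0 := by
  have key : ∀ {U U' : Opens X} (V W Z : LocalSections n I F A U)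
      (V' W' Z' : LocalSections n I F A U'), x ∈ U → x ∈ U' →
      (∀ᶠ y in 𝓝 x, V.1 y = V'.1 y) → (∀ᶠ y in 𝓝 x, W.1 y = W'.1 y) →
      (∀ᶠ y in 𝓝 x, Z.1 y = Z'.1 y) →
      (S.bracket U V (S.bracket U W Z)).1 x = (S.bracket U' V' (S.bracket U' W' Z')).1 x := by
    intro U U' V W Z V' W' Z' hx hx' hV hW hZ
    refine S.bracket_congr hx hx' hV ?_
    filter_upwards [U.isOpen.mem_nhds hx, U'.isOpen.mem_nhds hx', hW.eventually_nhds,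
      hZ.eventually_nhds] with y hy hy' hWy hZy
    exact S.bracket_congr hy hy' hWy hZy
  let U' := U ⊓ trivOpens F A x
  have h1 : U' ≤ U := inf_le_left
  have h2 : U' ≤ trivOpens F A x := inf_le_right
  have hx' : x ∈ U' := ⟨hx, mem_trivOpens_self F A x⟩
  have hr := fun V : LocalSections n I F A U =>
    (restrict_eventuallyEq h1 V hx').mono fun _ h => h.symm
  have hr' := fun V : LocalSections n I F A (trivOpens F A x) => restrict_eventuallyEq h2 V hx'
  rw [key V W Z _ _ _ hx hx' (hr V) (hr W) (hr Z), key W Z V _ _ _ hx hx' (hr W) (hr Z) (hr V),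
    key Z V W _ _ _ hx hx' (hr Z) (hr V) (hr W)]
  refine frame_induction₃ h2 (p := fun V W Z => (S.bracket U' V (S.bracket U' W Z)).1 x +
      (S.bracket U' W (S.bracket U' Z V)).1 x + (S.bracket U' Z (S.bracket U' V W)).1 x = 0)
    (fun a b c => ?_) (fun V W Z h => ?_) (fun V W Z Z' hZ hZ' => ?_) (fun f hf V W Z h => ?_) _ _ _
  · rw [key _ _ _ _ _ _ hx' (h2 hx') (hr' _) (hr' _) (hr' _),
      key _ _ _ _ _ _ hx' (h2 hx') (hr' (frame n I F A x b)) (hr' _) (hr' _),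
      key _ _ _ _ _ _ hx' (h2 hx') (hr' (frame n I F A x c)) (hr' _) (hr' _)]
    exact hj x a b c x (h2 hx')
  · rw [← h]
    abel
  · simp only [map_add, LinearMap.add_apply, Submodule.coe_add, Pi.add_apply]
    rw [← add_zero (0 : A x)]
    nth_rewrite 1 [← hZ]
    rw [← hZ']
    abel
  · have hdf : ∀ V : LocalSections n I F A U', ContMDiffOn I 𝓘(𝕜, 𝕜) n
        (fun y => mvfderiv I f y (S.anchor y (V.1 y))) U' := fun V =>
      ContMDiffOn.contMDiffOn_mvfderiv_apply (add_one_le_of_top_le hn) U'.isOpen hf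
        (S.contMDiffOn_anchor V)
    -- Two applications of the Leibniz rule; the mixed first-order terms are symmetric under
    -- exchange of `V` and `W` up to order, and drop out of the Jacobiator.
    have hl : ∀ V W : LocalSections n I F A U', (S.bracket U' V (S.bracket U' W
        (fsmul f hf Z))).1 x = mvfderiv I (fun y => mvfderiv I f y (S.anchor y (W.1 y))) x
          (S.anchor x (V.1 x)) • Z.1 x +
        mvfderiv I f x (S.anchor x (W.1 x)) • (S.bracket U' V Z).1 x +
        (mvfderiv I f x (S.anchor x (V.1 x)) • (S.bracket U' W Z).1 x +
          f x • (S.bracket U' V (S.bracket U' W Z)).1 x) := by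
      intro V W
      have : S.bracket U' W (fsmul f hf Z) = fsmul _ (hdf W) Z + fsmul f hf (S.bracket U' W Z) :=
        ext_on fun y hy => S.leibniz U' W Z f hf y hy
      rw [this, S.bracket_add_right_apply, S.leibniz U' V _ _ (hdf W) x hx',
        S.leibniz U' V _ f hf x hx']
    have hs : S.bracket U' (fsmul f hf Z) V = -S.bracket U' V (fsmul f hf Z) := S.bracket_skew _ _ _
    have hs' : S.bracket U' Z V = -S.bracket U' V Z := S.bracket_skew _ _ _
    -- This identity removes the second derivatives of `f`.
    have hm := S.mvfderiv_anchor_bracket hn hx' (ha U' V W x hx')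
      (hf.contMDiffAt (U'.isOpen.mem_nhds hx'))
    rw [hs'] at h
    rw [hs, S.bracket_skew_apply (fsmul f hf Z), S.leibniz U' _ Z f hf x hx', hl V W, hm]
    rw [map_neg, S.bracket_skew_apply Z] at h
    rw [map_neg]
    change _ + -(S.bracket U' W (S.bracket U' V (fsmul f hf Z))).1 x + _ = 0
    change _ + -(S.bracket U' W (S.bracket U' V Z)).1 x + _ = 0 at h
    rw [hl W V]
    linear_combination (norm := module) f x • h

/-- A skew algebroid which satisfies the remaining axioms of a Lie algebroid on local frames is a
Lie algebroid. -/
def toLieAlgebroid [IsManifold I 2 X] [IsManifold I n X] (hn : ∞ ≤ n)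
    (ha : ∀ x₀ a b, ∀ x ∈ trivOpens F A x₀,
      S.anchor x ((S.bracket _ (frame n I F A x₀ a) (frame n I F A x₀ b)).1 x) =
        mlieBracket I (fun y => S.anchor y ((frame n I F A x₀ a).1 y))
          (fun y => S.anchor y ((frame n I F A x₀ b).1 y)) x)
    (hj : ∀ x₀ a b c, ∀ x ∈ trivOpens F A x₀,
      (S.bracket _ (frame n I F A x₀ a) (S.bracket _ (frame n I F A x₀ b)
        (frame n I F A x₀ c))).1 x +
      (S.bracket _ (frame n I F A x₀ b) (S.bracket _ (frame n I F A x₀ c)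
        (frame n I F A x₀ a))).1 x +
      (S.bracket _ (frame n I F A x₀ c) (S.bracket _ (frame n I F A x₀ a)
        (frame n I F A x₀ b))).1 x = 0) : LieAlgebroid n I F A where
  anchor := S.anchor
  contMDiff_anchor := S.contMDiff_anchor
  bracket := S.bracket
  bracket_restrict := S.bracket_restrict
  bracket_self := S.bracket_self
  jacobi U V W Z := ext_on fun x hx =>
    S.jacobi_of_frame hn (S.anchor_bracket_of_frame hn ha) hj U V W Z x hx
  anchor_bracket := S.anchor_bracket_of_frame hn ha
  leibniz := S.leibniz

end SkewAlgebroid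

end SkewAlgebroidJacobi

/-! ### Bundle charts of the dual bundle -/

section DualBundleCoordinates

open Filter Topology LocalSections

variable {𝕜 : Type*} [NontriviallyNormedField 𝕜]
  {E : Type*} [NormedAddCommGroup E] [NormedSpace 𝕜 E]
  {H : Type*} [TopologicalSpace H]
  {X : Type*} [TopologicalSpace X] [ChartedSpace H X]
  {n : ℕ∞ω} {I : ModelWithCorners 𝕜 E H}
  {F : Type*} [NormedAddCommGroup F] [NormedSpace 𝕜 F]
  {A : X → Type*} [TopologicalSpace (TotalSpace F A)]
  [∀ x, AddCommGroup (A x)] [∀ x, Module 𝕜 (A x)] [∀ x, TopologicalSpace (A x)]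
  [FiberBundle F A] [VectorBundle 𝕜 F A]

/-- The fiber coordinate on the dual bundle defined by the preferred trivialization at `x₀`. -/
def dualCoord (x₀ : X) (ξ : DualTotal 𝕜 F A) : F →L[𝕜] 𝕜 :=
  (trivializationAt (F →L[𝕜] 𝕜) (DualBundle 𝕜 A) x₀ ξ).2

theorem mem_baseSet_dual_iff {x₀ x : X} :
    x ∈ (trivializationAt (F →L[𝕜] 𝕜) (DualBundle 𝕜 A) x₀).baseSet ↔ x ∈ trivOpens F A x₀ := by
  rw [hom_trivializationAt_baseSet]
  exact and_iff_left (mem_univ x)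

theorem dualCoord_apply {x₀ : X} {ξ : DualTotal 𝕜 F A} (hx : ξ.1 ∈ trivOpens F A x₀) (a : F) :
    dualCoord x₀ ξ a = ξ.2 (trivSymm x₀ ξ.1 a) := by
  have h : dualCoord x₀ ξ a = (trivializationAt 𝕜 (Trivial X 𝕜) x₀).continuousLinearMapAt 𝕜 ξ.1
    (ξ.2 ((trivializationAt F A x₀).symmL 𝕜 ξ.1 a)) := rfl
  rw [h, trivSymm_of_mem hx, Trivialization.symmL_apply _ hx,
    Trivialization.continuousLinearMapAt_apply, Trivialization.coe_linearMapAt_of_mem _ (mem_univ _)]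
  rfl

theorem dualCoord_sectionCoord {x₀ : X} {ξ : DualTotal 𝕜 F A} (hx : ξ.1 ∈ trivOpens F A x₀)
    (V : Π x, A x) : dualCoord x₀ ξ (sectionCoord F x₀ V ξ.1) = ξ.2 (V ξ.1) := by
  rw [dualCoord_apply hx, trivSymm_sectionCoord hx]

theorem extChartAt_dual (ξ₀ ξ : DualTotal 𝕜 F A) :
    extChartAt (I.prod 𝓘(𝕜, F →L[𝕜] 𝕜)) ξ₀ ξ = (extChartAt I ξ₀.1 ξ.1, dualCoord ξ₀.1 ξ) := by
  rw [FiberBundle.extChartAt]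
  rfl

theorem dualCoord_self (ξ : DualTotal 𝕜 F A) (a : F) :
    dualCoord ξ.1 ξ a = ξ.2 (trivSymm ξ.1 ξ.1 a) := dualCoord_apply (mem_trivOpens_self F A ξ.1) a

theorem continuous_dualProj : Continuous fun ξ : DualTotal 𝕜 F A => ξ.1 :=
  FiberBundle.continuous_proj (F →L[𝕜] 𝕜) (DualBundle 𝕜 A)

theorem contMDiffAt_dualCoord [ContMDiffVectorBundle n F A I] {x₀ : X} {ξ : DualTotal 𝕜 F A}
    (hx : ξ.1 ∈ trivOpens F A x₀) :
    ContMDiffAt (I.prod 𝓘(𝕜, F →L[𝕜] 𝕜)) 𝓘(𝕜, F →L[𝕜] 𝕜) n (dualCoord (𝕜 := 𝕜) (F := F) (A := A) x₀) ξ := by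
  have h := ((trivializationAt (F →L[𝕜] 𝕜) (DualBundle 𝕜 A) x₀).contMDiffAt_iff
    (IB := I) (n := n) (f := fun ξ : DualTotal 𝕜 F A => ξ)
    (IM := I.prod 𝓘(𝕜, F →L[𝕜] 𝕜)) (x₀ := ξ)
    ((Trivialization.mem_source _).2 (mem_baseSet_dual_iff.2 hx))).1 contMDiffAt_id
  exact h.2

variable [I.Boundaryless] [IsManifold I 1 X] [ContMDiffVectorBundle 1 F A I]

/-- The tangent space at `x` is identified with `E` by the preferred chart at `x`, so that chart has
the identity as derivative at its center. -/
theorem mvfderiv_extChartAt_self {M : Type*} [TopologicalSpace M] [ChartedSpace H M]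
    [IsManifold I 1 M] (x : M) (u : E) : mvfderiv I (extChartAt I x) x u = u := by
  have h1 : MDifferentiableAt I 𝓘(𝕜, E) (extChartAt I x) x :=
    mdifferentiableAt_extChartAt (mem_chart_source H x)
  have h2 : (extChartAt I x ∘ (extChartAt I x).symm) =ᶠ[𝓝 (extChartAt I x x)] id := by
    filter_upwards [extChartAt_target_mem_nhds (I := I) x] with y hy
    exact (extChartAt I x).right_inv hy
  have h3 : mvfderiv I (extChartAt I x) x = ContinuousLinearMap.id 𝕜 E := by
    rw [mvfderiv_eq_fderiv h1, h2.fderiv_eq, fderiv_id]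
  exact congrArg (fun L : E →L[𝕜] E => L u) h3

theorem mvfderiv_dualCoord_self (ξ : DualTotal 𝕜 F A) (u : E × (F →L[𝕜] 𝕜)) :
    mvfderiv (I.prod 𝓘(𝕜, F →L[𝕜] 𝕜)) (dualCoord (𝕜 := 𝕜) (F := F) (A := A) ξ.1) ξ u = u.2 := by
  have h1 : MDifferentiableAt (I.prod 𝓘(𝕜, F →L[𝕜] 𝕜)) 𝓘(𝕜, E × (F →L[𝕜] 𝕜))
    (extChartAt (I.prod 𝓘(𝕜, F →L[𝕜] 𝕜)) ξ) ξ :=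
    mdifferentiableAt_extChartAt (mem_chart_source _ ξ)
  have h2 := mvfderiv_clm_comp (ContinuousLinearMap.snd 𝕜 E (F →L[𝕜] 𝕜)) h1
  have h3 : (fun ζ => ContinuousLinearMap.snd 𝕜 E (F →L[𝕜] 𝕜)
      (extChartAt (I.prod 𝓘(𝕜, F →L[𝕜] 𝕜)) ξ ζ)) = dualCoord (𝕜 := 𝕜) (F := F) (A := A) ξ.1 :=
    funext fun ζ => congrArg Prod.snd (extChartAt_dual (I := I) ξ ζ)
  rw [h3] at h2
  rw [h2]
  exact congrArg Prod.snd (mvfderiv_extChartAt_self (I := I.prod 𝓘(𝕜, F →L[𝕜] 𝕜)) ξ u)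

theorem mvfderiv_comp_dualProj {G : Type*} [NormedAddCommGroup G] [NormedSpace 𝕜 G] {f : X → G}
    {ξ : DualTotal 𝕜 F A} (hf : MDifferentiableAt I 𝓘(𝕜, G) f ξ.1) (u : E × (F →L[𝕜] 𝕜)) :
    mvfderiv (I.prod 𝓘(𝕜, F →L[𝕜] 𝕜)) (fun ζ : DualTotal 𝕜 F A => f ζ.1) ξ u =
      mvfderiv I f ξ.1 u.1 := by
  have h1 : HasMFDerivAt (I.prod 𝓘(𝕜, F →L[𝕜] 𝕜)) I (fun ζ : DualTotal 𝕜 F A => ζ.1) ξ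
      (ContinuousLinearMap.fst 𝕜 E (F →L[𝕜] 𝕜)) := by
    refine ⟨continuous_dualProj.continuousAt, ?_⟩
    refine HasFDerivAt.hasFDerivWithinAt ?_
    refine (ContinuousLinearMap.fst 𝕜 E (F →L[𝕜] 𝕜)).hasFDerivAt.congr_of_eventuallyEq ?_
    filter_upwards [extChartAt_target_mem_nhds (I := I.prod 𝓘(𝕜, F →L[𝕜] 𝕜)) ξ] with y hy
    have h := (extChartAt (I.prod 𝓘(𝕜, F →L[𝕜] 𝕜)) ξ).right_inv hy
    rw [extChartAt_dual] at h
    exact congrArg Prod.fst h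
  have h2 := (HasMFDerivAt.comp ξ hf.hasMFDerivAt_mvfderiv h1).mvfderiv_eq
  exact congrArg (fun L : E × (F →L[𝕜] 𝕜) →L[𝕜] G => L u) h2

end DualBundleCoordinates

/-! ### Fiberwise affine functions and their differentials -/

section AffineFunctions

open Filter Topology LocalSections

variable {𝕜 : Type*} [NontriviallyNormedField 𝕜]
  {E : Type*} [NormedAddCommGroup E] [NormedSpace 𝕜 E]
  {H : Type*} [TopologicalSpace H]
  {X : Type*} [TopologicalSpace X] [ChartedSpace H X]
  {n : ℕ∞ω} {I : ModelWithCorners 𝕜 E H}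
  {F : Type*} [NormedAddCommGroup F] [NormedSpace 𝕜 F]
  {A : X → Type*} [TopologicalSpace (TotalSpace F A)]
  [∀ x, AddCommGroup (A x)] [∀ x, Module 𝕜 (A x)] [∀ x, TopologicalSpace (A x)]
  [FiberBundle F A] [VectorBundle 𝕜 F A]

/-- The fiberwise affine function `l_V + p^* f` on the dual bundle. -/
def affFun {U : Opens X} (V : LocalSections n I F A U) (f : X → 𝕜) : DualTotal 𝕜 F A → 𝕜 :=
  fun ξ => linFun V ξ + dualPull F A f ξ

theorem affFun_zero {U : Opens X} (V : LocalSections n I F A U) :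
    affFun V (fun _ => 0) = linFun V := funext fun _ => add_zero _

theorem zero_affFun {U : Opens X} (f : X → 𝕜) :
    affFun (0 : LocalSections n I F A U) f = dualPull F A f :=
  funext fun ξ => (congrArg (· + f ξ.1) (map_zero ξ.2)).trans (zero_add _)

theorem eventually_mem_trivOpens {x₀ : X} {ξ : DualTotal 𝕜 F A} (hx : ξ.1 ∈ trivOpens F A x₀) :
    ∀ᶠ ζ in 𝓝 ξ, ζ.1 ∈ trivOpens F A x₀ :=
  continuous_dualProj.continuousAt.eventually ((trivOpens F A x₀).isOpen.mem_nhds hx)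

theorem affFun_eventuallyEq {U : Opens X} (V : LocalSections n I F A U) (f : X → 𝕜) {x₀ : X}
    {ξ : DualTotal 𝕜 F A} (hx : ξ.1 ∈ trivOpens F A x₀) :
    affFun V f =ᶠ[𝓝 ξ] fun ζ => dualCoord x₀ ζ (sectionCoord F x₀ V.1 ζ.1) + f ζ.1 := by
  filter_upwards [eventually_mem_trivOpens hx] with ζ hζ
  rw [dualCoord_sectionCoord hζ]
  rfl

variable [ContMDiffVectorBundle n F A I]

theorem contMDiffAt_affFun {U : Opens X} (V : LocalSections n I F A U) {f : X → 𝕜}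
    {ξ : DualTotal 𝕜 F A} (hx : ξ.1 ∈ U) (hf : ContMDiffAt I 𝓘(𝕜, 𝕜) n f ξ.1) :
    ContMDiffAt (I.prod 𝓘(𝕜, F →L[𝕜] 𝕜)) 𝓘(𝕜, 𝕜) n (affFun V f) ξ := by
  have hx₀ := mem_trivOpens_self F A ξ.1
  have hp : ContMDiffAt (I.prod 𝓘(𝕜, F →L[𝕜] 𝕜)) I n (fun ζ : DualTotal 𝕜 F A => ζ.1) ξ :=
    Bundle.contMDiffAt_proj (DualBundle 𝕜 A)
  refine ContMDiffAt.congr_of_eventuallyEq ?_ (affFun_eventuallyEq V f hx₀)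
  exact (ContMDiffAt.clm_apply (contMDiffAt_dualCoord hx₀)
    ((contMDiffAt_sectionCoord V hx hx₀).comp ξ hp)).add (hf.comp ξ hp)

variable [I.Boundaryless] [IsManifold I 1 X] [ContMDiffVectorBundle 1 F A I]

/-- Product rule for the pairing of the fiber coordinate with the coordinates of `V`: the summands
come from moving in the fiber, from the variation of `V` along the base, and from `f`. -/
theorem mvfderiv_affFun (hn : 1 ≤ n) {U : Opens X} (V : LocalSections n I F A U) {f : X → 𝕜}
    {ξ : DualTotal 𝕜 F A} (hx : ξ.1 ∈ U) (hf : MDifferentiableAt I 𝓘(𝕜, 𝕜) f ξ.1)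
    (u : E × (F →L[𝕜] 𝕜)) :
    mvfderiv (I.prod 𝓘(𝕜, F →L[𝕜] 𝕜)) (affFun V f) ξ u =
      u.2 (sectionCoord F ξ.1 V.1 ξ.1) +
        ξ.2 (trivSymm ξ.1 ξ.1 (mvfderiv I (sectionCoord F ξ.1 V.1) ξ.1 u.1)) +
        mvfderiv I f ξ.1 u.1 := by
  have hn0 : n ≠ 0 := by rintro rfl; simp at hn
  have hx₀ := mem_trivOpens_self F A ξ.1
  have hs : MDifferentiableAt I 𝓘(𝕜, F) (sectionCoord F ξ.1 V.1) ξ.1 :=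
    (contMDiffAt_sectionCoord V hx hx₀).mdifferentiableAt hn0
  have hp : MDifferentiableAt (I.prod 𝓘(𝕜, F →L[𝕜] 𝕜)) I (fun ζ : DualTotal 𝕜 F A => ζ.1) ξ :=
    (Bundle.contMDiffAt_proj (n := 1) (DualBundle 𝕜 A)).mdifferentiableAt one_ne_zero
  have hd : MDifferentiableAt (I.prod 𝓘(𝕜, F →L[𝕜] 𝕜)) 𝓘(𝕜, F →L[𝕜] 𝕜)
      (dualCoord (𝕜 := 𝕜) (F := F) (A := A) ξ.1) ξ :=
    (contMDiffAt_dualCoord (n := n) (I := I) hx₀).mdifferentiableAt hn0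
  have hs' : MDifferentiableAt (I.prod 𝓘(𝕜, F →L[𝕜] 𝕜)) 𝓘(𝕜, F)
      (fun ζ : DualTotal 𝕜 F A => sectionCoord F ξ.1 V.1 ζ.1) ξ :=
    MDifferentiableAt.comp (g := sectionCoord F ξ.1 V.1) (f := fun ζ : DualTotal 𝕜 F A => ζ.1) ξ hs hp
  have hf' : MDifferentiableAt (I.prod 𝓘(𝕜, F →L[𝕜] 𝕜)) 𝓘(𝕜, 𝕜)
      (fun ζ : DualTotal 𝕜 F A => f ζ.1) ξ := MDifferentiableAt.comp (g := f) (f := fun ζ : DualTotal 𝕜 F A => ζ.1) ξ hf hp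
  have hds : MDifferentiableAt (I.prod 𝓘(𝕜, F →L[𝕜] 𝕜)) 𝓘(𝕜, 𝕜)
      (fun ζ : DualTotal 𝕜 F A => dualCoord ξ.1 ζ (sectionCoord F ξ.1 V.1 ζ.1)) ξ :=
    MDifferentiableAt.clm_apply hd hs'
  rw [(affFun_eventuallyEq V f hx₀).mvfderiv_eq, mvfderiv_fun_add hds hf']
  refine congrArg₂ (· + ·) ((mvfderiv_clm_apply hd hs' u).trans (congrArg₂ (· + ·) ?_ ?_))
    (mvfderiv_comp_dualProj hf u)
  · rw [mvfderiv_dualCoord_self]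
  · rw [mvfderiv_comp_dualProj hs u, dualCoord_self]

/-- The vertical part of a linear form on `E × F^*`, as an element of `F`. -/
def vertPart [CompleteSpace 𝕜] [FiniteDimensional 𝕜 F] :
    (E × (F →L[𝕜] 𝕜) →L[𝕜] 𝕜) →ₗ[𝕜] F :=
  (Module.evalEquiv 𝕜 F).symm.toLinearMap ∘ₗ
    { toFun := fun α => (α ∘L ContinuousLinearMap.inr 𝕜 E (F →L[𝕜] 𝕜)).toLinearMap ∘ₗ
        LinearMap.toContinuousLinearMap.toLinearMap
      map_add' := fun _ _ => rfl
      map_smul' := fun _ _ => rfl }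

theorem apply_vertPart [CompleteSpace 𝕜] [FiniteDimensional 𝕜 F] (α : E × (F →L[𝕜] 𝕜) →L[𝕜] 𝕜)
    (κ : F →L[𝕜] 𝕜) : κ (vertPart α) = α (0, κ) := by
  have h := Module.apply_evalEquiv_symm_apply 𝕜 F κ.toLinearMap
    ((α ∘L ContinuousLinearMap.inr 𝕜 E (F →L[𝕜] 𝕜)).toLinearMap ∘ₗ
        LinearMap.toContinuousLinearMap.toLinearMap)
  refine h.trans (congrArg (fun β => α (0, β)) ?_)
  ext v
  rfl

theorem apply_eq_vertPart [CompleteSpace 𝕜] [FiniteDimensional 𝕜 F]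
    (α : E × (F →L[𝕜] 𝕜) →L[𝕜] 𝕜) (u : E × (F →L[𝕜] 𝕜)) :
    α u = u.2 (vertPart α) + α (u.1, 0) := by
  rw [apply_vertPart, ← map_add]
  simp

theorem vertPart_eq [CompleteSpace 𝕜] [FiniteDimensional 𝕜 F] {α : E × (F →L[𝕜] 𝕜) →L[𝕜] 𝕜}
    {a : F} (h : ∀ κ, α (0, κ) = κ a) : vertPart α = a := by
  refine (Module.evalEquiv 𝕜 F).injective (LinearMap.ext fun φ => ?_)
  have := apply_vertPart α (LinearMap.toContinuousLinearMap φ)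
  rw [h] at this
  exact this

end AffineFunctions

/-! ### The bivector field of a skew algebroid -/

section LiePoissonConstruction

open Filter Topology LocalSections

variable {𝕜 : Type*} [NontriviallyNormedField 𝕜]
  {E : Type*} [NormedAddCommGroup E] [NormedSpace 𝕜 E]
  {H : Type*} [TopologicalSpace H]
  {X : Type*} [TopologicalSpace X] [ChartedSpace H X]
  {n : ℕ∞ω} {I : ModelWithCorners 𝕜 E H} [IsManifold I 1 X]
  {F : Type*} [NormedAddCommGroup F] [NormedSpace 𝕜 F]
  {A : X → Type*} [TopologicalSpace (TotalSpace F A)]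
  [∀ x, AddCommGroup (A x)] [∀ x, Module 𝕜 (A x)] [∀ x, TopologicalSpace (A x)]
  [FiberBundle F A] [VectorBundle 𝕜 F A] [ContMDiffVectorBundle n F A I]
  [CompleteSpace 𝕜] [FiniteDimensional 𝕜 F]

/-- The bivector on `E × F^*` defined by a bracket of elements of `F` and a linear map `F → E`. -/
def affineBivector (br : F →ₗ[𝕜] F →ₗ[𝕜] 𝕜) (ρ : F →ₗ[𝕜] E) :
    (E × (F →L[𝕜] 𝕜) →L[𝕜] 𝕜) →ₗ[𝕜] (E × (F →L[𝕜] 𝕜) →L[𝕜] 𝕜) →ₗ[𝕜] 𝕜 :=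
  let T : (E × (F →L[𝕜] 𝕜) →L[𝕜] 𝕜) →ₗ[𝕜] (E × (F →L[𝕜] 𝕜) →L[𝕜] 𝕜) →ₗ[𝕜] 𝕜 :=
    (ContinuousLinearMap.coeLM 𝕜).flip ∘ₗ (LinearMap.inl 𝕜 E (F →L[𝕜] 𝕜)) ∘ₗ ρ ∘ₗ vertPart
  br.compl₁₂ vertPart vertPart + (T - T.flip)

/-- The bracket of the frame vector fields, paired with a linear form on the fiber. -/
def SkewAlgebroid.frameBracket (S : SkewAlgebroid n I F A) (x₀ x : X) :
    F →ₗ[𝕜] F →ₗ[𝕜] A x :=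
  LinearMap.compr₂ ((S.bracket (trivOpens F A x₀)).compl₁₂ (frame n I F A x₀) (frame n I F A x₀))
    ((LinearMap.proj x).comp (Submodule.subtype _))

theorem SkewAlgebroid.frameBracket_apply (S : SkewAlgebroid n I F A) (x₀ x : X) (a b : F) :
    S.frameBracket x₀ x a b = (S.bracket _ (frame n I F A x₀ a) (frame n I F A x₀ b)).1 x := rfl

namespace SkewAlgebroid

variable (S : SkewAlgebroid n I F A)

/-- The fiberwise linear bivector field on the dual bundle defined by a skew algebroid. -/
def dualBivector : CotangentForm (I.prod 𝓘(𝕜, F →L[𝕜] 𝕜)) (DualTotal 𝕜 F A) := fun ξ =>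
  affineBivector (E := E) ((S.frameBracket ξ.1 ξ.1).compr₂ ξ.2.toLinearMap)
    (S.anchor ξ.1 ∘ₗ (isLinearMap_trivSymm 𝕜 F A ξ.1 ξ.1).mk')

theorem dualBivector_apply (ξ : DualTotal 𝕜 F A) (α β : E × (F →L[𝕜] 𝕜) →L[𝕜] 𝕜) :
    S.dualBivector ξ α β =
      ξ.2 ((S.bracket _ (frame n I F A ξ.1 (vertPart α)) (frame n I F A ξ.1 (vertPart β))).1 ξ.1) +
      (β (S.anchor ξ.1 (trivSymm ξ.1 ξ.1 (vertPart α)), 0) -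
        α (S.anchor ξ.1 (trivSymm ξ.1 ξ.1 (vertPart β)), 0)) := rfl

theorem dualBivector_self (ξ : DualTotal 𝕜 F A) (α : E × (F →L[𝕜] 𝕜) →L[𝕜] 𝕜) :
    S.dualBivector ξ α α = 0 := by
  rw [dualBivector_apply, sub_self, add_zero, S.bracket_self]
  exact map_zero ξ.2

variable [I.Boundaryless] [ContMDiffVectorBundle 1 F A I]

/-- The vertical part of `d(l_V + p^*f)` is the coordinate vector of `V`, and the horizontal part
holds the derivatives of those coordinates and of `f`. Inserted into the pointwise definition, they
reproduce the local formula for `[V, W]` paired with `ξ`, plus the two anchor derivatives. -/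
theorem dualBivector_bracket_affFun (hn : ∞ ≤ n) {U : Opens X} (V W : LocalSections n I F A U)
    {f g : X → 𝕜} {ξ : DualTotal 𝕜 F A} (hx : ξ.1 ∈ U) (hf : MDifferentiableAt I 𝓘(𝕜, 𝕜) f ξ.1)
    (hg : MDifferentiableAt I 𝓘(𝕜, 𝕜) g ξ.1) :
    S.dualBivector.bracket (affFun V f) (affFun W g) ξ =
      affFun (S.bracket U V W) (fun x => mvfderiv I g x (S.anchor x (V.1 x)) -
        mvfderiv I f x (S.anchor x (W.1 x))) ξ := by
  have h1 : (1 : ℕ∞ω) ≤ n := natCast_le_of_top_le hn 1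
  have hx₀ := mem_trivOpens_self F A ξ.1
  have hs := isLinearMap_trivSymm 𝕜 F A ξ.1 ξ.1
  obtain ⟨α, hα⟩ : ∃ α : E × (F →L[𝕜] 𝕜) →L[𝕜] 𝕜,
    α = mvfderiv (I.prod 𝓘(𝕜, F →L[𝕜] 𝕜)) (affFun V f) ξ := ⟨_, rfl⟩
  obtain ⟨β, hβ⟩ : ∃ β : E × (F →L[𝕜] 𝕜) →L[𝕜] 𝕜,
    β = mvfderiv (I.prod 𝓘(𝕜, F →L[𝕜] 𝕜)) (affFun W g) ξ := ⟨_, rfl⟩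
  have hα' : ∀ u, α u = _ := fun u =>
    (congrArg (fun L : E × (F →L[𝕜] 𝕜) →L[𝕜] 𝕜 => L u) hα).trans (mvfderiv_affFun h1 V hx hf u)
  have hβ' : ∀ u, β u = _ := fun u =>
    (congrArg (fun L : E × (F →L[𝕜] 𝕜) →L[𝕜] 𝕜 => L u) hβ).trans (mvfderiv_affFun h1 W hx hg u)
  have hz : ξ.2 (trivSymm ξ.1 ξ.1 (0 : F)) = 0 := by rw [hs.map_zero]; exact map_zero ξ.2
  have h0 : ∀ (L : E →L[𝕜] F) (D : E →L[𝕜] 𝕜) (c : 𝕜),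
      c + ξ.2 (trivSymm ξ.1 ξ.1 (L 0)) + D 0 = c := fun L D c => by
    rw [map_zero, map_zero, add_zero]
    exact (congrArg (c + ·) hz).trans (add_zero c)
  have hva : vertPart α = sectionCoord F ξ.1 V.1 ξ.1 := vertPart_eq fun κ =>
    (hα' _).trans (h0 (mvfderiv I _ ξ.1) (mvfderiv I f ξ.1) _)
  have hvb : vertPart β = sectionCoord F ξ.1 W.1 ξ.1 := vertPart_eq fun κ =>
    (hβ' _).trans (h0 (mvfderiv I _ ξ.1) (mvfderiv I g ξ.1) _)
  have h2 : S.dualBivector.bracket (affFun V f) (affFun W g) ξ = S.dualBivector ξ α β := by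
    rw [hα, hβ]; rfl
  rw [h2, dualBivector_apply, hva, hvb, trivSymm_sectionCoord hx₀, trivSymm_sectionCoord hx₀,
    hα', hβ']
  change _ = ξ.2 ((S.bracket U V W).1 ξ.1) + _
  have h3 : ∀ a b c : A ξ.1, (ξ.2 (a - b + c) : 𝕜) = ξ.2 a - ξ.2 b + ξ.2 c := fun a b c =>
    (map_add ξ.2 _ _).trans (congrArg (· + ξ.2 c) (map_sub ξ.2 a b))
  rw [S.bracket_eq hn V W hx hx₀, hs.map_sub, h3, zero_apply, zero_apply, dualPull]
  ring

end SkewAlgebroid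

variable [I.Boundaryless] [ContMDiffVectorBundle 1 F A I]

/-- A bundle chart is linear in the fiber: the vertical part of `u` pairs with a frame section, the
horizontal part with base coordinates. Hence the test functions of the Poisson criterion are affine.
-/
theorem coordFun_eventuallyEq (ξ : DualTotal 𝕜 F A) (u : E × (F →L[𝕜] 𝕜) →L[𝕜] 𝕜)
    {ζ : DualTotal 𝕜 F A} (hζ : ζ.1 ∈ trivOpens F A ξ.1) :
    coordFun (I.prod 𝓘(𝕜, F →L[𝕜] 𝕜)) ξ u =ᶠ[𝓝 ζ]
      affFun (frame n I F A ξ.1 (vertPart u))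
        (coordFun I ξ.1 (u ∘L ContinuousLinearMap.inl 𝕜 E (F →L[𝕜] 𝕜))) := by
  filter_upwards [eventually_mem_trivOpens hζ] with η hη
  refine (congrArg u (extChartAt_dual (I := I) ξ η)).trans ?_
  refine (apply_eq_vertPart u _).trans ?_
  exact congrArg₂ (· + ·) (dualCoord_apply hη _) rfl

theorem mvfderiv_coordFun_self (ξ : DualTotal 𝕜 F A) (u : E × (F →L[𝕜] 𝕜) →L[𝕜] 𝕜) :
    mvfderiv (I.prod 𝓘(𝕜, F →L[𝕜] 𝕜)) (coordFun (I.prod 𝓘(𝕜, F →L[𝕜] 𝕜)) ξ u) ξ = u := by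
  have h1 : MDifferentiableAt (I.prod 𝓘(𝕜, F →L[𝕜] 𝕜)) 𝓘(𝕜, E × (F →L[𝕜] 𝕜))
    (extChartAt (I.prod 𝓘(𝕜, F →L[𝕜] 𝕜)) ξ) ξ :=
    mdifferentiableAt_extChartAt (mem_chart_source _ ξ)
  refine (mvfderiv_clm_comp u h1).trans ?_
  ext v
  exact congrArg u (mvfderiv_extChartAt_self (I := I.prod 𝓘(𝕜, F →L[𝕜] 𝕜)) ξ v)

/-- Thus every covector at `ξ` is the differential of an affine function, which is the source of all
uniqueness statements about the tensor. -/
theorem mvfderiv_affFun_frame (ξ : DualTotal 𝕜 F A) (u : E × (F →L[𝕜] 𝕜) →L[𝕜] 𝕜) :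
    mvfderiv (I.prod 𝓘(𝕜, F →L[𝕜] 𝕜)) (affFun (frame n I F A ξ.1 (vertPart u))
      (coordFun I ξ.1 (u ∘L ContinuousLinearMap.inl 𝕜 E (F →L[𝕜] 𝕜)))) ξ = u :=
  (coordFun_eventuallyEq ξ u (mem_trivOpens_self F A ξ.1)).symm.mvfderiv_eq.trans
    (mvfderiv_coordFun_self ξ u)

end LiePoissonConstruction

/-! ### Existence of the Lie–Poisson structure -/

section LiePoissonExistence

open Filter Topology LocalSections

variable {𝕜 : Type*} [NontriviallyNormedField 𝕜]
  {E : Type*} [NormedAddCommGroup E] [NormedSpace 𝕜 E]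
  {H : Type*} [TopologicalSpace H]
  {X : Type*} [TopologicalSpace X] [ChartedSpace H X]
  {n : ℕ∞ω} {I : ModelWithCorners 𝕜 E H} [IsManifold I 1 X]
  {F : Type*} [NormedAddCommGroup F] [NormedSpace 𝕜 F]
  {A : X → Type*} [TopologicalSpace (TotalSpace F A)]
  [∀ x, AddCommGroup (A x)] [∀ x, Module 𝕜 (A x)] [∀ x, TopologicalSpace (A x)]
  [FiberBundle F A] [VectorBundle 𝕜 F A] [ContMDiffVectorBundle n F A I]
  [CompleteSpace 𝕜] [FiniteDimensional 𝕜 F] [FiniteDimensional 𝕜 E] [IsRCLikeNormedField 𝕜]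
  [I.Boundaryless]

namespace LieAlgebroid

variable (L : LieAlgebroid n I F A)

/-- The derivative of a function along the anchor of a section. -/
def deriv {U : Opens X} (V : LocalSections n I F A U) (f : X → 𝕜) : X → 𝕜 :=
  fun x => mvfderiv I f x (L.anchor x (V.1 x))

theorem contMDiffAt_deriv [IsManifold I n X] (hn : ∞ ≤ n) {U : Opens X}
    (V : LocalSections n I F A U) {f : X → 𝕜} {x : X}
    (hx : x ∈ U) (hf : ContMDiffAt I 𝓘(𝕜, 𝕜) n f x) : ContMDiffAt I 𝓘(𝕜, 𝕜) n (L.deriv V f) x :=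
  ContMDiffAt.contMDiffAt_mvfderiv_apply (add_one_le_of_top_le hn) hf
    ((L.toSkew.contMDiffOn_anchor V).contMDiffAt (U.isOpen.mem_nhds hx))

theorem deriv_sub_apply (hn : ∞ ≤ n) {U : Opens X}
    (V : LocalSections n I F A U) {f g : X → 𝕜} {x : X}
    (hf : ContMDiffAt I 𝓘(𝕜, 𝕜) n f x) (hg : ContMDiffAt I 𝓘(𝕜, 𝕜) n g x) :
    L.deriv V (fun y => f y - g y) x = L.deriv V f x - L.deriv V g x := by
  have hn0 : n ≠ 0 := by rintro rfl; simp at hn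
  rw [deriv, mvfderiv_fun_sub (hf.mdifferentiableAt hn0) (hg.mdifferentiableAt hn0)]
  rfl

theorem deriv_bracket_apply [IsManifold I n X] (hn : ∞ ≤ n) {U : Opens X}
    (V W : LocalSections n I F A U) {f : X → 𝕜} {x : X}
    (hx : x ∈ U) (hf : ContMDiffAt I 𝓘(𝕜, 𝕜) n f x) :
    L.deriv (L.bracket U V W) f x = L.deriv V (L.deriv W f) x - L.deriv W (L.deriv V f) x := by
  have : IsManifold I 2 X := IsManifold.of_le (natCast_le_of_top_le hn 2)
  have : CompleteSpace E := FiniteDimensional.complete 𝕜 E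
  exact L.toSkew.mvfderiv_anchor_bracket hn hx (L.anchor_bracket U V W x hx) hf

/-- The fiberwise linear bivector field on the dual bundle defined by a Lie algebroid. -/
def liePoisson : CotangentForm (I.prod 𝓘(𝕜, F →L[𝕜] 𝕜)) (DualTotal 𝕜 F A) := L.toSkew.dualBivector

theorem liePoisson_bracket_affFun (hn : ∞ ≤ n) {U : Opens X} (V W : LocalSections n I F A U)
    {f g : X → 𝕜} {ξ : DualTotal 𝕜 F A} (hx : ξ.1 ∈ U) (hf : ContMDiffAt I 𝓘(𝕜, 𝕜) n f ξ.1)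
    (hg : ContMDiffAt I 𝓘(𝕜, 𝕜) n g ξ.1) :
    L.liePoisson.bracket (affFun V f) (affFun W g) ξ =
      affFun (L.bracket U V W) (fun x => L.deriv V g x - L.deriv W f x) ξ := by
  have hn0 : n ≠ 0 := by rintro rfl; simp at hn
  have : ContMDiffVectorBundle 1 F A I := ContMDiffVectorBundle.of_le (natCast_le_of_top_le hn 1)
  exact L.toSkew.dualBivector_bracket_affFun hn V W hx (hf.mdifferentiableAt hn0)
    (hg.mdifferentiableAt hn0)

/-- A nested bracket differentiates the inner one, so its formula is needed on a neighborhood and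
not only at `ξ`. -/
theorem liePoisson_bracket_affFun_eventuallyEq [IsManifold I n X] (hn : ∞ ≤ n) {U : Opens X}
    (V W : LocalSections n I F A U)
    {f g : X → 𝕜} {ξ : DualTotal 𝕜 F A} (hx : ξ.1 ∈ U) (hf : ContMDiffAt I 𝓘(𝕜, 𝕜) n f ξ.1)
    (hg : ContMDiffAt I 𝓘(𝕜, 𝕜) n g ξ.1) :
    L.liePoisson.bracket (affFun V f) (affFun W g) =ᶠ[𝓝 ξ]
      affFun (L.bracket U V W) (fun x => L.deriv V g x - L.deriv W f x) := by
  have h1 : (1 : ℕ∞ω) ≤ n := natCast_le_of_top_le hn 1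
  have : ContMDiffVectorBundle 1 F A I := ContMDiffVectorBundle.of_le h1
  have hev : ∀ {p : X → Prop}, (∀ᶠ x in 𝓝 ξ.1, p x) → ∀ᶠ ζ in 𝓝 ξ, p ζ.1 := fun h =>
    continuous_dualProj.continuousAt.eventually h
  filter_upwards [hev (U.isOpen.mem_nhds hx),
    hev ((contMDiffAt_iff_contMDiffAt_nhds (by simp)).1 (hf.of_le h1)),
    hev ((contMDiffAt_iff_contMDiffAt_nhds (by simp)).1 (hg.of_le h1))] with ζ hζ hfζ hgζ
  exact L.toSkew.dualBivector_bracket_affFun hn V W hζ (hfζ.mdifferentiableAt (by simp))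
    (hgζ.mdifferentiableAt (by simp))

/-- On affine functions the Jacobiator splits. Its fiberwise linear part is the Jacobi identity for
sections; in its basic part, the iterated derivatives cancel over cyclic permutations because `[V,
W]` acts on functions as the commutator of `V` and `W`. -/
theorem isPoisson_liePoisson [IsManifold I n X] (hn : ∞ ≤ n) : L.liePoisson.IsPoisson n := by
  have hn0 : n ≠ 0 := by rintro rfl; simp at hn
  have : ContMDiffVectorBundle 1 F A I := ContMDiffVectorBundle.of_le (natCast_le_of_top_le hn 1)
  let J := I.prod 𝓘(𝕜, F →L[𝕜] 𝕜)
  let V (ξ : DualTotal 𝕜 F A) (u : E × (F →L[𝕜] 𝕜) →L[𝕜] 𝕜) := frame n I F A ξ.1 (vertPart u)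
  let f (ξ : DualTotal 𝕜 F A) (u : E × (F →L[𝕜] 𝕜) →L[𝕜] 𝕜) : X → 𝕜 :=
    coordFun I ξ.1 (u ∘L ContinuousLinearMap.inl 𝕜 E (F →L[𝕜] 𝕜))
  have hf : ∀ ξ u, ContMDiffAt I 𝓘(𝕜, 𝕜) n (f ξ u) ξ.1 := fun ξ u =>
    contMDiffAt_coordFun _ _ (mem_chart_source H ξ.1)
  have hx : ∀ ξ : DualTotal 𝕜 F A, ξ.1 ∈ trivOpens F A ξ.1 := fun ξ => mem_trivOpens_self F A ξ.1
  have hd : ∀ ξ u v, ContMDiffAt I 𝓘(𝕜, 𝕜) n (L.deriv (V ξ u) (f ξ v)) ξ.1 := fun ξ u v =>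
    L.contMDiffAt_deriv hn _ (hx ξ) (hf ξ v)
  have hc : ∀ ξ u, coordFun J ξ u =ᶠ[𝓝 ξ] affFun (V ξ u) (f ξ u) := fun ξ u =>
    coordFun_eventuallyEq ξ u (hx ξ)
  have hb : ∀ ξ u v, L.liePoisson.bracket (coordFun J ξ u) (coordFun J ξ v) =ᶠ[𝓝 ξ]
      affFun (L.bracket _ (V ξ u) (V ξ v))
        (fun x => L.deriv (V ξ u) (f ξ v) x - L.deriv (V ξ v) (f ξ u) x) := by
    intro ξ u v
    have h1 : L.liePoisson.bracket (coordFun J ξ u) (coordFun J ξ v) =ᶠ[𝓝 ξ]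
        L.liePoisson.bracket (affFun (V ξ u) (f ξ u)) (affFun (V ξ v) (f ξ v)) := by
      filter_upwards [(hc ξ u).eventually_nhds, (hc ξ v).eventually_nhds] with ζ h h'
      exact CotangentForm.bracket_congr_of_eventuallyEq _ h h'
    exact h1.trans (L.liePoisson_bracket_affFun_eventuallyEq hn _ _ (hx ξ) (hf ξ u) (hf ξ v))
  refine CotangentForm.IsPoisson.of_coordFun _ hn ?_ ?_ ?_
  · exact fun ξ α => L.toSkew.dualBivector_self ξ α
  · intro ξ u v
    exact (contMDiffAt_affFun _ (hx ξ) ((hd ξ u v).sub (hd ξ v u))).congr_of_eventuallyEq (hb ξ u v)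
  · intro ξ u v w
    have h2 : ∀ u v w, L.liePoisson.bracket (coordFun J ξ u)
        (L.liePoisson.bracket (coordFun J ξ v) (coordFun J ξ w)) ξ =
        affFun (L.bracket _ (V ξ u) (L.bracket _ (V ξ v) (V ξ w)))
          (fun x => L.deriv (V ξ u) (fun x => L.deriv (V ξ v) (f ξ w) x - L.deriv (V ξ w) (f ξ v) x) x
            - L.deriv (L.bracket _ (V ξ v) (V ξ w)) (f ξ u) x) ξ := by
      intro u v w
      rw [CotangentForm.bracket_congr_of_eventuallyEq _ (hc ξ u) (hb ξ v w)]
      exact L.liePoisson_bracket_affFun hn _ _ (hx ξ) (hf ξ u) ((hd ξ v w).sub (hd ξ w v))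
    have h3 : ∀ u v w, L.liePoisson.bracket (coordFun J ξ u)
        (L.liePoisson.bracket (coordFun J ξ v) (coordFun J ξ w)) ξ =
        linFun (L.bracket _ (V ξ u) (L.bracket _ (V ξ v) (V ξ w))) ξ +
        (L.deriv (V ξ u) (L.deriv (V ξ v) (f ξ w)) ξ.1 -
          L.deriv (V ξ u) (L.deriv (V ξ w) (f ξ v)) ξ.1 -
        (L.deriv (V ξ v) (L.deriv (V ξ w) (f ξ u)) ξ.1 -
          L.deriv (V ξ w) (L.deriv (V ξ v) (f ξ u)) ξ.1)) := by
      intro u v w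
      rw [h2, affFun, dualPull, L.deriv_sub_apply hn _ (hd ξ v w) (hd ξ w v),
        L.deriv_bracket_apply hn _ _ (hx ξ) (hf ξ u)]
    have h4 := congrArg (fun Z => linFun Z ξ) (L.jacobi _ (V ξ u) (V ξ v) (V ξ w))
    have h5 : ∀ Z Z' Z'' : LocalSections n I F A (trivOpens F A ξ.1),
        linFun (Z + Z' + Z'') ξ = linFun Z ξ + linFun Z' ξ + linFun Z'' ξ := fun Z Z' Z'' =>
      (map_add ξ.2 _ _).trans (congrArg (· + linFun Z'' ξ) (map_add ξ.2 _ _))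
    have h6 : linFun (0 : LocalSections n I F A (trivOpens F A ξ.1)) ξ = 0 := map_zero ξ.2
    rw [h3, h3, h3]
    simp only [h5, h6] at h4
    linear_combination h4

theorem isLiePoisson_liePoisson [IsManifold I n X] (hn : ∞ ≤ n) : L.IsLiePoisson L.liePoisson := by
  have hat : ∀ {U : Opens X} {f : X → 𝕜} {x : X}, ContMDiffOn I 𝓘(𝕜, 𝕜) n f U → x ∈ U →
      ContMDiffAt I 𝓘(𝕜, 𝕜) n f x := fun hf hx => hf.contMDiffAt (Opens.isOpen _ |>.mem_nhds hx)
  have hd0 : ∀ {U : Opens X} (V : LocalSections n I F A U) (x : X),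
      L.deriv V (fun _ => 0) x = 0 := fun V x => by
    rw [deriv, mvfderiv_const]; rfl
  have h0d : ∀ {U : Opens X} (f : X → 𝕜) (x : X),
      L.deriv (0 : LocalSections n I F A U) f x = 0 := fun {U} f x =>
    (congrArg (mvfderiv I f x) (map_zero (L.anchor x))).trans (map_zero (mvfderiv I f x))
  have hll : ∀ (U : Opens X) (V W : LocalSections n I F A U), ∀ ξ : DualTotal 𝕜 F A, ξ.1 ∈ U →
      L.liePoisson.bracket (linFun V) (linFun W) ξ = linFun (L.bracket U V W) ξ := by
    intro U V W ξ hx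
    rw [← affFun_zero V, ← affFun_zero W, L.liePoisson_bracket_affFun hn V W hx contMDiffAt_const
      contMDiffAt_const, affFun, dualPull, hd0, hd0, sub_zero, add_zero]
  have hlb : ∀ (U : Opens X) (V : LocalSections n I F A U) (f : X → 𝕜),
      ContMDiffOn I 𝓘(𝕜, 𝕜) n f U → ∀ ξ : DualTotal 𝕜 F A, ξ.1 ∈ U →
      L.liePoisson.bracket (linFun V) (dualPull F A f) ξ = dualPull F A (L.deriv V f) ξ := by
    intro U V f hf ξ hx
    rw [← affFun_zero V, ← zero_affFun (n := n) (I := I) (U := U) f,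
      L.liePoisson_bracket_affFun hn V 0 hx contMDiffAt_const (hat hf hx), affFun, dualPull, h0d,
      sub_zero, map_zero]
    exact (congrArg (· + _) (map_zero ξ.2)).trans (zero_add _)
  refine ⟨L.isPoisson_liePoisson hn, ⟨fun U V W => ⟨_, hll U V W⟩, fun U V f hf => ⟨L.deriv V f,
    fun x hx => (L.contMDiffAt_deriv hn V hx (hat hf hx)).contMDiffWithinAt, hlb U V f hf⟩,
    fun U f g hf hg ξ hx => ?_⟩, hll, hlb⟩
  rw [← zero_affFun (n := n) (I := I) (U := U) f, ← zero_affFun (n := n) (I := I) (U := U) g,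
    L.liePoisson_bracket_affFun hn 0 0 hx (hat hf hx) (hat hg hx), affFun, dualPull, h0d, h0d,
    sub_zero, map_zero, add_zero]
  exact map_zero ξ.2

end LieAlgebroid

end LiePoissonExistence

/-! ### Uniqueness on both sides of the Lie–Poisson correspondence -/

section LiePoissonUniqueness

open Filter Topology LocalSections

variable {𝕜 : Type*} [NontriviallyNormedField 𝕜]
  {E : Type*} [NormedAddCommGroup E] [NormedSpace 𝕜 E]
  {H : Type*} [TopologicalSpace H]
  {X : Type*} [TopologicalSpace X] [ChartedSpace H X]
  {n : ℕ∞ω} {I : ModelWithCorners 𝕜 E H} [IsManifold I 1 X]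
  {F : Type*} [NormedAddCommGroup F] [NormedSpace 𝕜 F]
  {A : X → Type*} [TopologicalSpace (TotalSpace F A)]
  [∀ x, AddCommGroup (A x)] [∀ x, Module 𝕜 (A x)] [∀ x, TopologicalSpace (A x)]
  [FiberBundle F A] [VectorBundle 𝕜 F A] [ContMDiffVectorBundle n F A I]
  [CompleteSpace 𝕜] [FiniteDimensional 𝕜 F] [FiniteDimensional 𝕜 E] [IsRCLikeNormedField 𝕜]
  [I.Boundaryless]

theorem CotangentForm.IsPoisson.skew {M : Type*} [TopologicalSpace M] [ChartedSpace H M]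
    {P : CotangentForm I M} (hP : P.IsPoisson n) (f g : M → 𝕜) (m : M) :
    P.bracket f g m = -P.bracket g f m := by
  have h := hP.alternating m (mvfderiv I f m + mvfderiv I g m)
  simp only [map_add, LinearMap.add_apply, hP.alternating, zero_add, add_zero] at h
  exact eq_neg_of_add_eq_zero_left ((add_comm _ _).trans h)

theorem eq_of_forall_clm_apply_eq {v w : E} (h : ∀ u : E →L[𝕜] 𝕜, u v = u w) : v = w := by
  refine sub_eq_zero.1 ((Module.forall_dual_apply_eq_zero_iff 𝕜 _).1 fun φ => ?_)
  rw [map_sub, sub_eq_zero]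
  exact h (LinearMap.toContinuousLinearMap φ)

namespace LieAlgebroid

variable {L L' : LieAlgebroid n I F A}
  {P P' : CotangentForm (I.prod 𝓘(𝕜, F →L[𝕜] 𝕜)) (DualTotal 𝕜 F A)}

/-- Bilinearity leaves four brackets: the formulas for `L`, with antisymmetry, settle three, and
fiberwise linearity kills the bracket of two basic functions. -/
theorem IsLiePoisson.bracket_affFun (hP : L.IsLiePoisson P) (hn : ∞ ≤ n) {U : Opens X}
    (V W : LocalSections n I F A U) {f g : X → 𝕜} (hf : ContMDiffOn I 𝓘(𝕜, 𝕜) n f U)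
    (hg : ContMDiffOn I 𝓘(𝕜, 𝕜) n g U) {ξ : DualTotal 𝕜 F A} (hx : ξ.1 ∈ U) :
    P.bracket (affFun V f) (affFun W g) ξ =
      affFun (L.bracket U V W) (fun x => L.deriv V g x - L.deriv W f x) ξ := by
  have hn0 : n ≠ 0 := by rintro rfl; simp at hn
  have hd : ∀ (V : LocalSections n I F A U) {f : X → 𝕜}, ContMDiffOn I 𝓘(𝕜, 𝕜) n f U →
      MDifferentiableAt (I.prod 𝓘(𝕜, F →L[𝕜] 𝕜)) 𝓘(𝕜, 𝕜) (affFun V f) ξ := fun V f hf =>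
    (contMDiffAt_affFun V hx (hf.contMDiffAt (U.isOpen.mem_nhds hx))).mdifferentiableAt hn0
  have hl : ∀ V : LocalSections n I F A U,
      MDifferentiableAt (I.prod 𝓘(𝕜, F →L[𝕜] 𝕜)) 𝓘(𝕜, 𝕜) (linFun V) ξ := fun V => by
    rw [← affFun_zero]; exact hd V contMDiffOn_const
  have hb : ∀ {f : X → 𝕜}, ContMDiffOn I 𝓘(𝕜, 𝕜) n f U →
      MDifferentiableAt (I.prod 𝓘(𝕜, F →L[𝕜] 𝕜)) 𝓘(𝕜, 𝕜) (dualPull F A f) ξ := fun {f} hf => by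
    rw [← zero_affFun (n := n) (I := I) (U := U) f]; exact hd 0 hf
  have hs : ∀ (V : LocalSections n I F A U) {f : X → 𝕜}, ContMDiffOn I 𝓘(𝕜, 𝕜) n f U →
      mvfderiv (I.prod 𝓘(𝕜, F →L[𝕜] 𝕜)) (affFun V f) ξ =
        mvfderiv (I.prod 𝓘(𝕜, F →L[𝕜] 𝕜)) (linFun V) ξ +
        mvfderiv (I.prod 𝓘(𝕜, F →L[𝕜] 𝕜)) (dualPull F A f) ξ := fun V f hf =>
    mvfderiv_fun_add (hl V) (hb hf)
  have h1 : P.bracket (affFun V f) (affFun W g) ξ =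
      P.bracket (linFun V) (linFun W) ξ + P.bracket (linFun V) (dualPull F A g) ξ +
      (P.bracket (dualPull F A f) (linFun W) ξ + P.bracket (dualPull F A f) (dualPull F A g) ξ) := by
    rw [CotangentForm.bracket, hs V hf, hs W hg]
    simp only [map_add, LinearMap.add_apply, CotangentForm.bracket]
    ring
  rw [h1, hP.isPoisson.skew (dualPull F A f), hP.bracket_lin_lin U V W ξ hx,
    hP.bracket_lin_basic U V g hg ξ hx, hP.bracket_lin_basic U W f hf ξ hx]
  rw [hP.isFiberwiseLinear.basic_basic U f g hf hg ξ hx, add_zero, affFun, dualPull, dualPull,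
    dualPull, deriv, deriv]
  ring

variable [IsManifold I n X]

/-- Two tensors with equal brackets of affine functions agree on all pairs of covectors, since these
are differentials of such functions. -/
theorem IsLiePoisson.eq_liePoisson (hP : L.IsLiePoisson P) (hn : ∞ ≤ n) : P = L.liePoisson := by
  have : ContMDiffVectorBundle 1 F A I := ContMDiffVectorBundle.of_le (natCast_le_of_top_le hn 1)
  funext ξ
  -- The base coordinates are regular only on the chart domain, so the frames are restricted to it.
  let U : Opens X := trivOpens F A ξ.1 ⊓ ⟨(chartAt H ξ.1).source, (chartAt H ξ.1).open_source⟩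
  have hU : U ≤ trivOpens F A ξ.1 := inf_le_left
  have hx : ξ.1 ∈ U := ⟨mem_trivOpens_self F A ξ.1, mem_chart_source H ξ.1⟩
  let V (u : E × (F →L[𝕜] 𝕜) →L[𝕜] 𝕜) := restrict hU (frame n I F A ξ.1 (vertPart u))
  let f (u : E × (F →L[𝕜] 𝕜) →L[𝕜] 𝕜) : X → 𝕜 :=
    coordFun I ξ.1 (u ∘L ContinuousLinearMap.inl 𝕜 E (F →L[𝕜] 𝕜))
  have hf : ∀ u, ContMDiffOn I 𝓘(𝕜, 𝕜) n (f u) U := fun u x hx =>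
    (contMDiffAt_coordFun _ _ hx.2).contMDiffWithinAt
  have hV : ∀ u, affFun (frame n I F A ξ.1 (vertPart u)) (f u) =ᶠ[𝓝 ξ] affFun (V u) (f u) := by
    intro u
    filter_upwards [continuous_dualProj.continuousAt.eventually (U.isOpen.mem_nhds hx)] with ζ hζ
    exact congrArg (fun a => ζ.2 a + f u ζ.1) (LocalSections.restrict_apply hU _ hζ).symm
  have hu : ∀ u, mvfderiv (I.prod 𝓘(𝕜, F →L[𝕜] 𝕜)) (affFun (V u) (f u)) ξ = u := fun u =>
    (hV u).symm.mvfderiv_eq.trans (mvfderiv_affFun_frame ξ u)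
  refine LinearMap.ext fun (α : E × (F →L[𝕜] 𝕜) →L[𝕜] 𝕜) =>
    LinearMap.ext fun (β : E × (F →L[𝕜] 𝕜) →L[𝕜] 𝕜) => ?_
  have h1 := hP.bracket_affFun hn (V α) (V β) (hf α) (hf β) hx
  have h2 := (L.isLiePoisson_liePoisson hn).bracket_affFun hn (V α) (V β) (hf α) (hf β) hx
  have h3 := h1.trans h2.symm
  rw [CotangentForm.bracket, CotangentForm.bracket, hu, hu] at h3
  exact h3

/-- Brackets of `l_V` with base coordinates recover the components of `ρ(V)`; the values of `l_{[V,
W]}` on all covectors recover `[V, W]`. -/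
theorem IsLiePoisson.algebroid_unique (hP : L.IsLiePoisson P) (hP' : L'.IsLiePoisson P) :
    L = L' := by
  refine LieAlgebroid.ext_of (fun x v => ?_) (fun U V W x hx => ?_)
  · let U : Opens X := trivOpens F A x ⊓ ⟨(chartAt H x).source, (chartAt H x).open_source⟩
    have hU : U ≤ trivOpens F A x := inf_le_left
    have hx : x ∈ U := ⟨mem_trivOpens_self F A x, mem_chart_source H x⟩
    let V : LocalSections n I F A U :=
      restrict hU (frame n I F A x (trivializationAt F A x ⟨x, v⟩).2)
    have hV : V.1 x = v := by
      rw [LocalSections.restrict_apply hU _ hx, frame_apply, trivSymm_of_mem (hU hx)]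
      exact (trivializationAt F A x).symm_apply_apply_mk (hU hx) v
    have key : ∀ u : E →L[𝕜] 𝕜, u (L.anchor x v) = u (L'.anchor x v) := by
      intro u
      have hf : ContMDiffOn I 𝓘(𝕜, 𝕜) n (coordFun I x u) U := fun x hx =>
        (contMDiffAt_coordFun _ _ hx.2).contMDiffWithinAt
      have h1 : ∀ w : E, mvfderiv I (coordFun I x u) x w = u w := fun w => by
        refine (congrArg (fun L : E →L[𝕜] 𝕜 => L w) (mvfderiv_clm_comp u
          (mdifferentiableAt_extChartAt (mem_chart_source H x)))).trans ?_
        exact congrArg u (mvfderiv_extChartAt_self x w)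
      -- The bracket with a basic function is basic, so its value at the zero covector carries all
      -- the information.
      have h2 := (hP.bracket_lin_basic U V _ hf ⟨x, 0⟩ hx).symm.trans
        (hP'.bracket_lin_basic U V _ hf ⟨x, 0⟩ hx)
      simp only [dualPull] at h2
      rw [hV] at h2
      exact (h1 _).symm.trans (h2.trans (h1 _))
    exact eq_of_forall_clm_apply_eq (E := E) key
  · have h1 : ∀ a : F →L[𝕜] 𝕜, a (sectionCoord F x (L.bracket U V W).1 x) =
        a (sectionCoord F x (L'.bracket U V W).1 x) := by
      intro a
      have hx₀ := mem_trivOpens_self F A x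
      let ξ : A x →L[𝕜] 𝕜 := a ∘L (trivializationAt F A x).continuousLinearMapAt 𝕜 x
      have hξ : ∀ Z : Π x, A x, ξ (Z x) = a (sectionCoord F x Z x) := fun Z =>
        congrArg a ((trivializationAt F A x).continuousLinearMapAt_apply_of_mem 𝕜 hx₀ _)
      rw [← hξ, ← hξ]
      exact (hP.bracket_lin_lin U V W ⟨x, ξ⟩ hx).symm.trans (hP'.bracket_lin_lin U V W ⟨x, ξ⟩ hx)
    rw [← trivSymm_sectionCoord (F := F) (mem_trivOpens_self F A x) (L.bracket U V W).1,
      ← trivSymm_sectionCoord (F := F) (mem_trivOpens_self F A x) (L'.bracket U V W).1]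
    exact congrArg _ (eq_of_forall_clm_apply_eq h1)

end LieAlgebroid

end LiePoissonUniqueness

/-! ### Change of trivialization -/

section CoordinateChange

open Filter Topology LocalSections

variable {𝕜 : Type*} [NontriviallyNormedField 𝕜]
  {E : Type*} [NormedAddCommGroup E] [NormedSpace 𝕜 E]
  {H : Type*} [TopologicalSpace H]
  {X : Type*} [TopologicalSpace X] [ChartedSpace H X]
  {n : ℕ∞ω} {I : ModelWithCorners 𝕜 E H}
  {F : Type*} [NormedAddCommGroup F] [NormedSpace 𝕜 F]
  {A : X → Type*} [TopologicalSpace (TotalSpace F A)]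
  [∀ x, AddCommGroup (A x)] [∀ x, Module 𝕜 (A x)] [∀ x, TopologicalSpace (A x)]
  [FiberBundle F A] [VectorBundle 𝕜 F A] [ContMDiffVectorBundle 1 F A I]

/-- Product rule for the transition function applied to the old coordinates. The derivative of the
transition function, with coordinates frozen at `x`, is the derivative of an old frame section read
in the new trivialization. -/
theorem mvfderiv_sectionCoord_change {x₀ x₁ x : X} (h₀ : x ∈ trivOpens F A x₀)
    (h₁ : x ∈ trivOpens F A x₁) {V : Π x, A x}
    (hV : MDifferentiableAt I 𝓘(𝕜, F) (sectionCoord F x₀ V) x) (u : TangentSpace I x) :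
    mvfderiv I (sectionCoord F x₁ V) x u =
      mvfderiv I (sectionCoord (A := A) F x₁ fun y => trivSymm x₀ y (sectionCoord F x₀ V x)) x u +
      sectionCoord (A := A) F x₁ (fun y => trivSymm x₀ y (mvfderiv I (sectionCoord F x₀ V) x u)) x := by
  let T : X → F →L[𝕜] F := fun y =>
    ((trivializationAt F A x₀).coordChangeL 𝕜 (trivializationAt F A x₁) y : F →L[𝕜] F)
  have hT : MDifferentiableAt I 𝓘(𝕜, F →L[𝕜] F) T x :=
    (contMDiffAt_coordChangeL (n := 1) h₀ h₁).mdifferentiableAt one_ne_zero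
  have hTa : ∀ y ∈ trivOpens F A x₀ ⊓ trivOpens F A x₁, ∀ a,
      T y a = sectionCoord (A := A) F x₁ (fun y => trivSymm x₀ y a) y := fun y hy a => by
    rw [sectionCoord, trivSymm_of_mem hy.1]
    exact Trivialization.coordChangeL_apply _ _ hy a
  have hev : ∀ᶠ y in 𝓝 x, y ∈ trivOpens F A x₀ ⊓ trivOpens F A x₁ :=
    (trivOpens F A x₀ ⊓ trivOpens F A x₁).isOpen.mem_nhds ⟨h₀, h₁⟩
  have h2 : sectionCoord F x₁ V =ᶠ[𝓝 x] fun y => T y (sectionCoord F x₀ V y) := by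
    filter_upwards [hev] with y hy
    rw [hTa y hy]
    exact sectionCoord_congr x₁ (trivSymm_sectionCoord hy.1 V).symm
  have h3 : ∀ a, (sectionCoord (A := A) F x₁ fun y => trivSymm x₀ y a) =ᶠ[𝓝 x] fun y => T y a := fun a =>
    hev.mono fun y hy => (hTa y hy a).symm
  rw [h2.mvfderiv_eq, mvfderiv_clm_apply hT hV, (h3 _).mvfderiv_eq, ← hTa x ⟨h₀, h₁⟩]
  refine congrArg (· + _) ?_
  exact (congrArg (fun L : E →L[𝕜] F => L u)
    (mvfderiv_clm_comp (ContinuousLinearMap.apply 𝕜 F (sectionCoord F x₀ V x)) hT)).symm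

end CoordinateChange

/-! ### Regularity of maps into the tangent bundle -/

section TangentCoordinates

open Filter Topology

variable {𝕜 : Type*} [NontriviallyNormedField 𝕜]
  {E : Type*} [NormedAddCommGroup E] [NormedSpace 𝕜 E]
  {H : Type*} [TopologicalSpace H]
  {X : Type*} [TopologicalSpace X] [ChartedSpace H X]
  {n : ℕ∞ω} {I : ModelWithCorners 𝕜 E H} [IsManifold I 1 X]
  {E' : Type*} [NormedAddCommGroup E'] [NormedSpace 𝕜 E']
  {H' : Type*} [TopologicalSpace H'] {J : ModelWithCorners 𝕜 E' H'}
  {M : Type*} [TopologicalSpace M] [ChartedSpace H' M]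

/-- The preferred trivialization of the tangent bundle is the derivative of the chart. In this form
the condition concerns functions with values in `E`, which pass easily from complex to real scalars.
-/
theorem contMDiffAt_tangentBundle_iff {f : M → X} {V : Π m, TangentSpace I (f m)} {m : M} :
    ContMDiffAt J I.tangent n (fun y => (⟨f y, V y⟩ : TangentBundle I X)) m ↔
      ContMDiffAt J I n f m ∧
      ContMDiffAt J 𝓘(𝕜, E) n (fun y => mvfderiv I (extChartAt I (f m)) (f y) (V y)) m := by
  rw [contMDiffAt_totalSpace]
  refine and_congr_right fun h => ?_
  have : (fun y => (trivializationAt E (TangentSpace I) (f m) ⟨f y, V y⟩).2) =ᶠ[𝓝 m]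
      fun y => mvfderiv I (extChartAt I (f m)) (f y) (V y) := by
    filter_upwards [h.continuousAt.eventually ((chartAt H (f m)).open_source.mem_nhds
      (mem_chart_source H (f m)))] with y hy
    have h1 := TangentBundle.continuousLinearMapAt_trivializationAt (I := I) hy
    have h2 := congrArg (fun L : E →L[𝕜] E => L (V y)) h1
    refine Eq.trans ?_ h2
    exact ((trivializationAt E (TangentSpace I) (f m)).continuousLinearMapAt_apply_of_mem 𝕜
      (by rw [TangentBundle.trivializationAt_baseSet]; exact hy) _).symm
  exact this.contMDiffAt_iff

end TangentCoordinates

/-! ### From complex to real derivatives and Lie brackets -/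

section RestrictScalars

open Filter Topology

variable {E : Type*} [NormedAddCommGroup E] [NormedSpace ℂ E]
  {X : Type*} [TopologicalSpace X] [ChartedSpace E X]
  {n : ℕ∞ω}
  {F : Type*} [NormedAddCommGroup F] [NormedSpace ℂ F]
  {G : Type*} [NormedAddCommGroup G] [NormedSpace ℂ G]

theorem HasMFDerivAt.restrictScalars_real {f : X → G} {x : X} {f' : E →L[ℂ] G}
    (h : HasMFDerivAt 𝓘(ℂ, E) 𝓘(ℂ, G) f x f') :
    HasMFDerivAt 𝓘(ℝ, E) 𝓘(ℝ, G) f x (f'.restrictScalars ℝ) :=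
  ⟨h.1, HasFDerivWithinAt.restrictScalars ℝ h.2⟩

theorem MDifferentiableAt.mvfderiv_real_apply {f : X → G} {x : X}
    (h : MDifferentiableAt 𝓘(ℂ, E) 𝓘(ℂ, G) f x) (u : E) :
    mvfderiv 𝓘(ℝ, E) f x u = mvfderiv 𝓘(ℂ, E) f x u :=
  congrArg (fun L : E →L[ℝ] G => L u) h.hasMFDerivAt_mvfderiv.restrictScalars_real.mvfderiv_eq

theorem ContMDiffAt.restrictScalars_real {f : X → G} {x : X} (h : ContMDiffAt 𝓘(ℂ, E) 𝓘(ℂ, G) n f x) :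
    ContMDiffAt 𝓘(ℝ, E) 𝓘(ℝ, G) n f x :=
  ⟨h.1, ContDiffWithinAt.restrict_scalars ℝ h.2⟩

theorem ContMDiffAt.complexCLM_apply {f : X → F →L[ℂ] G} {v : X → F} {x : X}
    (hf : ContMDiffAt 𝓘(ℝ, E) 𝓘(ℝ, F →L[ℂ] G) n f x) (hv : ContMDiffAt 𝓘(ℝ, E) 𝓘(ℝ, F) n v x) :
    ContMDiffAt 𝓘(ℝ, E) 𝓘(ℝ, G) n (fun y => f y (v y)) x :=
  ContMDiffAt.clm_apply ((ContinuousLinearMap.restrictScalarsL ℂ F G ℝ ℝ).contMDiff.contMDiffAt.comp x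
    hf) hv

variable [IsManifold 𝓘(ℂ, E) ω X]

theorem ContMDiffAt.tangent_restrictScalars_real {V : X → E} {x : X}
    (h : ContMDiffAt 𝓘(ℂ, E) 𝓘(ℂ, E).tangent n
      (fun y => (⟨y, V y⟩ : TangentBundle 𝓘(ℂ, E) X)) x) :
    ContMDiffAt 𝓘(ℝ, E) 𝓘(ℝ, E).tangent n (fun y => (⟨y, V y⟩ : TangentBundle 𝓘(ℝ, E) X)) x := by
  have h' := (contMDiffAt_tangentBundle_iff (I := 𝓘(ℂ, E)) (f := fun y => y) (V := V)).1 h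
  refine (contMDiffAt_tangentBundle_iff (I := 𝓘(ℝ, E)) (f := fun y => y) (V := V)).2
    ⟨contMDiffAt_id, h'.2.restrictScalars_real.congr_of_eventuallyEq ?_⟩
  filter_upwards [(chartAt E x).open_source.mem_nhds (mem_chart_source E x)] with y hy
  exact MDifferentiableAt.mvfderiv_real_apply (mdifferentiableAt_extChartAt hy) (V y)

/-- Over either field the bracket acts on the `E`-valued chart map as a commutator of derivations.
For holomorphic data the real and complex derivatives agree, and the chart has identity derivative
at its center. -/
theorem mlieBracket_real_eq [CompleteSpace E] {V W : X → E} {x : X}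
    (hV : ContMDiffAt 𝓘(ℂ, E) 𝓘(ℂ, E).tangent ω
      (fun y => (⟨y, V y⟩ : TangentBundle 𝓘(ℂ, E) X)) x)
    (hW : ContMDiffAt 𝓘(ℂ, E) 𝓘(ℂ, E).tangent ω
      (fun y => (⟨y, W y⟩ : TangentBundle 𝓘(ℂ, E) X)) x) :
    (mlieBracket 𝓘(ℝ, E) V W x : E) = mlieBracket 𝓘(ℂ, E) V W x := by
  have hf : ContMDiffAt 𝓘(ℂ, E) 𝓘(ℂ, E) ω (extChartAt 𝓘(ℂ, E) x) x := contMDiffAt_extChartAt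
  have h1 : ∀ {V : X → E}, ContMDiffAt 𝓘(ℂ, E) 𝓘(ℂ, E).tangent ω
      (fun y => (⟨y, V y⟩ : TangentBundle 𝓘(ℂ, E) X)) x → ContMDiffAt 𝓘(ℂ, E) 𝓘(ℂ, E) ω
      (fun y => mvfderiv 𝓘(ℂ, E) (extChartAt 𝓘(ℂ, E) x) y (V y)) x := fun hV =>
    ContMDiffAt.contMDiffAt_mvfderiv_apply le_top hf hV
  have h2 : ∀ V : X → E, (fun y => mvfderiv 𝓘(ℝ, E) (extChartAt 𝓘(ℂ, E) x) y (V y)) =ᶠ[𝓝 x]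
      (fun y => mvfderiv 𝓘(ℂ, E) (extChartAt 𝓘(ℂ, E) x) y (V y)) := by
    intro V
    filter_upwards [(chartAt E x).open_source.mem_nhds (mem_chart_source E x)] with y hy
    exact MDifferentiableAt.mvfderiv_real_apply (mdifferentiableAt_extChartAt hy) (V y)
  have h3 : ∀ {V : X → E}, ContMDiffAt 𝓘(ℂ, E) 𝓘(ℂ, E).tangent ω
      (fun y => (⟨y, V y⟩ : TangentBundle 𝓘(ℂ, E) X)) x → ContMDiffAt 𝓘(ℝ, E) 𝓘(ℝ, E) ω
      (fun y => mvfderiv 𝓘(ℝ, E) (extChartAt 𝓘(ℂ, E) x) y (V y)) x := fun hV =>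
    (h1 hV).restrictScalars_real.congr_of_eventuallyEq (h2 _)
  have h4 : ∀ {V W : X → E}, ContMDiffAt 𝓘(ℂ, E) 𝓘(ℂ, E).tangent ω
      (fun y => (⟨y, W y⟩ : TangentBundle 𝓘(ℂ, E) X)) x →
      (mvfderiv 𝓘(ℝ, E) (fun y => mvfderiv 𝓘(ℝ, E) (extChartAt 𝓘(ℂ, E) x) y (W y)) x (V x) : E) =
      mvfderiv 𝓘(ℂ, E) (fun y => mvfderiv 𝓘(ℂ, E) (extChartAt 𝓘(ℂ, E) x) y (W y)) x (V x) := by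
    intro V W hW
    rw [(h2 W).mvfderiv_eq]
    exact ((h1 hW).mdifferentiableAt (by simp)).mvfderiv_real_apply _
  have hC := mvfderiv_mlieBracket (hf.of_le le_top) (hV.mdifferentiableAt (by simp))
    (hW.mdifferentiableAt (by simp)) ((h1 hV).mdifferentiableAt (by simp))
    ((h1 hW).mdifferentiableAt (by simp))
  have hR := mvfderiv_mlieBracket (hf.restrictScalars_real.of_le le_top)
    (hV.tangent_restrictScalars_real.mdifferentiableAt (by simp))
    (hW.tangent_restrictScalars_real.mdifferentiableAt (by simp))
    ((h3 hV).mdifferentiableAt (by simp)) ((h3 hW).mdifferentiableAt (by simp))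
  refine (mvfderiv_extChartAt_self (I := 𝓘(ℝ, E)) x _).symm.trans (Eq.trans ?_
    (mvfderiv_extChartAt_self (I := 𝓘(ℂ, E)) x _))
  refine hR.trans (Eq.trans ?_ hC.symm)
  exact congrArg₂ (fun a b : E => a - b) (h4 hW) (h4 hV)

end RestrictScalars

/-! ### The local bracket of smooth sections and its independence of the trivialization -/

section Realification

open Filter Topology LocalSections

variable {E : Type*} [NormedAddCommGroup E] [NormedSpace ℂ E] [FiniteDimensional ℂ E]
  {X : Type*} [TopologicalSpace X] [ChartedSpace E X] [IsManifold 𝓘(ℂ, E) ω X]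
  {F : Type*} [NormedAddCommGroup F] [NormedSpace ℂ F] [FiniteDimensional ℂ F]
  {A : X → Type*} [TopologicalSpace (TotalSpace F A)]
  [∀ x, AddCommGroup (A x)] [∀ x, Module ℂ (A x)] [∀ x, TopologicalSpace (A x)]
  [FiberBundle F A] [VectorBundle ℂ F A] [ContMDiffVectorBundle ω F A 𝓘(ℂ, E)]

theorem contMDiffVectorBundle_real_one : ContMDiffVectorBundle 1 F A 𝓘(ℝ, E) :=
  ContMDiffVectorBundle.of_le (n := ω) le_top

theorem contMDiffVectorBundle_real_top : ContMDiffVectorBundle ∞ F A 𝓘(ℝ, E) :=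
  ContMDiffVectorBundle.of_le (n := ω) le_top

namespace LieAlgebroid

variable (L : LieAlgebroid ω 𝓘(ℂ, E) F A)

/-- The real-linear extension of the bracket of a holomorphic Lie algebroid, computed in the
trivialization at `x₀`. -/
def localBracket (x₀ x : X) (V W : Π x, A x) : A x :=
  trivSymm x₀ x ((mvfderiv 𝓘(ℝ, E) (sectionCoord F x₀ W) x (L.anchor x (V x)) : F) -
    mvfderiv 𝓘(ℝ, E) (sectionCoord F x₀ V) x (L.anchor x (W x))) +
  L.toSkew.frameBracket x₀ x (sectionCoord F x₀ V x) (sectionCoord F x₀ W x)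

theorem bracket_eq_localBracket {U : Opens X} (V W : LocalSections ω 𝓘(ℂ, E) F A U) {x₀ x : X}
    (hx : x ∈ U) (hx₀ : x ∈ trivOpens F A x₀) :
    (L.bracket U V W).1 x = L.localBracket x₀ x V.1 W.1 := by
  refine (L.toSkew.bracket_eq le_top V W hx hx₀).trans ?_
  have h : ∀ (V : LocalSections ω 𝓘(ℂ, E) F A U) (u : E),
      mvfderiv 𝓘(ℝ, E) (sectionCoord F x₀ V.1) x u =
        mvfderiv 𝓘(ℂ, E) (sectionCoord F x₀ V.1) x u := fun V u =>
    ((contMDiffAt_sectionCoord V hx hx₀).mdifferentiableAt (by simp)).mvfderiv_real_apply u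
  exact congrArg (fun a : F => trivSymm x₀ x a +
    L.toSkew.frameBracket x₀ x (sectionCoord F x₀ V.1 x) (sectionCoord F x₀ W.1 x))
    (congrArg₂ (fun a b : F => a - b) (h W _).symm (h V _).symm)

theorem localBracket_congr {x₀ x : X} {V V' W W' : Π x, A x} (hV : ∀ᶠ y in 𝓝 x, V y = V' y)
    (hW : ∀ᶠ y in 𝓝 x, W y = W' y) :
    L.localBracket x₀ x V W = L.localBracket x₀ x V' W' := by
  have h1 := sectionCoord_congr_of_eventuallyEq (F := F) x₀ hV
  have h2 := sectionCoord_congr_of_eventuallyEq (F := F) x₀ hW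
  rw [localBracket, localBracket, h1.mvfderiv_eq, h2.mvfderiv_eq, h1.eq_of_nhds, h2.eq_of_nhds,
    hV.self_of_nhds, hW.self_of_nhds]

/-- In the new trivialization the derivative terms split into the old ones and derivatives of frozen
old frames. The latter, with the new structure functions, compute the bracket of two old frame
sections, which is the old structure-function term. -/
theorem localBracket_eq {x₀ x₁ x : X} (h₀ : x ∈ trivOpens F A x₀) (h₁ : x ∈ trivOpens F A x₁)
    {V W : Π x, A x} (hV : MDifferentiableAt 𝓘(ℝ, E) 𝓘(ℝ, F) (sectionCoord F x₀ V) x)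
    (hW : MDifferentiableAt 𝓘(ℝ, E) 𝓘(ℝ, F) (sectionCoord F x₀ W) x) :
    L.localBracket x₀ x V W = L.localBracket x₁ x V W := by
  have := contMDiffVectorBundle_real_one (E := E) (F := F) (A := A)
  obtain ⟨v, hv⟩ : ∃ v, v = sectionCoord F x₀ V x := ⟨_, rfl⟩
  obtain ⟨w, hw⟩ : ∃ w, w = sectionCoord F x₀ W x := ⟨_, rfl⟩
  have hfr : ∀ {V : Π x, A x} {v : F}, v = sectionCoord F x₀ V x →
      (frame ω 𝓘(ℂ, E) F A x₀ v).1 x = V x := fun hv => by rw [hv, frame_sectionCoord h₀]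
  -- The frozen frames are holomorphic, so their bracket is already known to be given by the formula
  -- in the trivialization at `x₁`.
  have h1 := L.bracket_eq_localBracket (frame ω 𝓘(ℂ, E) F A x₀ v) (frame ω 𝓘(ℂ, E) F A x₀ w) h₀ h₁
  have hs := isLinearMap_trivSymm ℂ F A x₁ x
  have hc := mvfderiv_sectionCoord_change (I := 𝓘(ℝ, E)) h₀ h₁ hV
  have hc' := mvfderiv_sectionCoord_change (I := 𝓘(ℝ, E)) h₀ h₁ hW
  have he : ∀ p q p' q' : F, trivSymm x₁ x
      ((p + sectionCoord (A := A) F x₁ (fun y => trivSymm x₀ y q) x) -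
        (p' + sectionCoord (A := A) F x₁ (fun y => trivSymm x₀ y q') x)) =
      trivSymm x₁ x (p - p') + (trivSymm x₀ x (q - q') : A x) := by
    intro p q p' q'
    rw [add_sub_add_comm, hs.map_add, hs.map_sub (sectionCoord _ _ _ _), trivSymm_sectionCoord h₁,
      trivSymm_sectionCoord h₁, (isLinearMap_trivSymm ℂ F A x₀ x).map_sub]
  have h2 : L.localBracket x₁ x V W = trivSymm x₁ x
        ((mvfderiv 𝓘(ℝ, E) (sectionCoord F x₁ (frame ω 𝓘(ℂ, E) F A x₀ w).1) x
            (L.anchor x (V x)) : F) -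
          mvfderiv 𝓘(ℝ, E) (sectionCoord F x₁ (frame ω 𝓘(ℂ, E) F A x₀ v).1) x
            (L.anchor x (W x))) +
      trivSymm x₀ x ((mvfderiv 𝓘(ℝ, E) (sectionCoord F x₀ W) x (L.anchor x (V x)) : F) -
        mvfderiv 𝓘(ℝ, E) (sectionCoord F x₀ V) x (L.anchor x (W x))) +
      L.toSkew.frameBracket x₁ x (sectionCoord F x₁ V x) (sectionCoord F x₁ W x) := by
    refine congrArg (· + _) ?_
    rw [hv, hw]
    exact (congrArg₂ (fun a b : F => trivSymm x₁ x (a - b)) (hc' _) (hc _)).trans (he _ _ _ _)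
  rw [h2, add_right_comm]
  rw [localBracket, hfr hv, hfr hw, sectionCoord_congr x₁ (hfr hv),
    sectionCoord_congr x₁ (hfr hw)] at h1
  rw [← h1, localBracket, ← hv, ← hw, L.toSkew.frameBracket_apply, add_comm]
  rfl

end LieAlgebroid

end Realification

/-! ### Smoothness and algebraic properties of the real bracket -/

section RealificationBracket

open Filter Topology LocalSections

variable {E : Type*} [NormedAddCommGroup E] [NormedSpace ℂ E] [FiniteDimensional ℂ E]
  {X : Type*} [TopologicalSpace X] [ChartedSpace E X] [IsManifold 𝓘(ℂ, E) ω X]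
  {F : Type*} [NormedAddCommGroup F] [NormedSpace ℂ F] [FiniteDimensional ℂ F]
  {A : X → Type*} [TopologicalSpace (TotalSpace F A)]
  [∀ x, AddCommGroup (A x)] [∀ x, Module ℂ (A x)] [∀ x, TopologicalSpace (A x)]
  [FiberBundle F A] [VectorBundle ℂ F A] [ContMDiffVectorBundle ω F A 𝓘(ℂ, E)]

namespace LieAlgebroid

variable (L : LieAlgebroid ω 𝓘(ℂ, E) F A)

/-- The structure functions of a holomorphic Lie algebroid in the trivialization at `x₀`. -/
def structureFun (x₀ y : X) : F →L[ℂ] F →L[ℂ] F :=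
  LinearMap.toContinuousLinearMap (LinearMap.toContinuousLinearMap.toLinearMap ∘ₗ
    (L.toSkew.frameBracket x₀ y).compr₂ ((trivializationAt F A x₀).linearMapAt ℂ y))

theorem structureFun_apply {x₀ y : X} (hy : y ∈ trivOpens F A x₀) (a b : F) :
    L.structureFun x₀ y a b = sectionCoord F x₀
      (L.bracket _ (frame ω 𝓘(ℂ, E) F A x₀ a) (frame ω 𝓘(ℂ, E) F A x₀ b)).1 y :=
  congrFun ((trivializationAt F A x₀).coe_linearMapAt_of_mem hy) _

theorem contMDiffAt_structureFun {x₀ y : X} (hy : y ∈ trivOpens F A x₀) :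
    ContMDiffAt 𝓘(ℂ, E) 𝓘(ℂ, F →L[ℂ] F →L[ℂ] F) ω (L.structureFun x₀) y := by
  refine contMDiffAt_of_clm_apply fun a => contMDiffAt_of_clm_apply fun b => ?_
  refine (contMDiffAt_sectionCoord (L.bracket _ (frame ω 𝓘(ℂ, E) F A x₀ a)
    (frame ω 𝓘(ℂ, E) F A x₀ b)) hy hy).congr_of_eventuallyEq ?_
  filter_upwards [(trivOpens F A x₀).isOpen.mem_nhds hy] with z hz
  exact L.structureFun_apply hz a b

theorem sectionCoord_localBracket {x₀ x : X} (hx : x ∈ trivOpens F A x₀) (V W : Π x, A x) :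
    sectionCoord F x₀ (fun y => L.localBracket x₀ y V W) x =
      ((mvfderiv 𝓘(ℝ, E) (sectionCoord F x₀ W) x (L.anchor x (V x)) : F) -
        mvfderiv 𝓘(ℝ, E) (sectionCoord F x₀ V) x (L.anchor x (W x))) +
      L.structureFun x₀ x (sectionCoord F x₀ V x) (sectionCoord F x₀ W x) := by
  refine ((isLinearMap_sectionCoord ℂ hx).map_add
    (fun y => trivSymm x₀ y ((mvfderiv 𝓘(ℝ, E) (sectionCoord F x₀ W) y (L.anchor y (V y)) : F) -
        mvfderiv 𝓘(ℝ, E) (sectionCoord F x₀ V) y (L.anchor y (W y))))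
    (fun y => L.toSkew.frameBracket x₀ y (sectionCoord F x₀ V y) (sectionCoord F x₀ W y))).trans ?_
  refine congrArg₂ (· + ·) (sectionCoord_trivSymm hx rfl) ?_
  rw [L.structureFun_apply hx]
  rfl

theorem contMDiff_anchor_real :
    ContMDiff (𝓘(ℝ, E).prod 𝓘(ℝ, F)) 𝓘(ℝ, E).tangent ∞
      (fun v : TotalSpace F A => (⟨v.1, L.anchor v.1 v.2⟩ : TangentBundle 𝓘(ℝ, E) X)) := by
  intro v
  have h := (contMDiffAt_tangentBundle_iff (I := 𝓘(ℂ, E)) (J := 𝓘(ℂ, E).prod 𝓘(ℂ, F))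
    (f := fun v : TotalSpace F A => v.1) (V := fun v => L.anchor v.1 v.2)).1 (L.contMDiff_anchor v)
  refine (contMDiffAt_tangentBundle_iff (I := 𝓘(ℝ, E)) (J := 𝓘(ℝ, E).prod 𝓘(ℝ, F))
    (f := fun v : TotalSpace F A => v.1) (V := fun v => (L.anchor v.1 v.2 : E))).2
    ⟨Bundle.contMDiffAt_proj A, ?_⟩
  have h1 : ContMDiffAt (𝓘(ℝ, E).prod 𝓘(ℝ, F)) 𝓘(ℝ, E) ∞ (fun v' : TotalSpace F A =>
      (mvfderiv 𝓘(ℂ, E) (extChartAt 𝓘(ℂ, E) v.1) v'.1 (L.anchor v'.1 v'.2) : E)) v :=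
    ⟨h.2.1, (ContDiffWithinAt.restrict_scalars ℝ h.2.2).of_le le_top⟩
  refine h1.congr_of_eventuallyEq ?_
  filter_upwards [(FiberBundle.continuous_proj F A).continuousAt.eventually
    ((chartAt E v.1).open_source.mem_nhds (mem_chart_source E v.1))] with y hy
  exact MDifferentiableAt.mvfderiv_real_apply (mdifferentiableAt_extChartAt hy) _

theorem contMDiffAt_localBracket {U : Opens X} (V W : LocalSections ∞ 𝓘(ℝ, E) F A U) {x₀ x : X}
    (hx : x ∈ U) (hx₀ : x ∈ trivOpens F A x₀) :
    ContMDiffAt 𝓘(ℝ, E) 𝓘(ℝ, F) ∞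
      (sectionCoord F x₀ fun y => L.localBracket x₀ y V.1 W.1) x := by
  have := contMDiffVectorBundle_real_top (E := E) (F := F) (A := A)
  have hV : ∀ V : LocalSections ∞ 𝓘(ℝ, E) F A U,
      ContMDiffAt 𝓘(ℝ, E) 𝓘(ℝ, F) ∞ (sectionCoord F x₀ V.1) x := fun V =>
    contMDiffAt_sectionCoord V hx hx₀
  have hd : ∀ V W : LocalSections ∞ 𝓘(ℝ, E) F A U, ContMDiffAt 𝓘(ℝ, E) 𝓘(ℝ, F) ∞ (fun y =>
      (mvfderiv 𝓘(ℝ, E) (sectionCoord F x₀ W.1) y (L.anchor y (V.1 y)) : F)) x := fun V W =>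
    ContMDiffAt.contMDiffAt_mvfderiv_apply le_rfl (hV W)
      (L.contMDiff_anchor_real.contMDiffAt.comp x (contMDiffAt V hx))
  have hC : ContMDiffAt 𝓘(ℝ, E) 𝓘(ℝ, F →L[ℂ] F →L[ℂ] F) ∞ (L.structureFun x₀) x :=
    (L.contMDiffAt_structureFun hx₀).restrictScalars_real.of_le le_top
  refine (((hd V W).sub (hd W V)).add
    ((hC.complexCLM_apply (hV V)).complexCLM_apply (hV W))).congr_of_eventuallyEq ?_
  filter_upwards [(trivOpens F A x₀).isOpen.mem_nhds hx₀] with y hy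
  exact L.sectionCoord_localBracket hy V.1 W.1

theorem mdifferentiableAt_sectionCoord_real {U : Opens X} (V : LocalSections ∞ 𝓘(ℝ, E) F A U)
    {x₀ x : X} (hx : x ∈ U) (hx₀ : x ∈ trivOpens F A x₀) :
    MDifferentiableAt 𝓘(ℝ, E) 𝓘(ℝ, F) (sectionCoord F x₀ V.1) x :=
  have := contMDiffVectorBundle_real_top (E := E) (F := F) (A := A)
  (contMDiffAt_sectionCoord V hx hx₀).mdifferentiableAt (by simp)

open Classical in
/-- The bracket of smooth sections extending the bracket of holomorphic sections. -/
def realBracket {U : Opens X} (V W : LocalSections ∞ 𝓘(ℝ, E) F A U) :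
    LocalSections ∞ 𝓘(ℝ, E) F A U :=
  ⟨fun x => if x ∈ U then L.localBracket x x V.1 W.1 else 0, fun x hx => by
    have := contMDiffVectorBundle_real_top (E := E) (F := F) (A := A)
    refine ContMDiffAt.contMDiffWithinAt ?_
    refine ((trivializationAt F A x).contMDiffAt_section_iff (mem_trivOpens_self F A x)).2 ?_
    refine (L.contMDiffAt_localBracket V W hx (mem_trivOpens_self F A x)).congr_of_eventuallyEq ?_
    filter_upwards [U.isOpen.mem_nhds hx,
      (trivOpens F A x).isOpen.mem_nhds (mem_trivOpens_self F A x)] with y hy hy₀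
    -- Each value is defined in the trivialization at its own point; regularity needs one fixed
    -- trivialization for all nearby `y`.
    have h : (if y ∈ U then L.localBracket y y V.1 W.1 else 0) = L.localBracket x y V.1 W.1 :=
      (if_pos hy).trans (L.localBracket_eq (mem_trivOpens_self F A y) hy₀
        (mdifferentiableAt_sectionCoord_real V hy (mem_trivOpens_self F A y))
        (mdifferentiableAt_sectionCoord_real W hy (mem_trivOpens_self F A y)))
    exact congrArg (fun a : A y => (trivializationAt F A x ⟨y, a⟩).2) h,
    fun x hx => if_neg hx⟩

theorem realBracket_apply {U : Opens X} (V W : LocalSections ∞ 𝓘(ℝ, E) F A U) {x₀ x : X}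
    (hx : x ∈ U) (hx₀ : x ∈ trivOpens F A x₀) :
    (L.realBracket V W).1 x = L.localBracket x₀ x V.1 W.1 :=
  (if_pos hx).trans (L.localBracket_eq (mem_trivOpens_self F A x) hx₀
      (mdifferentiableAt_sectionCoord_real V hx (mem_trivOpens_self F A x))
      (mdifferentiableAt_sectionCoord_real W hx (mem_trivOpens_self F A x)))

theorem localBracket_self (x₀ x : X) (V : Π x, A x) : L.localBracket x₀ x V V = 0 := by
  rw [localBracket, sub_self, (isLinearMap_trivSymm ℂ F A x₀ x).map_zero, zero_add,
    L.toSkew.frameBracket_apply, L.toSkew.bracket_self]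
  rfl

theorem localBracket_add_right {x₀ x : X} (hx₀ : x ∈ trivOpens F A x₀) {V W Z : Π x, A x}
    (hW : MDifferentiableAt 𝓘(ℝ, E) 𝓘(ℝ, F) (sectionCoord F x₀ W) x)
    (hZ : MDifferentiableAt 𝓘(ℝ, E) 𝓘(ℝ, F) (sectionCoord F x₀ Z) x) :
    L.localBracket x₀ x V (W + Z) = L.localBracket x₀ x V W + L.localBracket x₀ x V Z := by
  have h1 : sectionCoord F x₀ (W + Z) =ᶠ[𝓝 x]
      fun y => sectionCoord F x₀ W y + sectionCoord F x₀ Z y := by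
    filter_upwards [(trivOpens F A x₀).isOpen.mem_nhds hx₀] with y hy
    exact (isLinearMap_sectionCoord ℂ hy).map_add W Z
  have h2 : ∀ u, (mvfderiv 𝓘(ℝ, E) (sectionCoord F x₀ (W + Z)) x u : F) =
      mvfderiv 𝓘(ℝ, E) (sectionCoord F x₀ W) x u +
      mvfderiv 𝓘(ℝ, E) (sectionCoord F x₀ Z) x u := fun u => by
    rw [h1.mvfderiv_eq, mvfderiv_fun_add hW hZ]; rfl
  have h3 : (mvfderiv 𝓘(ℝ, E) (sectionCoord F x₀ V) x (L.anchor x ((W + Z) x)) : F) =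
      mvfderiv 𝓘(ℝ, E) (sectionCoord F x₀ V) x (L.anchor x (W x)) +
      mvfderiv 𝓘(ℝ, E) (sectionCoord F x₀ V) x (L.anchor x (Z x)) :=
    (congrArg (mvfderiv 𝓘(ℝ, E) (sectionCoord F x₀ V) x) (map_add (L.anchor x) _ _)).trans
      (map_add (mvfderiv 𝓘(ℝ, E) (sectionCoord F x₀ V) x) _ _)
  have h4 := isLinearMap_trivSymm ℂ F A x₀ x
  rw [localBracket, h1.eq_of_nhds, map_add, localBracket, localBracket]
  refine (congrArg (· + _) (congrArg₂ (fun a b : F => trivSymm x₀ x (a - b)) (h2 _) h3)).trans ?_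
  rw [add_sub_add_comm, h4.map_add]
  abel

theorem localBracket_smul_right {x₀ x : X} (hx₀ : x ∈ trivOpens F A x₀) {f : X → ℝ}
    {V W : Π x, A x} (hf : MDifferentiableAt 𝓘(ℝ, E) 𝓘(ℝ, ℝ) f x)
    (hW : MDifferentiableAt 𝓘(ℝ, E) 𝓘(ℝ, F) (sectionCoord F x₀ W) x) :
    L.localBracket x₀ x V (fun y => f y • W y) =
      (mvfderiv 𝓘(ℝ, E) f x (L.anchor x (V x)) : ℝ) • W x + f x • L.localBracket x₀ x V W := by
  have h1 : sectionCoord F x₀ (fun y => f y • W y) =ᶠ[𝓝 x] fun y => f y • sectionCoord F x₀ W y := by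
    filter_upwards [(trivOpens F A x₀).isOpen.mem_nhds hx₀] with y hy
    exact (isLinearMap_sectionCoord ℝ hy).map_smul (f y) W
  have h2 : ∀ u, (mvfderiv 𝓘(ℝ, E) (sectionCoord F x₀ fun y => f y • W y) x u : F) =
      f x • mvfderiv 𝓘(ℝ, E) (sectionCoord F x₀ W) x u +
      (mvfderiv 𝓘(ℝ, E) f x u : ℝ) • sectionCoord F x₀ W x := fun u => by
    rw [h1.mvfderiv_eq, mvfderiv_fun_smul hf hW]; rfl
  have h3 : (mvfderiv 𝓘(ℝ, E) (sectionCoord F x₀ V) x (L.anchor x (f x • W x)) : F) =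
      f x • mvfderiv 𝓘(ℝ, E) (sectionCoord F x₀ V) x (L.anchor x (W x)) := by
    have h : (L.anchor x (f x • W x) : E) = f x • (L.anchor x (W x) : E) := by
      rw [← Complex.coe_smul, map_smul]
      exact Complex.coe_smul (E := E) _ _
    exact (congrArg (mvfderiv 𝓘(ℝ, E) (sectionCoord F x₀ V) x) h).trans
      (map_smul (mvfderiv 𝓘(ℝ, E) (sectionCoord F x₀ V) x) _ _)
  have h4 := isLinearMap_trivSymm ℝ F A x₀ x
  have h5 : ∀ a b : F, L.toSkew.frameBracket x₀ x a (f x • b) =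
      f x • L.toSkew.frameBracket x₀ x a b := fun a b => by
    rw [← Complex.coe_smul, map_smul, Complex.coe_smul]
  rw [localBracket, h1.eq_of_nhds, h5, localBracket]
  refine (congrArg (· + _) (congrArg₂ (fun a b : F => trivSymm x₀ x (a - b)) (h2 _) h3)).trans ?_
  rw [add_sub_right_comm, ← smul_sub, h4.map_add, h4.map_smul, h4.map_smul,
    trivSymm_sectionCoord hx₀, smul_add]
  abel

theorem localBracket_skew (x₀ x : X) (V W : Π x, A x) :
    L.localBracket x₀ x V W = -L.localBracket x₀ x W V := by
  rw [localBracket, localBracket, L.toSkew.frameBracket_apply, L.toSkew.frameBracket_apply,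
    L.toSkew.bracket_skew_apply, neg_add, ← (isLinearMap_trivSymm ℂ F A x₀ x).map_neg, neg_sub]

end LieAlgebroid

end RealificationBracket

/-! ### The underlying real Lie algebroid -/

section UnderlyingReal

open Filter Topology LocalSections

variable {E : Type*} [NormedAddCommGroup E] [NormedSpace ℂ E] [FiniteDimensional ℂ E]
  {X : Type*} [TopologicalSpace X] [ChartedSpace E X] [IsManifold 𝓘(ℂ, E) ω X]
  {F : Type*} [NormedAddCommGroup F] [NormedSpace ℂ F] [FiniteDimensional ℂ F]
  {A : X → Type*} [TopologicalSpace (TotalSpace F A)]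
  [∀ x, AddCommGroup (A x)] [∀ x, Module ℂ (A x)] [∀ x, TopologicalSpace (A x)]
  [FiberBundle F A] [VectorBundle ℂ F A] [ContMDiffVectorBundle ω F A 𝓘(ℂ, E)]

namespace LieAlgebroid

variable (L : LieAlgebroid ω 𝓘(ℂ, E) F A)

theorem realBracket_toSmooth {U : Opens X} (V W : LocalSections ω 𝓘(ℂ, E) F A U) :
    L.realBracket (toSmooth V) (toSmooth W) = toSmooth (L.bracket U V W) :=
  ext_on fun _ hx => (L.realBracket_apply _ _ hx (mem_trivOpens_self F A _)).trans
    (L.bracket_eq_localBracket V W hx (mem_trivOpens_self F A _)).symm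

theorem realBracket_skew {U : Opens X} (V W : LocalSections ∞ 𝓘(ℝ, E) F A U) :
    L.realBracket V W = -L.realBracket W V := by
  refine ext_on fun x hx => ?_
  have h : (-L.realBracket W V).1 x = -(L.realBracket W V).1 x := rfl
  rw [h, L.realBracket_apply V W hx (mem_trivOpens_self F A x),
    L.realBracket_apply W V hx (mem_trivOpens_self F A x), L.localBracket_skew]

theorem realBracket_add_right {U : Opens X} (V W Z : LocalSections ∞ 𝓘(ℝ, E) F A U) :
    L.realBracket V (W + Z) = L.realBracket V W + L.realBracket V Z := by
  refine ext_on fun x hx => ?_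
  have h₀ := mem_trivOpens_self F A x
  have h : (L.realBracket V W + L.realBracket V Z).1 x =
    (L.realBracket V W).1 x + (L.realBracket V Z).1 x := rfl
  rw [h, L.realBracket_apply V _ hx h₀, L.realBracket_apply V W hx h₀,
    L.realBracket_apply V Z hx h₀]
  exact L.localBracket_add_right h₀ (mdifferentiableAt_sectionCoord_real W hx h₀)
    (mdifferentiableAt_sectionCoord_real Z hx h₀)

theorem realBracket_fsmul {U : Opens X} (V W : LocalSections ∞ 𝓘(ℝ, E) F A U) {f : X → ℝ}
    (hf : ContMDiffOn 𝓘(ℝ, E) 𝓘(ℝ, ℝ) ∞ f U) {x : X} (hx : x ∈ U) :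
    (L.realBracket V (fsmul f hf W)).1 x =
      (mvfderiv 𝓘(ℝ, E) f x (L.anchor x (V.1 x)) : ℝ) • W.1 x +
        f x • (L.realBracket V W).1 x := by
  have h₀ := mem_trivOpens_self F A x
  rw [L.realBracket_apply V _ hx h₀, L.realBracket_apply V W hx h₀]
  exact L.localBracket_smul_right h₀
    ((hf.contMDiffAt (U.isOpen.mem_nhds hx)).mdifferentiableAt (by simp))
    (mdifferentiableAt_sectionCoord_real W hx h₀)

theorem realBracket_smul_right {U : Opens X} (c : ℝ) (V W : LocalSections ∞ 𝓘(ℝ, E) F A U) :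
    L.realBracket V (c • W) = c • L.realBracket V W := by
  refine ext_on fun x hx => ?_
  refine (L.realBracket_fsmul V W (f := fun _ => c) contMDiffOn_const hx).trans ?_
  rw [mvfderiv_const]
  exact (congrArg (· + _) (zero_smul ℝ (W.1 x))).trans (zero_add _)

/-- The skew algebroid underlying the realification of a holomorphic Lie algebroid. -/
def realSkew : SkewAlgebroid ∞ 𝓘(ℝ, E) F A where
  anchor x :=
    { toFun := fun v => L.anchor x v
      map_add' := fun v w => map_add (L.anchor x) v w
      map_smul' := fun c v => by
        change (L.anchor x (c • v) : E) = c • (L.anchor x v : E)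
        rw [← Complex.coe_smul, map_smul]
        exact Complex.coe_smul (E := E) _ _ }
  contMDiff_anchor := L.contMDiff_anchor_real
  bracket U := LinearMap.mk₂ ℝ (fun V W => L.realBracket V W)
    (fun V W Z => by
      rw [L.realBracket_skew, L.realBracket_add_right, neg_add, ← L.realBracket_skew,
        ← L.realBracket_skew])
    (fun c V W => by
      rw [L.realBracket_skew, L.realBracket_smul_right, ← smul_neg, ← L.realBracket_skew])
    (fun V W Z => L.realBracket_add_right V W Z)
    (fun c V W => L.realBracket_smul_right c V W)
  bracket_restrict U U' h V W V' W' hV hW x hx := by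
    have h₀ := mem_trivOpens_self F A x
    refine (L.realBracket_apply V' W' hx h₀).trans (Eq.trans ?_
      (L.realBracket_apply V W (h hx) h₀).symm)
    exact L.localBracket_congr (Filter.mem_of_superset (U'.isOpen.mem_nhds hx) hV)
      (Filter.mem_of_superset (U'.isOpen.mem_nhds hx) hW)
  bracket_self U V := ext_on fun x hx =>
    (L.realBracket_apply V V hx (mem_trivOpens_self F A x)).trans (L.localBracket_self _ _ _)
  leibniz U V W f hf x hx := L.realBracket_fsmul V W hf hx

theorem realSkew_bracket_toSmooth {U : Opens X} (V W : LocalSections ω 𝓘(ℂ, E) F A U) :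
    L.realSkew.bracket U (toSmooth V) (toSmooth W) = toSmooth (L.bracket U V W) :=
  L.realBracket_toSmooth V W

/-- The real bundle keeps the trivializations of the complex one, so its frames are holomorphic.
This is what lets the axioms tested on frames be inherited from `L`. -/
theorem toSmooth_frame [ContMDiffVectorBundle ∞ F A 𝓘(ℝ, E)] (x₀ : X) (a : F) :
    frame ∞ 𝓘(ℝ, E) F A x₀ a = toSmooth (frame ω 𝓘(ℂ, E) F A x₀ a) := rfl

theorem realSkew_anchor_bracket {U : Opens X} (V W : LocalSections ω 𝓘(ℂ, E) F A U) {x : X}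
    (hx : x ∈ U) :
    L.realSkew.anchor x ((L.realSkew.bracket U (toSmooth V) (toSmooth W)).1 x) =
      mlieBracket 𝓘(ℝ, E) (fun y => L.realSkew.anchor y ((toSmooth V).1 y))
        (fun y => L.realSkew.anchor y ((toSmooth W).1 y)) x := by
  have hd : ∀ V : LocalSections ω 𝓘(ℂ, E) F A U, ContMDiffAt 𝓘(ℂ, E) 𝓘(ℂ, E).tangent ω
      (fun y => (⟨y, L.anchor y (V.1 y)⟩ : TangentBundle 𝓘(ℂ, E) X)) x := fun V =>
    (L.toSkew.contMDiffOn_anchor V).contMDiffAt (U.isOpen.mem_nhds hx)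
  rw [L.realSkew_bracket_toSmooth V W]
  exact (L.anchor_bracket U V W x hx).trans (mlieBracket_real_eq (hd V) (hd W)).symm

theorem realSkew_jacobi {U : Opens X} (V W Z : LocalSections ω 𝓘(ℂ, E) F A U) (x : X) :
    (L.realSkew.bracket U (toSmooth V) (L.realSkew.bracket U (toSmooth W) (toSmooth Z))).1 x +
    (L.realSkew.bracket U (toSmooth W) (L.realSkew.bracket U (toSmooth Z) (toSmooth V))).1 x +
    (L.realSkew.bracket U (toSmooth Z) (L.realSkew.bracket U (toSmooth V) (toSmooth W))).1 x
      = 0 := by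
  simp only [L.realSkew_bracket_toSmooth]
  exact congrFun (congrArg Subtype.val (L.jacobi U V W Z)) x

/-- The underlying real Lie algebroid of a holomorphic Lie algebroid. -/
def realify : LieAlgebroid ∞ 𝓘(ℝ, E) F A :=
  have : ContMDiffVectorBundle ∞ F A 𝓘(ℝ, E) := contMDiffVectorBundle_real_top
  have : IsManifold 𝓘(ℝ, E) 2 X := IsManifold.of_le (n := ω) le_top
  have : IsManifold 𝓘(ℝ, E) ∞ X := IsManifold.of_le (n := ω) le_top
  L.realSkew.toLieAlgebroid le_rfl
    (fun x₀ a b _ hx => by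
      rw [toSmooth_frame, toSmooth_frame]
      exact L.realSkew_anchor_bracket _ _ hx)
    (fun x₀ a b c x _ => by
      rw [toSmooth_frame, toSmooth_frame, toSmooth_frame]
      exact L.realSkew_jacobi _ _ _ x)

theorem isUnderlyingReal_realify : L.IsUnderlyingReal L.realify :=
  ⟨fun _ _ => rfl, fun _ V W => L.realBracket_toSmooth V W⟩

theorem realify_bracket_apply {U : Opens X} (V W : LocalSections ∞ 𝓘(ℝ, E) F A U) {x₀ x : X}
    (hx : x ∈ U) (hx₀ : x ∈ trivOpens F A x₀) :
    (L.realify.bracket U V W).1 x = L.localBracket x₀ x V.1 W.1 :=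
  L.realBracket_apply V W hx hx₀

variable {L}

/-- The local formula expresses the bracket through the anchor and the brackets of frames, and both
are prescribed by `L`. -/
theorem IsUnderlyingReal.eq_realify {R : LieAlgebroid ∞ 𝓘(ℝ, E) F A} (hR : L.IsUnderlyingReal R) :
    R = L.realify := by
  have : ContMDiffVectorBundle ∞ F A 𝓘(ℝ, E) := contMDiffVectorBundle_real_top
  refine ext_of hR.anchor_eq fun U V W x hx => ?_
  have h₀ := mem_trivOpens_self F A x
  refine (R.toSkew.bracket_eq le_rfl V W hx h₀).trans (Eq.trans ?_
    (L.realify.toSkew.bracket_eq le_rfl V W hx h₀).symm)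
  have h1 : ∀ a b, (R.toSkew.bracket _ (frame ∞ 𝓘(ℝ, E) F A x a) (frame ∞ 𝓘(ℝ, E) F A x b)) =
      (L.realify.toSkew.bracket _ (frame ∞ 𝓘(ℝ, E) F A x a) (frame ∞ 𝓘(ℝ, E) F A x b)) :=
    fun a b => by
      rw [toSmooth_frame, toSmooth_frame]
      exact (hR.bracket_eq _ _ _).trans (L.isUnderlyingReal_realify.bracket_eq _ _ _).symm
  have h2 : ∀ v, R.toSkew.anchor x v = L.realify.toSkew.anchor x v := hR.anchor_eq x
  rw [h1, h2, h2]

end LieAlgebroid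

end UnderlyingReal

/-! ### Complex multiples of an algebroid and the deformation by `j` -/

section ComplexScaling

open Filter Topology LocalSections

variable {E : Type*} [NormedAddCommGroup E] [NormedSpace ℂ E] [FiniteDimensional ℂ E]
  {X : Type*} [TopologicalSpace X] [ChartedSpace E X] [IsManifold 𝓘(ℂ, E) ω X]
  {F : Type*} [NormedAddCommGroup F] [NormedSpace ℂ F] [FiniteDimensional ℂ F]
  {A : X → Type*} [TopologicalSpace (TotalSpace F A)]
  [∀ x, AddCommGroup (A x)] [∀ x, Module ℂ (A x)] [∀ x, TopologicalSpace (A x)]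
  [FiberBundle F A] [VectorBundle ℂ F A] [ContMDiffVectorBundle ω F A 𝓘(ℂ, E)]

namespace LieAlgebroid

/-- The holomorphic Lie algebroid `(A, c ρ, c [·,·])`, for a complex number `c`. -/
def complexScale (c : ℂ) (L : LieAlgebroid ω 𝓘(ℂ, E) F A) : LieAlgebroid ω 𝓘(ℂ, E) F A where
  anchor x := c • L.anchor x
  contMDiff_anchor := by
    have h := contMDiffOn_fiberwise (I := 𝓘(ℂ, E)) (F := E)
      (A := (TangentSpace 𝓘(ℂ, E) : X → Type _))
      (fun x v => c • v) (c • ContinuousLinearMap.id ℂ E)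
      (fun x₀ x hx v => ((trivializationAt E (TangentSpace 𝓘(ℂ, E)) x₀).linear ℂ hx).map_smul c v)
      L.contMDiff_anchor.contMDiffOn (s := univ)
    exact contMDiffOn_univ.1 h
  bracket U := c • L.bracket U
  bracket_restrict U U' h V W V' W' hV hW x hx := by
    have := L.bracket_restrict U U' h V W V' W' hV hW x hx
    simp [this]
  bracket_self U V := by simp [L.bracket_self]
  jacobi U V W Z := by
    have := L.jacobi U V W Z
    simp only [LinearMap.smul_apply, map_smul]
    rw [← smul_add, ← smul_add, ← smul_add, ← smul_add, this, smul_zero, smul_zero]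
  anchor_bracket U V W x hx := by
    have : CompleteSpace E := FiniteDimensional.complete ℂ E
    have h1 := mlieBracket_const_smul_left (I := 𝓘(ℂ, E)) (c := c)
      (W := fun y => c • L.anchor y (W.1 y)) (L.toSkew.mdifferentiableAt_anchor le_top V hx)
    have h2 := mlieBracket_const_smul_right (I := 𝓘(ℂ, E)) (c := c)
      (V := fun y => L.anchor y (V.1 y)) (L.toSkew.mdifferentiableAt_anchor le_top W hx)
    have h3 := L.anchor_bracket U V W x hx
    change c • L.anchor x (c • (L.bracket U V W).1 x) =
      mlieBracket 𝓘(ℂ, E) (c • fun y => L.anchor y (V.1 y)) (fun y => c • L.anchor y (W.1 y)) x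
    rw [map_smul, h3]
    exact (h1.trans (congrArg (c • ·) h2)).symm
  leibniz U V W f hf x hx := by
    have := L.leibniz U V W f hf x hx
    simp only [LinearMap.smul_apply, map_smul, Submodule.coe_smul, Pi.smul_apply, this, smul_add,
      smul_smul, smul_eq_mul, mul_comm]

theorem complexScale_one (L : LieAlgebroid ω 𝓘(ℂ, E) F A) : L.complexScale 1 = L :=
  ext_of (fun x v => one_smul ℂ (L.anchor x v)) (fun U V W x _ => one_smul ℂ ((L.bracket U V W).1 x))

variable (L : LieAlgebroid ω 𝓘(ℂ, E) F A)

/-- Uniqueness of the underlying real algebroid reduces this to holomorphic sections, where it is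
associativity of scalar multiplication. -/
theorem realify_complexScale_scale (c : ℂ) (d : ℝ) :
    (L.complexScale c).realify.scale d = (L.complexScale (d * c)).realify := by
  refine IsUnderlyingReal.eq_realify ⟨fun x v => ?_, fun U V W => ?_⟩
  · change d • (c • (L.anchor x v : E)) = ((d : ℂ) * c) • (L.anchor x v : E)
    rw [mul_smul, Complex.coe_smul]
  · have h := (L.complexScale c).isUnderlyingReal_realify.bracket_eq U V W
    refine (congrArg (d • ·) h).trans (ext_on fun x _ => ?_)
    change d • (c • (L.bracket U V W).1 x) = ((d : ℂ) * c) • (L.bracket U V W).1 x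
    rw [mul_smul, Complex.coe_smul]

/-- Multiplication by `i` commutes with differentiating coordinates, but the coordinates of `V` are
not assumed holomorphic, so `i` cannot be taken out of the direction `i ρ(W)`. -/
theorem localBracket_jmul_right {U : Opens X} (V : Π x, A x) (W : LocalSections ∞ 𝓘(ℝ, E) F A U)
    {x₀ x : X} (hx : x ∈ U) (hx₀ : x ∈ trivOpens F A x₀) :
    L.localBracket x₀ x V (jmul W).1 = trivSymm x₀ x
        (Complex.I • (mvfderiv 𝓘(ℝ, E) (sectionCoord F x₀ W.1) x (L.anchor x (V x)) : F) -
          mvfderiv 𝓘(ℝ, E) (sectionCoord F x₀ V) x (Complex.I • (L.anchor x (W.1 x) : E))) +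
      Complex.I • L.toSkew.frameBracket x₀ x (sectionCoord F x₀ V x) (sectionCoord F x₀ W.1 x) := by
  have h1 : sectionCoord F x₀ (jmul W).1 =ᶠ[𝓝 x]
      fun y => (Complex.I • ContinuousLinearMap.id ℝ F) (sectionCoord F x₀ W.1 y) := by
    filter_upwards [(trivOpens F A x₀).isOpen.mem_nhds hx₀] with y hy
    exact (isLinearMap_sectionCoord ℂ hy).map_smul Complex.I W.1
  have h2 : ∀ u : E, (mvfderiv 𝓘(ℝ, E) (sectionCoord F x₀ (jmul W).1) x u : F) =
      Complex.I • (mvfderiv 𝓘(ℝ, E) (sectionCoord F x₀ W.1) x u : F) := fun u => by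
    rw [h1.mvfderiv_eq]
    exact congrArg (fun L : E →L[ℝ] F => L u)
      (mvfderiv_clm_comp _ (mdifferentiableAt_sectionCoord_real W hx hx₀))
  have h3 : (L.anchor x ((jmul W).1 x) : E) = Complex.I • (L.anchor x (W.1 x) : E) :=
    map_smul (L.anchor x) Complex.I (W.1 x)
  have h4 : sectionCoord F x₀ (jmul W).1 x = Complex.I • sectionCoord F x₀ W.1 x := h1.eq_of_nhds
  rw [localBracket, h4, map_smul]
  exact congrArg (· + _) (congrArg₂ (fun a b : F => trivSymm x₀ x (a - b)) (h2 _)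
    (congrArg (mvfderiv 𝓘(ℝ, E) (sectionCoord F x₀ V) x) h3))

/-- In `[jV, W] + [V, jW] - j[V, W]` the terms `i ρ(V)W` and `i ρ(W)V` cancel. There remain the
derivatives along `iρ(V)` and `iρ(W)` and one copy of `i c(V, W)`, which is the local bracket of
`iL`. The deformation is therefore a Lie algebroid with no further verification. -/
theorem isDeformation_realify : L.realify.IsDeformation (L.complexScale Complex.I).realify := by
  refine ⟨fun x v => (map_smul (L.anchor x) Complex.I v).symm, fun U V W => ext_on fun x hx => ?_⟩
  have h₀ := mem_trivOpens_self F A x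
  have h1 : (L.realify.bracket U (jmul V) W + L.realify.bracket U V (jmul W) -
      jmul (L.realify.bracket U V W)).1 x = (L.realify.bracket U (jmul V) W).1 x +
      (L.realify.bracket U V (jmul W)).1 x - Complex.I • (L.realify.bracket U V W).1 x := rfl
  rw [h1, L.realify_bracket_apply _ _ hx h₀, L.realify_bracket_apply _ _ hx h₀,
    L.realify_bracket_apply _ _ hx h₀, realify_bracket_apply _ _ _ hx h₀,
    L.localBracket_skew x x (jmul V).1, L.localBracket_jmul_right _ _ hx h₀,
    L.localBracket_jmul_right _ _ hx h₀]
  have hs := isLinearMap_trivSymm ℂ F A x x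
  have h2 : ∀ V W : Π x, A x, (L.complexScale Complex.I).localBracket x x V W = trivSymm x x
      ((mvfderiv 𝓘(ℝ, E) (sectionCoord F x W) x (Complex.I • (L.anchor x (V x) : E)) : F) -
        mvfderiv 𝓘(ℝ, E) (sectionCoord F x V) x (Complex.I • (L.anchor x (W x) : E))) +
      Complex.I • L.toSkew.frameBracket x x (sectionCoord F x V x) (sectionCoord F x W x) :=
    fun _ _ => rfl
  have h3 : ∀ V W : Π x, A x, L.toSkew.frameBracket x x (sectionCoord F x W x)
      (sectionCoord F x V x) = -L.toSkew.frameBracket x x (sectionCoord F x V x)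
      (sectionCoord F x W x) := fun V W => by
    rw [L.toSkew.frameBracket_apply, L.toSkew.frameBracket_apply, L.toSkew.bracket_skew_apply]
  rw [h2, localBracket, h3 V.1 W.1]
  simp only [hs.map_sub, hs.map_smul, smul_add, smul_sub, smul_neg]
  abel

theorem IsDeformation.unique {R D D' : LieAlgebroid ∞ 𝓘(ℝ, E) F A} (h : R.IsDeformation D)
    (h' : R.IsDeformation D') : D = D' :=
  ext_of (fun x v => (h.anchor_eq x v).trans (h'.anchor_eq x v).symm)
    (fun U V W x _ => by rw [h.bracket_eq, h'.bracket_eq])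

/-- The identity isomorphism. -/
def isoRefl (L : LieAlgebroid ∞ 𝓘(ℝ, E) F A) : L.Iso L where
  fiber x := LinearEquiv.refl ℝ (A x)
  contMDiff_fiber := contMDiff_id
  contMDiff_fiber_symm := contMDiff_id
  anchor_comm _ _ := rfl
  bracket_comm U V W V' W' hV hW x := by
    rw [show V' = V from Subtype.ext (funext hV), show W' = W from Subtype.ext (funext hW)]
    rfl

theorem exists_iso_of_eq {L L' : LieAlgebroid ∞ 𝓘(ℝ, E) F A} (h : L = L') :
    ∃ Φ : L.Iso L', ∀ x v, Φ.fiber x v = v := by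
  subst h
  exact ⟨isoRefl L, fun _ _ => rfl⟩

end LieAlgebroid

end ComplexScaling

/-! ### The map `Ψ` in bundle charts -/

section DualIdentification

open Filter Topology LocalSections

variable {E : Type*} [NormedAddCommGroup E] [NormedSpace ℂ E]
  {X : Type*} [TopologicalSpace X] [ChartedSpace E X]
  {F : Type*} [NormedAddCommGroup F] [NormedSpace ℂ F]
  {A : X → Type*} [TopologicalSpace (TotalSpace F A)]
  [∀ x, AddCommGroup (A x)] [∀ x, Module ℂ (A x)] [∀ x, TopologicalSpace (A x)]
  [FiberBundle F A] [VectorBundle ℂ F A]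

theorem dualPsi_apply (ξ : DualTotal ℝ F A) (v : A ξ.1) :
    ((dualPsi F A ξ).2 v : ℂ) = ((ξ.2 v : ℝ) : ℂ) - Complex.I * ((ξ.2 (Complex.I • v) : ℝ) : ℂ) :=
  have := fiber_continuousConstSMul F A ξ.1
  StrongDual.extendRCLike_apply (𝕜 := ℂ) (F := A ξ.1) ξ.2 v

theorem re_dualPsi_apply (ξ : DualTotal ℝ F A) (v : A ξ.1) :
    ((dualPsi F A ξ).2 v : ℂ).re = ξ.2 v :=
  have := fiber_continuousConstSMul F A ξ.1
  StrongDual.re_extendRCLike_apply (𝕜 := ℂ) (F := A ξ.1) ξ.2 v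

/-- The trivializations of `A` are complex linear, so they commute with `j`, and `Ψ` becomes the
same constant map of model fibers everywhere. -/
theorem dualCoord_dualPsi {x₀ : X} {ξ : DualTotal ℝ F A} (hx : ξ.1 ∈ trivOpens F A x₀) :
    dualCoord x₀ (dualPsi F A ξ) =
      StrongDual.extendRCLikeL (𝕜 := ℂ) (F := F) (dualCoord x₀ ξ) := by
  have h : ∀ a, ((StrongDual.extendRCLikeL (𝕜 := ℂ) (F := F) (dualCoord x₀ ξ)) a : ℂ) =
      ((dualCoord x₀ ξ a : ℝ) : ℂ) - Complex.I * ((dualCoord x₀ ξ (Complex.I • a) : ℝ) : ℂ) :=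
    fun a => StrongDual.extendRCLike_apply (𝕜 := ℂ) (F := F) (dualCoord x₀ ξ) a
  ext a
  rw [h, dualCoord_apply hx, dualCoord_apply hx,
    (isLinearMap_trivSymm ℂ F A x₀ ξ.1).map_smul]
  exact (dualCoord_apply (ξ := dualPsi F A ξ) hx a).trans (dualPsi_apply ξ _)

/-- In the bundle charts at `ξ` and at its image, `Ψ` is the restriction of one linear map near `ξ`,
hence equal to its own derivative. -/
theorem hasMFDerivAt_dualPsi (ξ : DualTotal ℝ F A) :
    HasMFDerivAt (𝓘(ℝ, E).prod 𝓘(ℝ, F →L[ℝ] ℝ)) (𝓘(ℝ, E).prod 𝓘(ℝ, F →L[ℂ] ℂ)) (dualPsi F A) ξ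
      ((ContinuousLinearMap.id ℝ E).prodMap
        (StrongDual.extendRCLikeL (𝕜 := ℂ) (F := F) : (F →L[ℝ] ℝ) →L[ℝ] (F →L[ℂ] ℂ))) := by
  have hc : ContinuousAt (dualPsi F A) ξ := by
    refine (FiberBundle.continuousAt_totalSpace _ _).2 ⟨continuous_dualProj.continuousAt, ?_⟩
    have h1 : ContinuousAt (fun ζ : DualTotal ℝ F A =>
        StrongDual.extendRCLikeL (𝕜 := ℂ) (F := F) (dualCoord ξ.1 ζ)) ξ := by
      refine (StrongDual.extendRCLikeL (𝕜 := ℂ) (F := F)).continuous.continuousAt.comp ?_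
      exact ((FiberBundle.continuousAt_totalSpace (F →L[ℝ] ℝ) (fun ζ : DualTotal ℝ F A => ζ)).1
        continuousAt_id).2
    refine h1.congr ?_
    filter_upwards [eventually_mem_trivOpens (mem_trivOpens_self F A ξ.1)] with ζ hζ
    exact (dualCoord_dualPsi hζ).symm
  refine ⟨hc, HasFDerivAt.hasFDerivWithinAt ?_⟩
  refine (((ContinuousLinearMap.id ℝ E).prodMap
    (StrongDual.extendRCLikeL (𝕜 := ℂ) (F := F) :
      (F →L[ℝ] ℝ) →L[ℝ] (F →L[ℂ] ℂ))).hasFDerivAt).congr_of_eventuallyEq ?_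
  have hcs : Tendsto (extChartAt (𝓘(ℝ, E).prod 𝓘(ℝ, F →L[ℝ] ℝ)) ξ).symm
      (𝓝 (extChartAt (𝓘(ℝ, E).prod 𝓘(ℝ, F →L[ℝ] ℝ)) ξ ξ)) (𝓝 ξ) := by
    have := continuousAt_extChartAt_symm (I := 𝓘(ℝ, E).prod 𝓘(ℝ, F →L[ℝ] ℝ)) ξ
    rwa [ContinuousAt, extChartAt_to_inv ξ] at this
  have hev := hcs.eventually (p := fun ζ => ζ.1 ∈ trivOpens F A ξ.1)
    (eventually_mem_trivOpens (mem_trivOpens_self F A ξ.1))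
  filter_upwards [extChartAt_target_mem_nhds (I := 𝓘(ℝ, E).prod 𝓘(ℝ, F →L[ℝ] ℝ)) ξ, hev] with y hy hy'
  have h := (extChartAt (𝓘(ℝ, E).prod 𝓘(ℝ, F →L[ℝ] ℝ)) ξ).right_inv hy
  rw [extChartAt_dual] at h
  have h2 := extChartAt_dual (I := 𝓘(ℂ, E)) (dualPsi F A ξ)
    (dualPsi F A ((extChartAt (𝓘(ℝ, E).prod 𝓘(ℝ, F →L[ℝ] ℝ)) ξ).symm y))
  have ha : extChartAt 𝓘(ℝ, E) ξ.1
      ((extChartAt (𝓘(ℝ, E).prod 𝓘(ℝ, F →L[ℝ] ℝ)) ξ).symm y).1 = y.1 := congrArg Prod.fst h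
  have hb : dualCoord ξ.1 ((extChartAt (𝓘(ℝ, E).prod 𝓘(ℝ, F →L[ℝ] ℝ)) ξ).symm y) = y.2 :=
    congrArg Prod.snd h
  exact h2.trans (Prod.ext ha ((dualCoord_dualPsi hy').trans (congrArg _ hb)))

theorem affFun_toSmooth {U : Opens X} (V : LocalSections ω 𝓘(ℂ, E) F A U) (f : X → ℂ)
    (ξ : DualTotal ℝ F A) :
    affFun (toSmooth V) (fun x => (f x).re) ξ = (affFun V f (dualPsi F A ξ)).re :=
  congrArg (· + (f ξ.1).re) (re_dualPsi_apply ξ (V.1 ξ.1)).symm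

end DualIdentification

/-! ### Real and imaginary parts of the holomorphic Lie–Poisson tensor -/

section RealPartOfLiePoisson

open Filter Topology LocalSections

variable {E : Type*} [NormedAddCommGroup E] [NormedSpace ℂ E] [FiniteDimensional ℂ E]
  {X : Type*} [TopologicalSpace X] [ChartedSpace E X] [IsManifold 𝓘(ℂ, E) ω X]
  {F : Type*} [NormedAddCommGroup F] [NormedSpace ℂ F] [FiniteDimensional ℂ F]
  {A : X → Type*} [TopologicalSpace (TotalSpace F A)]
  [∀ x, AddCommGroup (A x)] [∀ x, Module ℂ (A x)] [∀ x, TopologicalSpace (A x)]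
  [FiberBundle F A] [VectorBundle ℂ F A]

/-- A real covector is twice the real part of its `(1,0)`-part. A bivector takes two covectors, so
this factor enters squared and produces the `4` of the theorem. -/
theorem re_covector10_apply {V : Type*} [NormedAddCommGroup V] [NormedSpace ℂ V] (α : V →L[ℝ] ℝ)
    (v : V) : 2 * (covector10 V α v).re = α v := by
  have h : covector10 V α v = ((1 / 2 : ℝ) : ℂ) • (StrongDual.extendRCLike (𝕜 := ℂ) α v) := by
    rw [Complex.coe_smul]; rfl
  rw [h, smul_eq_mul, Complex.re_ofReal_mul]
  have := StrongDual.re_extendRCLike_apply (𝕜 := ℂ) α v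
  rw [RCLike.re_eq_complex_re] at this
  rw [this]
  ring

variable (E F) in
/-- The differential of the identification of the real and the complex dual bundle in bundle
charts. -/
def dualPsiEquiv : (E × (F →L[ℝ] ℝ)) ≃L[ℝ] E × (F →L[ℂ] ℂ) :=
  (ContinuousLinearEquiv.refl ℝ E).prodCongr StrongDual.extendRCLikeL

theorem inverse_mfderiv_dualPsi {ξ : DualTotal ℝ F A}
    {T : (E × (F →L[ℝ] ℝ)) →L[ℝ] (E × (F →L[ℂ] ℂ))}
    (hT : T = mfderiv (𝓘(ℝ, E).prod 𝓘(ℝ, F →L[ℝ] ℝ)) (𝓘(ℝ, E).prod 𝓘(ℝ, F →L[ℂ] ℂ))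
      (dualPsi F A) ξ) :
    T.inverse = ((dualPsiEquiv E F).symm : (E × (F →L[ℂ] ℂ)) →L[ℝ] (E × (F →L[ℝ] ℝ))) := by
  have h : T = (dualPsiEquiv E F : (E × (F →L[ℝ] ℝ)) →L[ℝ] (E × (F →L[ℂ] ℂ))) :=
    hT.trans (hasMFDerivAt_dualPsi ξ).mfderiv
  rw [h, ContinuousLinearMap.inverse_equiv]

/-- The complex covector corresponding to a real covector on the real dual bundle. -/
def dualCovector (α : E × (F →L[ℝ] ℝ) →L[ℝ] ℝ) : E × (F →L[ℂ] ℂ) →L[ℂ] ℂ :=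
  covector10 (E × (F →L[ℂ] ℂ)) (α ∘L ((dualPsiEquiv E F).symm : (E × (F →L[ℂ] ℂ)) →L[ℝ] (E × (F →L[ℝ] ℝ))))

theorem dualRe_apply (P : CotangentForm (𝓘(ℂ, E).prod 𝓘(ℂ, F →L[ℂ] ℂ)) (DualTotal ℂ F A))
    (ξ : DualTotal ℝ F A) (α β : E × (F →L[ℝ] ℝ) →L[ℝ] ℝ) :
    dualRe P ξ α β = (P (dualPsi F A ξ) (dualCovector α) (dualCovector β)).re := by
  have h := inverse_mfderiv_dualPsi (E := E) (ξ := ξ) rfl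
  exact congrArg (fun T : E × (F →L[ℂ] ℂ) →L[ℝ] E × (F →L[ℝ] ℝ) =>
    (P (dualPsi F A ξ) (covector10 (E × (F →L[ℂ] ℂ)) (α ∘L T))
      (covector10 (E × (F →L[ℂ] ℂ)) (β ∘L T))).re) h

theorem dualIm_apply (P : CotangentForm (𝓘(ℂ, E).prod 𝓘(ℂ, F →L[ℂ] ℂ)) (DualTotal ℂ F A))
    (ξ : DualTotal ℝ F A) (α β : E × (F →L[ℝ] ℝ) →L[ℝ] ℝ) :
    dualIm P ξ α β = (P (dualPsi F A ξ) (dualCovector α) (dualCovector β)).im := by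
  have h := inverse_mfderiv_dualPsi (E := E) (ξ := ξ) rfl
  exact congrArg (fun T : E × (F →L[ℂ] ℂ) →L[ℝ] E × (F →L[ℝ] ℝ) =>
    (P (dualPsi F A ξ) (covector10 (E × (F →L[ℂ] ℂ)) (α ∘L T))
      (covector10 (E × (F →L[ℂ] ℂ)) (β ∘L T))).im) h

variable [ContMDiffVectorBundle ω F A 𝓘(ℂ, E)]

theorem mvfderiv_affFun_toSmooth {U : Opens X} (V : LocalSections ω 𝓘(ℂ, E) F A U) {f : X → ℂ}
    {ξ : DualTotal ℝ F A} (hx : ξ.1 ∈ U) (hf : ContMDiffAt 𝓘(ℂ, E) 𝓘(ℂ, ℂ) ω f ξ.1)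
    {γ : E × (F →L[ℂ] ℂ) →L[ℂ] ℂ}
    (hγ : mvfderiv (𝓘(ℂ, E).prod 𝓘(ℂ, F →L[ℂ] ℂ)) (affFun V f) (dualPsi F A ξ) = γ)
    (u : E × (F →L[ℝ] ℝ)) :
    mvfderiv (𝓘(ℝ, E).prod 𝓘(ℝ, F →L[ℝ] ℝ)) (affFun (toSmooth V) fun x => (f x).re) ξ u =
      (γ (dualPsiEquiv E F u)).re := by
  have h1 : MDifferentiableAt (𝓘(ℂ, E).prod 𝓘(ℂ, F →L[ℂ] ℂ)) 𝓘(ℂ, ℂ) (affFun V f) (dualPsi F A ξ) :=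
    (contMDiffAt_affFun (ξ := dualPsi F A ξ) V hx hf).mdifferentiableAt (by simp)
  have h2 : HasMFDerivAt (𝓘(ℂ, E).prod 𝓘(ℂ, F →L[ℂ] ℂ)) 𝓘(ℂ, ℂ) (affFun V f) (dualPsi F A ξ) γ := by
    rw [← hγ]; exact h1.hasMFDerivAt_mvfderiv
  have h3 : HasMFDerivAt (𝓘(ℝ, E).prod 𝓘(ℝ, F →L[ℂ] ℂ)) 𝓘(ℝ, ℂ) (affFun V f) (dualPsi F A ξ)
      (γ.restrictScalars ℝ) := ⟨h2.1, HasFDerivWithinAt.restrictScalars ℝ h2.2⟩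
  have h4 := HasMFDerivAt.comp ξ (Complex.reCLM.hasMFDerivAt)
    (HasMFDerivAt.comp ξ h3 (hasMFDerivAt_dualPsi ξ))
  have h5 : (affFun (toSmooth V) fun x => (f x).re) =
      Complex.reCLM ∘ affFun V f ∘ dualPsi F A := funext fun ζ => affFun_toSmooth V f ζ
  rw [h5]
  exact congrArg (fun L : E × (F →L[ℝ] ℝ) →L[ℝ] ℝ => L u) h4.mvfderiv_eq

namespace LieAlgebroid

variable (L : LieAlgebroid ω 𝓘(ℂ, E) F A)

theorem realify_deriv_re {U : Opens X} (V : LocalSections ω 𝓘(ℂ, E) F A U) {f : X → ℂ} {x : X}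
    (hf : ContMDiffAt 𝓘(ℂ, E) 𝓘(ℂ, ℂ) ω f x) :
    L.realify.deriv (toSmooth V) (fun y => (f y).re) x = (L.deriv V f x).re := by
  have h1 : MDifferentiableAt 𝓘(ℂ, E) 𝓘(ℂ, ℂ) f x := hf.mdifferentiableAt (by simp)
  have h2 : MDifferentiableAt 𝓘(ℝ, E) 𝓘(ℝ, ℂ) f x :=
    (h1.hasMFDerivAt_mvfderiv.restrictScalars_real).mdifferentiableAt
  refine (congrArg (fun T : E →L[ℝ] ℝ => T (L.anchor x (V.1 x)))
    (mvfderiv_clm_comp Complex.reCLM h2)).trans ?_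
  exact congrArg Complex.re (h1.mvfderiv_real_apply _)

theorem complexScale_deriv (c : ℂ) {U : Opens X} (V : LocalSections ω 𝓘(ℂ, E) F A U) (f : X → ℂ)
    (x : X) : (L.complexScale c).deriv V f x = c * L.deriv V f x :=
  map_smul (mvfderiv 𝓘(ℂ, E) f x) c (L.anchor x (V.1 x))

/-- Both tensors are evaluated on real parts of holomorphic affine functions whose complex
differentials are the `(1,0)`-parts of the given covectors. The holomorphic bracket enters through
its real part, and the real parts of `l_V` and of derivatives along the anchor are their real
counterparts. -/
theorem dualRe_liePoisson :
    dualRe L.liePoisson = (L.complexScale (1 / 4)).realify.liePoisson := by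
  have := contMDiffVectorBundle_real_top (E := E) (F := F) (A := A)
  have : ContMDiffVectorBundle 1 F A 𝓘(ℂ, E) := ContMDiffVectorBundle.of_le (n := ω) le_top
  funext ξ
  refine LinearMap.ext fun (α : E × (F →L[ℝ] ℝ) →L[ℝ] ℝ) =>
    LinearMap.ext fun (β : E × (F →L[ℝ] ℝ) →L[ℝ] ℝ) => ?_
  have hx := mem_trivOpens_self F A ξ.1
  let V (α : E × (F →L[ℝ] ℝ) →L[ℝ] ℝ) := frame ω 𝓘(ℂ, E) F A ξ.1 (vertPart (dualCovector α))
  let f (α : E × (F →L[ℝ] ℝ) →L[ℝ] ℝ) : X → ℂ := coordFun 𝓘(ℂ, E) ξ.1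
    (dualCovector α ∘L ContinuousLinearMap.inl ℂ E (F →L[ℂ] ℂ))
  have hf : ∀ α, ContMDiffAt 𝓘(ℂ, E) 𝓘(ℂ, ℂ) ω (f α) ξ.1 := fun α =>
    contMDiffAt_coordFun _ _ (mem_chart_source E ξ.1)
  have hf' : ∀ α, ContMDiffAt 𝓘(ℝ, E) 𝓘(ℝ, ℝ) ∞ (fun x => (f α x).re) ξ.1 := fun α =>
    Complex.reCLM.contMDiff.contMDiffAt.comp ξ.1 ((hf α).restrictScalars_real.of_le le_top)
  have hγ : ∀ α, mvfderiv (𝓘(ℂ, E).prod 𝓘(ℂ, F →L[ℂ] ℂ)) (affFun (V α) (f α)) (dualPsi F A ξ) =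
      dualCovector α := fun α => mvfderiv_affFun_frame (dualPsi F A ξ) (dualCovector α)
  -- The covector is twice the differential of the real part of the affine function chosen for it.
  have hα : ∀ α : E × (F →L[ℝ] ℝ) →L[ℝ] ℝ,
      (2 : ℝ) • (mvfderiv (𝓘(ℝ, E).prod 𝓘(ℝ, F →L[ℝ] ℝ))
        (affFun (toSmooth (V α)) fun x => (f α x).re) ξ : E × (F →L[ℝ] ℝ) →L[ℝ] ℝ) = α := by
    intro α
    ext u
    refine (congrArg (2 * ·) (mvfderiv_affFun_toSmooth (V α) hx (hf α) (hγ α) u)).trans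
      ((re_covector10_apply _ _).trans ?_)
    exact congrArg α ((dualPsiEquiv E F).symm_apply_apply u)
  have h1 : dualRe L.liePoisson ξ α β =
      (L.liePoisson.bracket (affFun (V α) (f α)) (affFun (V β) (f β)) (dualPsi F A ξ)).re := by
    rw [dualRe_apply, CotangentForm.bracket, hγ, hγ]
  -- The factor `4` collected here is compensated by scaling `L` with `1 / 4`.
  have h2 : ∀ R : LieAlgebroid ∞ 𝓘(ℝ, E) F A, R.liePoisson ξ α β = 4 * R.liePoisson.bracket
      (affFun (toSmooth (V α)) fun x => (f α x).re)
      (affFun (toSmooth (V β)) fun x => (f β x).re) ξ := by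
    intro R
    have h : ∀ (B : (E × (F →L[ℝ] ℝ) →L[ℝ] ℝ) →ₗ[ℝ] (E × (F →L[ℝ] ℝ) →L[ℝ] ℝ) →ₗ[ℝ] ℝ) (a b),
        B ((2 : ℝ) • a) ((2 : ℝ) • b) = 4 * B a b := fun B a b => by
      rw [map_smul, map_smul, LinearMap.smul_apply, smul_eq_mul, smul_eq_mul, ← mul_assoc]
      norm_num
    refine Eq.trans ?_ (h (R.liePoisson ξ) _ _)
    exact congrArg₂ (fun a b : E × (F →L[ℝ] ℝ) →L[ℝ] ℝ => R.liePoisson ξ a b) (hα α).symm (hα β).symm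
  rw [h1, h2, L.liePoisson_bracket_affFun le_top (ξ := dualPsi F A ξ) _ _ hx (hf α) (hf β),
    liePoisson_bracket_affFun _ le_rfl _ _ hx (hf' α) (hf' β),
    (L.complexScale (1 / 4)).isUnderlyingReal_realify.bracket_eq]
  rw [affFun, affFun, dualPull, dualPull, realify_deriv_re _ _ (hf β), realify_deriv_re _ _ (hf α),
    complexScale_deriv, complexScale_deriv]
  have h3 : linFun (toSmooth ((L.complexScale (1 / 4)).bracket (trivOpens F A ξ.1) (V α) (V β))) ξ =
      1 / 4 * ξ.2 ((L.bracket (trivOpens F A ξ.1) (V α) (V β)).1 ξ.1) := by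
    have h : (((1 / 4 : ℝ) : ℂ)) • ((L.bracket (trivOpens F A ξ.1) (V α) (V β)).1 ξ.1) =
      (1 / 4 : ℝ) • ((L.bracket (trivOpens F A ξ.1) (V α) (V β)).1 ξ.1) := Complex.coe_smul _ _
    rw [show ((1 / 4 : ℝ) : ℂ) = 1 / 4 by norm_num] at h
    exact (congrArg ξ.2 h).trans (map_smul ξ.2 _ _)
  have h4 : ∀ z : ℂ, (1 / 4 * z).re = 1 / 4 * z.re := fun z => by
    rw [show (1 / 4 : ℂ) = ((1 / 4 : ℝ) : ℂ) by norm_num, Complex.re_ofReal_mul]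
  rw [h3, h4, h4, Complex.add_re, Complex.sub_re]
  have h5 : (linFun (L.bracket (trivOpens F A ξ.1) (V α) (V β)) (dualPsi F A ξ)).re =
    ξ.2 ((L.bracket (trivOpens F A ξ.1) (V α) (V β)).1 ξ.1) := re_dualPsi_apply ξ _
  refine (congrArg (· + _) h5).trans ?_
  have h6 : (dualPsi F A ξ).1 = ξ.1 := rfl
  rw [h6]
  ring

/-- `Im z = Re(-i z)`, and the Lie–Poisson tensor is linear in the pair of anchor and bracket, so
`-i` can be moved into the algebroid. -/
theorem dualIm_liePoisson :
    dualIm L.liePoisson = dualRe (L.complexScale (-Complex.I)).liePoisson := by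
  funext ξ
  refine LinearMap.ext fun (α : E × (F →L[ℝ] ℝ) →L[ℝ] ℝ) =>
    LinearMap.ext fun (β : E × (F →L[ℝ] ℝ) →L[ℝ] ℝ) => ?_
  have h : ∀ γ δ : E × (F →L[ℂ] ℂ) →L[ℂ] ℂ,
      (L.complexScale (-Complex.I)).liePoisson (dualPsi F A ξ) γ δ =
        -Complex.I * L.liePoisson (dualPsi F A ξ) γ δ := by
    intro γ δ
    have h1 : ∀ (c : ℂ) (γ : E × (F →L[ℂ] ℂ) →L[ℂ] ℂ) (v : E), γ (c • v, 0) = c * γ (v, 0) :=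
      fun c γ v => by
        have := map_smul γ c (v, 0)
        rwa [Prod.smul_mk, smul_zero] at this
    refine ((L.complexScale (-Complex.I)).toSkew.dualBivector_apply (dualPsi F A ξ) γ δ).trans
      (Eq.trans ?_ (congrArg (-Complex.I * ·)
        (L.toSkew.dualBivector_apply (dualPsi F A ξ) γ δ)).symm)
    refine (congrArg₂ (· + ·) (map_smul (dualPsi F A ξ).2 (-Complex.I) _)
      (congrArg₂ (fun a b : ℂ => a - b) (h1 (-Complex.I) δ _) (h1 (-Complex.I) γ _))).trans ?_
    rw [mul_add, mul_sub]
    rfl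
  rw [dualIm_apply, dualRe_apply, h, neg_mul, Complex.neg_re, Complex.I_mul_re, neg_neg]

end LieAlgebroid

end RealPartOfLiePoisson

/-! ### Identification of the real algebroids and their scalings -/

section RealAndImaginaryParts

open LocalSections

variable {E : Type*} [NormedAddCommGroup E] [NormedSpace ℂ E] [FiniteDimensional ℂ E]
  {X : Type*} [TopologicalSpace X] [ChartedSpace E X] [IsManifold 𝓘(ℂ, E) ω X]
  {F : Type*} [NormedAddCommGroup F] [NormedSpace ℂ F] [FiniteDimensional ℂ F]
  {A : X → Type*} [TopologicalSpace (TotalSpace F A)]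
  [∀ x, AddCommGroup (A x)] [∀ x, Module ℂ (A x)] [∀ x, TopologicalSpace (A x)]
  [FiberBundle F A] [VectorBundle ℂ F A] [ContMDiffVectorBundle ω F A 𝓘(ℂ, E)]

namespace LieAlgebroid

theorem complexScale_complexScale (c d : ℂ) (L : LieAlgebroid ω 𝓘(ℂ, E) F A) :
    (L.complexScale c).complexScale d = L.complexScale (d * c) :=
  ext_of (fun x v => (mul_smul d c (L.anchor x v)).symm)
    (fun U V W x _ => (mul_smul d c ((L.bracket U V W).1 x)).symm)

theorem isLiePoisson_liePoisson_real (R : LieAlgebroid ∞ 𝓘(ℝ, E) F A) :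
    R.IsLiePoisson R.liePoisson :=
  haveI : FiniteDimensional ℝ E := FiniteDimensional.complexToReal E
  haveI : FiniteDimensional ℝ F := FiniteDimensional.complexToReal F
  haveI : IsManifold 𝓘(ℝ, E) ∞ X := IsManifold.of_le (n := ω) le_top
  haveI : ContMDiffVectorBundle ∞ F A 𝓘(ℝ, E) := contMDiffVectorBundle_real_top
  R.isLiePoisson_liePoisson le_rfl

theorem IsLiePoisson.algebroid_unique_real {R R' : LieAlgebroid ∞ 𝓘(ℝ, E) F A}
    {P : CotangentForm (𝓘(ℝ, E).prod 𝓘(ℝ, F →L[ℝ] ℝ)) (DualTotal ℝ F A)}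
    (hR : R.IsLiePoisson P) (hR' : R'.IsLiePoisson P) : R = R' :=
  haveI : FiniteDimensional ℝ E := FiniteDimensional.complexToReal E
  haveI : FiniteDimensional ℝ F := FiniteDimensional.complexToReal F
  haveI : IsManifold 𝓘(ℝ, E) ∞ X := IsManifold.of_le (n := ω) le_top
  haveI : ContMDiffVectorBundle ∞ F A 𝓘(ℝ, E) := contMDiffVectorBundle_real_top
  hR.algebroid_unique hR'

variable (L : LieAlgebroid ω 𝓘(ℂ, E) F A)

theorem isLiePoisson_dualRe :
    (L.complexScale (1 / 4)).realify.IsLiePoisson (dualRe L.liePoisson) := by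
  rw [L.dualRe_liePoisson]
  exact isLiePoisson_liePoisson_real _

theorem isLiePoisson_dualIm :
    ((L.complexScale (-Complex.I)).complexScale (1 / 4)).realify.IsLiePoisson
      (dualIm L.liePoisson) := by
  rw [L.dualIm_liePoisson]
  exact isLiePoisson_dualRe _

theorem realify_scale_re : (L.complexScale (1 / 4)).realify.scale 4 = L.realify := by
  rw [realify_complexScale_scale]
  have h : ((4 : ℝ) : ℂ) * (1 / 4) = 1 := by norm_num
  rw [h, complexScale_one]

/-- The constants multiply to `(-4) · (1/4) · (-i) = i`, which explains the sign in the imaginary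
case. -/
theorem realify_scale_im :
    ((L.complexScale (-Complex.I)).complexScale (1 / 4)).realify.scale (-4) =
      (L.complexScale Complex.I).realify := by
  rw [realify_complexScale_scale, complexScale_complexScale]
  have h : ((-4 : ℝ) : ℂ) * (1 / 4) * -Complex.I = Complex.I := by push_cast; ring
  rw [h]

end LieAlgebroid

end RealAndImaginaryParts

end

theorem mainTheorem5
    {E : Type*} [NormedAddCommGroup E] [NormedSpace ℂ E] [FiniteDimensional ℂ E]
    {X : Type*} [TopologicalSpace X] [ChartedSpace E X] [IsManifold 𝓘(ℂ, E) ω X]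
    {F : Type*} [NormedAddCommGroup F] [NormedSpace ℂ F] [FiniteDimensional ℂ F]
    {A : X → Type*} [TopologicalSpace (TotalSpace F A)]
    [∀ x, AddCommGroup (A x)] [∀ x, Module ℂ (A x)] [∀ x, TopologicalSpace (A x)]
    [FiberBundle F A] [VectorBundle ℂ F A] [ContMDiffVectorBundle ω F A 𝓘(ℂ, E)]
    (L : LieAlgebroid ω 𝓘(ℂ, E) F A) :
    -- the fiberwise linear holomorphic Poisson structure on the complex dual of `A`
    (∃! P : CotangentForm (𝓘(ℂ, E).prod 𝓘(ℂ, F →L[ℂ] ℂ)) (DualTotal ℂ F A), L.IsLiePoisson P) ∧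
    -- the underlying real Lie algebroid
    (∃! AR : LieAlgebroid ∞ 𝓘(ℝ, E) F A, L.IsUnderlyingReal AR) ∧
    ∀ (P : CotangentForm (𝓘(ℂ, E).prod 𝓘(ℂ, F →L[ℂ] ℂ)) (DualTotal ℂ F A))
      (AR : LieAlgebroid ∞ 𝓘(ℝ, E) F A), L.IsLiePoisson P → L.IsUnderlyingReal AR →
      -- its deformation by `j`
      (∃! AI : LieAlgebroid ∞ 𝓘(ℝ, E) F A, AR.IsDeformation AI) ∧
      -- the real Lie algebroids defined by the real and imaginary parts of `P`
      (∃! ARe : LieAlgebroid ∞ 𝓘(ℝ, E) F A, ARe.IsLiePoisson (dualRe P)) ∧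
      (∃! AIm : LieAlgebroid ∞ 𝓘(ℝ, E) F A, AIm.IsLiePoisson (dualIm P)) ∧
      ∀ AI ARe AIm : LieAlgebroid ∞ 𝓘(ℝ, E) F A,
        AR.IsDeformation AI → ARe.IsLiePoisson (dualRe P) → AIm.IsLiePoisson (dualIm P) →
        (∃ Φ : (ARe.scale 4).Iso AR, ∀ x v, Φ.fiber x v = v) ∧
        (∃ Φ : (AIm.scale (-4)).Iso AI, ∀ x v, Φ.fiber x v = v) := by
  refine ⟨⟨L.liePoisson, L.isLiePoisson_liePoisson le_top, fun P hP => hP.eq_liePoisson le_top⟩,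
    ⟨L.realify, L.isUnderlyingReal_realify, fun R hR => hR.eq_realify⟩, fun P AR hP hAR => ?_⟩
  obtain rfl := hP.eq_liePoisson le_top
  obtain rfl := hAR.eq_realify
  refine ⟨⟨_, L.isDeformation_realify, fun AI hAI => hAI.unique L.isDeformation_realify⟩,
    ⟨_, L.isLiePoisson_dualRe, fun R hR => hR.algebroid_unique_real L.isLiePoisson_dualRe⟩,
    ⟨_, L.isLiePoisson_dualIm, fun R hR => hR.algebroid_unique_real L.isLiePoisson_dualIm⟩,
    fun AI ARe AIm hAI hRe hIm => ?_⟩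
  -- Uniqueness replaces each algebroid by its explicit realification of a multiple of `L`; both
  -- claims then become equalities of algebroids.
  obtain rfl := hAI.unique L.isDeformation_realify
  obtain rfl := hRe.algebroid_unique_real L.isLiePoisson_dualRe
  obtain rfl := hIm.algebroid_unique_real L.isLiePoisson_dualIm
  exact ⟨LieAlgebroid.exists_iso_of_eq L.realify_scale_re,
    LieAlgebroid.exists_iso_of_eq L.realify_scale_im⟩
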